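/- Let $G=\mathrm{SL}_2(\mathbb C)$ act on $\mathbb P^1=\mathbb P(\mathbb C^2)$, let $\|g\|$ be the operator norm of $g\in G$ for the Euclidean norm on $\mathbb C^2$, let $\sigma_g(x)=\log\frac{\|gv\|}{\|v\|}$ for $x=[v]\in\mathbb P^1$, and write $g^*u(x)=u(gx)$. Let $\omega_{\mathrm{FS}}$ be the Fubini–Study form on $\mathbb P^1$, normalized to have total mass one. Let $W^{1,2}$ be the Sobolev space of (classes modulo $\omega_{\mathrm{FS}}$-null sets of) functions $u\in L^2(\mathbb P^1,\omega_{\mathrm{FS}})$ with values in $\mathbb C$ whose distributional derivative $\partial u$ is a $(1,0)$-form with $L^2$ coefficients, with the norm $$\|u\|_{W^{1,2}}=\Big|\int_{\mathbb P^1}u\,\omega_{\mathrm{FS}}\Big|+\|\partial u\|_{L^2},\qquad \|\partial u\|_{L^2}=\Big(\int_{\mathbb P^1} i\,\partial u\wedge\overline{\partial u}\Big)^{1/2}.$$ Let $p\ge 1$ be real and let $\mu$ be a Borel probability measure on $G$ with $\int_G\log^p\|g\|\,d\mu(g)<\infty$. For $\xi\in\mathbb R$ and integers $0\le k\le\lfloor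 p-1\rfloor$ put $$\mathcal P^{(k)}_\xi u(x)=\int_G (i\sigma_g(x))^k\,e^{i\xi\sigma_g(x)}\,(g^*u)(x)\,d\mu(g),\qquad \mathcal P_\xi=\mathcal P_\xi^{(0)} .$$ Then for every $u\in W^{1,2}$ the integral defining $\mathcal P^{(k)}_\xi u(x)$ converges absolutely for almost every $x$, each $\mathcal P^{(k)}_\xi$ is a bounded operator on $W^{1,2}$, and the family $\xi\mapsto\mathcal P_\xi$ is continuous for the operator norm. If $p\ge 2$, this family is $\lfloor p-1\rfloor$ times differentiable in $\xi\in\mathbb R$ for the operator norm, and $\frac{d^k}{d\xi^k}\mathcal P_\xi=\mathcal P_\xi^{(k)}$ for $k=0,1,\dots,\lfloor p-1\rfloor$. -/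

import Mathlib

open MeasureTheory Filter Topology
open scoped LinearAlgebra.Projectivization ContDiff Matrix

noncomputable section

namespace SobolevP1

/-! ### The projective line, the action of `SL₂(ℂ)` and the norm cocycle -/

/-- The group `SL₂(ℂ)`. -/
abbrev SL2C : Type := Matrix.SpecialLinearGroup (Fin 2) ℂ

/-- The complex projective line: lines in `ℂ²`, on which `SL₂(ℂ)` acts by `g • [v] = [g v]`
(Mathlib's action on a projectivization). -/
abbrev P1 : Type := ℙ ℂ (Fin 2 → ℂ)

/-- The quotient topology on `ℙ¹`. -/
instance : TopologicalSpace P1 :=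
  TopologicalSpace.coinduced (Projectivization.mk' ℂ (V := Fin 2 → ℂ)) inferInstance

/-- The Borel `σ`-algebra on `ℙ¹`. -/
instance : MeasurableSpace P1 := borel P1

instance : BorelSpace P1 := ⟨rfl⟩

/-- The Euclidean (hermitian) norm on `ℂ²`. -/
def vnorm (v : Fin 2 → ℂ) : ℝ := ‖WithLp.toLp 2 v‖

/-- The operator norm of `g ∈ SL₂(ℂ)` for the Euclidean norm on `ℂ²`. -/
def opNorm (g : SL2C) : ℝ := ‖Matrix.toEuclideanCLM (n := Fin 2) (𝕜 := ℂ) g.1‖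

/-- The norm cocycle `σ_g(x) = log (‖g v‖ / ‖v‖)`, where `x = [v]`; it does not depend on the
choice of `v`, see `cocycle_mk`. -/
def cocycle (g : SL2C) (x : P1) : ℝ :=
  Real.log (vnorm (g.1 *ᵥ x.rep) / vnorm x.rep)

theorem cocycle_mk (g : SL2C) (v : Fin 2 → ℂ) (hv : v ≠ 0) :
    cocycle g (Projectivization.mk ℂ v hv) = Real.log (vnorm (g.1 *ᵥ v) / vnorm v) := by
  obtain ⟨a, ha⟩ := Projectivization.exists_smul_eq_mk_rep ℂ v hv
  have h0 : ‖(a : ℂ)‖ ≠ 0 := by simp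
  unfold cocycle vnorm
  rw [← ha, Units.smul_def, Matrix.mulVec_smul, WithLp.toLp_smul, WithLp.toLp_smul, norm_smul,
    norm_smul, mul_div_mul_left _ _ h0]

/-! ### Affine charts and the Fubini–Study measure -/

/-- The two standard affine charts `z ↦ [z : 1]` and `z ↦ [1 : z]` of `ℙ¹`. -/
def chart (j : Fin 2) (z : ℂ) : P1 :=
  if j = 0 then Projectivization.mk ℂ ![z, 1] (by simp)
  else Projectivization.mk ℂ ![1, z] (by simp)

theorem continuous_chart (j : Fin 2) : Continuous (chart j) := by
  have hq : Continuous (Projectivization.mk' ℂ (V := Fin 2 → ℂ)) := continuous_coinduced_rng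
  unfold chart
  split_ifs with h
  · have hc : Continuous fun z : ℂ => (![z, 1] : Fin 2 → ℂ) := by fun_prop
    have h2 : Continuous fun z : ℂ =>
        (⟨![z, 1], by simp⟩ : {v : Fin 2 → ℂ // v ≠ 0}) := hc.subtype_mk _
    exact hq.comp h2
  · have hc : Continuous fun z : ℂ => (![1, z] : Fin 2 → ℂ) := by fun_prop
    have h2 : Continuous fun z : ℂ =>
        (⟨![1, z], by simp⟩ : {v : Fin 2 → ℂ // v ≠ 0}) := hc.subtype_mk _
    exact hq.comp h2

theorem measurable_chart (j : Fin 2) : Measurable (chart j) := (continuous_chart j).measurable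

theorem chart_one_eq (z : ℂ) (hz : z ≠ 0) : chart 1 z = chart 0 z⁻¹ := by
  simp only [chart, one_ne_zero, if_false, if_true]
  rw [Projectivization.mk_eq_mk_iff']
  refine ⟨z, ?_⟩
  ext i
  fin_cases i <;> simp [hz]

/-- The density of the Fubini–Study form (of total mass one) with respect to Lebesgue measure `dA`
in the affine coordinate `z`: `1 / (π (1 + |z|²)²)`. -/
def fsDensity (z : ℂ) : ℝ := 1 / (Real.pi * (1 + ‖z‖ ^ 2) ^ 2)

/-- The Fubini–Study measure `ω_FS` on `ℙ¹`. -/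
def fubiniStudy : Measure P1 :=
  Measure.map (chart 0) ((volume : Measure ℂ).withDensity fun z => ENNReal.ofReal (fsDensity z))

theorem fsDensity_pos (z : ℂ) : 0 < fsDensity z := by
  unfold fsDensity
  have := Real.pi_pos
  positivity

theorem continuous_fsDensity : Continuous fsDensity := by
  unfold fsDensity
  refine Continuous.div continuous_const (by fun_prop) fun z => ?_
  have := Real.pi_pos
  positivity

theorem quasi_chart_zero :
    Measure.QuasiMeasurePreserving (chart 0) (volume : Measure ℂ) fubiniStudy := by
  refine ⟨measurable_chart 0, ?_⟩
  unfold fubiniStudy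
  refine Measure.AbsolutelyContinuous.map ?_ (measurable_chart 0)
  refine withDensity_absolutelyContinuous' ?_ ?_
  · exact (continuous_fsDensity.measurable.ennreal_ofReal).aemeasurable
  · exact Eventually.of_forall fun z => by simpa using fsDensity_pos z

theorem quasi_chart (j : Fin 2) :
    Measure.QuasiMeasurePreserving (chart j) (volume : Measure ℂ) fubiniStudy := by
  fin_cases j
  · exact quasi_chart_zero
  refine ⟨measurable_chart 1, Measure.AbsolutelyContinuous.mk fun N hN h0 => ?_⟩
  have hA : (volume : Measure ℂ) (chart 0 ⁻¹' N) = 0 := quasi_chart_zero.preimage_null h0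
  change Measure.map (chart 1) volume N = 0
  rw [Measure.map_apply (measurable_chart 1) hN]
  have hsub : chart 1 ⁻¹' N ⊆ {0} ∪ (fun z : ℂ => z⁻¹) '' ((chart 0 ⁻¹' N) \ {0}) := by
    intro z hz
    by_cases h : z = 0
    · exact Or.inl h
    · refine Or.inr ⟨z⁻¹, ⟨?_, by simpa using h⟩, inv_inv z⟩
      have hz' : chart 1 z ∈ N := hz
      rwa [chart_one_eq z h] at hz'
  refine measure_mono_null hsub (measure_union_null (by simp) ?_)
  refine addHaar_image_eq_zero_of_differentiableOn_of_addHaar_eq_zero volume ?_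
    (measure_mono_null Set.sdiff_subset hA)
  intro z hz
  have h1 : DifferentiableAt ℂ (fun z : ℂ => z⁻¹) z := differentiableAt_inv hz.2
  exact (h1.restrictScalars ℝ).differentiableWithinAt

instance : IsFiniteMeasure fubiniStudy := by
  have hint : Integrable fsDensity (volume : Measure ℂ) := by
    have h := (integrable_rpow_neg_one_add_norm_sq (E := ℂ) (μ := volume) (r := 4)
      (by simp; norm_num)).const_mul (1 / Real.pi)
    refine h.congr (Eventually.of_forall fun z => ?_)
    have h1 : (0 : ℝ) ≤ 1 + ‖z‖ ^ 2 := by positivity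
    have h2 : (-4 / 2 : ℝ) = -((2 : ℕ) : ℝ) := by norm_num
    simp only [fsDensity]
    rw [h2, Real.rpow_neg h1, Real.rpow_natCast, one_div, one_div, mul_inv]
  unfold fubiniStudy
  have := isFiniteMeasure_withDensity_ofReal hint.2
  infer_instance

/-! ### Weak `∂`-derivatives -/

/-- The Wirtinger derivative `∂φ/∂z = (∂φ/∂x - i ∂φ/∂y) / 2`. -/
def wirtinger (φ : ℂ → ℂ) (z : ℂ) : ℂ :=
  (1 / 2) * (fderiv ℝ φ z 1 - Complex.I * fderiv ℝ φ z Complex.I)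

/-- `f` is the derivative `∂v/∂z` of `v` in the sense of distributions on `ℂ`. -/
def HasWeakDz (v f : ℂ → ℂ) : Prop :=
  LocallyIntegrable v ∧ LocallyIntegrable f ∧
    ∀ φ : ℂ → ℂ, ContDiff ℝ ∞ φ → HasCompactSupport φ →
      ∫ z, v z * wirtinger φ z = - ∫ z, f z * φ z

theorem continuous_wirtinger {φ : ℂ → ℂ} (h : ContDiff ℝ ∞ φ) : Continuous (wirtinger φ) := by
  have h1 : Continuous (fderiv ℝ φ) := h.continuous_fderiv (by simp)
  unfold wirtinger
  fun_prop

theorem hasCompactSupport_wirtinger {φ : ℂ → ℂ} (h : HasCompactSupport φ) :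
    HasCompactSupport (wirtinger φ) := by
  refine HasCompactSupport.mono (h.fderiv (𝕜 := ℝ)) fun z hz => ?_
  contrapose! hz
  have h0 : fderiv ℝ φ z = 0 := by simpa using hz
  simp [wirtinger, h0]

theorem integrable_mul_test {v φ : ℂ → ℂ} (hv : LocallyIntegrable v) (h : Continuous φ)
    (hc : HasCompactSupport φ) : Integrable fun z => v z * φ z := by
  simpa [mul_comm] using hv.integrable_smul_left_of_hasCompactSupport h hc

theorem HasWeakDz.congr {v w f : ℂ → ℂ} (h : HasWeakDz v f) (hvw : v =ᵐ[volume] w) :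
    HasWeakDz w f := by
  refine ⟨h.1.congr hvw, h.2.1, fun φ h1 h2 => ?_⟩
  rw [← h.2.2 φ h1 h2]
  refine integral_congr_ae ?_
  filter_upwards [hvw] with z hz
  rw [hz]

theorem HasWeakDz.add {v w f g : ℂ → ℂ} (h : HasWeakDz v f) (h' : HasWeakDz w g) :
    HasWeakDz (v + w) (f + g) := by
  refine ⟨h.1.add h'.1, h.2.1.add h'.2.1, fun φ h1 h2 => ?_⟩
  have e1 := continuous_wirtinger h1
  have e2 := hasCompactSupport_wirtinger h2
  simp only [Pi.add_apply, add_mul]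
  rw [integral_add (integrable_mul_test h.1 e1 e2) (integrable_mul_test h'.1 e1 e2),
    integral_add (integrable_mul_test h.2.1 h1.continuous h2)
      (integrable_mul_test h'.2.1 h1.continuous h2), h.2.2 φ h1 h2, h'.2.2 φ h1 h2]
  ring

theorem HasWeakDz.smul {v f : ℂ → ℂ} (c : ℂ) (h : HasWeakDz v f) :
    HasWeakDz (c • v) (c • f) := by
  refine ⟨h.1.smul c, h.2.1.smul c, fun φ h1 h2 => ?_⟩
  simp only [Pi.smul_apply, smul_eq_mul, mul_assoc]
  rw [integral_const_mul, integral_const_mul, h.2.2 φ h1 h2]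
  ring

theorem HasWeakDz.zero : HasWeakDz 0 0 :=
  ⟨locallyIntegrable_zero, locallyIntegrable_zero, fun φ _ _ => by simp⟩

theorem HasWeakDz.unique {v f g : ℂ → ℂ} (h : HasWeakDz v f) (h' : HasWeakDz v g) :
    f =ᵐ[volume] g := by
  have hfg : LocallyIntegrable (f - g) := h.2.1.sub h'.2.1
  have h0 := ae_eq_zero_of_integral_contDiff_smul_eq_zero hfg fun φ h1 h2 => by
    have c1 : ContDiff ℝ ∞ fun z => (φ z : ℂ) := Complex.ofRealCLM.contDiff.comp h1
    have c2 : HasCompactSupport fun z => (φ z : ℂ) :=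
      h2.comp_left (g := fun t : ℝ => (t : ℂ)) (by simp)
    have e := (h.2.2 _ c1 c2).symm.trans (h'.2.2 _ c1 c2)
    have e' := neg_inj.mp e
    have : ∫ z, (f z * (φ z : ℂ) - g z * (φ z : ℂ)) = 0 := by
      rw [integral_sub (integrable_mul_test h.2.1 c1.continuous c2)
        (integrable_mul_test h'.2.1 c1.continuous c2), e', sub_self]
    rw [← this]
    refine integral_congr_ae (Eventually.of_forall fun z => ?_)
    simp only [Pi.sub_apply, Complex.real_smul]
    ring
  filter_upwards [h0] with z hz
  simpa [sub_eq_zero] using hz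

/-! ### The Sobolev space `W^{1,2}(ℙ¹)` -/

/-- The subspace of those classes `u ∈ L²(ℙ¹, ω_FS)` whose distributional derivative `∂u` is a
`(1,0)`-form with `L²` coefficients: in each affine chart `∂u = f dz` with `f ∈ L²(ℂ, dA)`.
(The intrinsic `L²`-norm of a `(1,0)`-form on `ℙ¹` is the `L²(dA)`-norm of its coefficient in
either chart, up to the factor `√2`.) -/
def sobolevSubmodule : Submodule ℂ (Lp ℂ 2 fubiniStudy) where
  carrier := {u | ∀ j : Fin 2, ∃ f : ℂ → ℂ, MemLp f 2 volume ∧ HasWeakDz (u ∘ chart j) f}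
  zero_mem' := fun j => ⟨0, MemLp.zero,
    HasWeakDz.zero.congr ((quasi_chart j).ae_eq_comp (Lp.coeFn_zero ℂ 2 fubiniStudy).symm)⟩
  add_mem' := fun {u v} hu hv j => by
    obtain ⟨f, hf, hf'⟩ := hu j
    obtain ⟨g, hg, hg'⟩ := hv j
    exact ⟨f + g, hf.add hg,
      (hf'.add hg').congr ((quasi_chart j).ae_eq_comp (Lp.coeFn_add u v).symm)⟩
  smul_mem' := fun c u hu j => by
    obtain ⟨f, hf, hf'⟩ := hu j
    exact ⟨c • f, hf.const_smul c,
      (hf'.smul c).congr ((quasi_chart j).ae_eq_comp (Lp.coeFn_smul c u).symm)⟩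

/-- The Sobolev space `W^{1,2}(ℙ¹)`, with the norm defined below. -/
def W12 : Type := sobolevSubmodule

instance : AddCommGroup W12 := inferInstanceAs (AddCommGroup sobolevSubmodule)

instance : Module ℂ W12 := inferInstanceAs (Module ℂ sobolevSubmodule)

namespace W12

/-- The `L²`-class underlying an element of `W^{1,2}`. -/
def toL2 : W12 →ₗ[ℂ] Lp ℂ 2 fubiniStudy := sobolevSubmodule.subtype

/-- A function on `ℙ¹` representing an element of `W^{1,2}`. -/
instance : CoeFun W12 fun _ => P1 → ℂ := ⟨fun u => (toL2 u : P1 → ℂ)⟩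

theorem exists_dz (u : W12) :
    ∃ f : ℂ → ℂ, MemLp f 2 volume ∧ HasWeakDz (u ∘ chart 0) f := u.2 0

/-- The coefficient `f ∈ L²(ℂ, dA)` of `∂u = f dz` in the affine coordinate `z = [z : 1]`. -/
def dz (u : W12) : Lp ℂ 2 (volume : Measure ℂ) := (exists_dz u).choose_spec.1.toLp

theorem hasWeakDz_dz (u : W12) : HasWeakDz (u ∘ chart 0) (exists_dz u).choose :=
  (exists_dz u).choose_spec.2

theorem coeFn_dz (u : W12) : dz u =ᵐ[volume] (exists_dz u).choose :=
  MemLp.coeFn_toLp (exists_dz u).choose_spec.1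

theorem dz_add (u v : W12) : dz (u + v) = dz u + dz v := by
  refine Lp.ext ?_
  have h1 : HasWeakDz ((u + v : W12) ∘ chart 0)
      ((exists_dz u).choose + (exists_dz v).choose) :=
    ((hasWeakDz_dz u).add (hasWeakDz_dz v)).congr
      (quasi_chart_zero.ae_eq_comp (Lp.coeFn_add (toL2 u) (toL2 v)).symm)
  filter_upwards [(hasWeakDz_dz (u + v)).unique h1, coeFn_dz (u + v), coeFn_dz u, coeFn_dz v,
    Lp.coeFn_add (dz u) (dz v)] with z e1 e2 e3 e4 e5
  rw [e2, e1, e5, Pi.add_apply, Pi.add_apply, e3, e4]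

theorem dz_smul (c : ℂ) (u : W12) : dz (c • u) = c • dz u := by
  refine Lp.ext ?_
  have h1 : HasWeakDz ((c • u : W12) ∘ chart 0) (c • (exists_dz u).choose) :=
    ((hasWeakDz_dz u).smul c).congr
      (quasi_chart_zero.ae_eq_comp (Lp.coeFn_smul c (toL2 u)).symm)
  filter_upwards [(hasWeakDz_dz (c • u)).unique h1, coeFn_dz (c • u), coeFn_dz u,
    Lp.coeFn_smul c (dz u)] with z e1 e2 e3 e4
  rw [e2, e1, e4, Pi.smul_apply, Pi.smul_apply, e3]

/-- The norm `‖u‖ = |∫ u ω_FS| + ‖∂u‖_{L²}` of `W^{1,2}`, where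
`‖∂u‖_{L²} = (∫_{ℙ¹} i ∂u ∧ conj(∂u))^{1/2} = (2 ∫_ℂ |f|² dA)^{1/2}` if `∂u = f dz`
(since `i dz ∧ dz̄ = 2 dA` and the complement of the chart is a point). -/
def sobolevNorm (u : W12) : ℝ := ‖∫ x, u x ∂fubiniStudy‖ + √2 * ‖dz u‖

theorem integrable (u : W12) : Integrable u fubiniStudy :=
  (Lp.memLp (toL2 u)).integrable (by norm_num)

theorem integral_add (u v : W12) :
    ∫ x, (u + v : W12) x ∂fubiniStudy = ∫ x, u x ∂fubiniStudy + ∫ x, v x ∂fubiniStudy := by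
  rw [← MeasureTheory.integral_add (integrable u) (integrable v)]
  exact integral_congr_ae (Lp.coeFn_add (toL2 u) (toL2 v))

theorem integral_smul (c : ℂ) (u : W12) :
    ∫ x, (c • u : W12) x ∂fubiniStudy = c * ∫ x, u x ∂fubiniStudy := by
  rw [← integral_const_mul]
  exact integral_congr_ae (Lp.coeFn_smul c (toL2 u))

theorem sobolevNorm_smul (c : ℂ) (u : W12) : sobolevNorm (c • u) = ‖c‖ * sobolevNorm u := by
  rw [sobolevNorm, integral_smul, dz_smul, norm_mul, norm_smul, sobolevNorm]
  ring

/-- `sobolevNorm` makes `W^{1,2}` a (semi)normed space. (It is a norm; definiteness plays no role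
in the notions of bounded operator, operator norm, continuity and derivative.) -/
instance : SeminormedAddCommGroup W12 :=
  AddGroupSeminorm.toSeminormedAddCommGroup
    { toFun := sobolevNorm
      map_zero' := by simpa using sobolevNorm_smul 0 0
      neg' := fun u => by simpa using sobolevNorm_smul (-1) u
      add_le' := fun u v => by
        have h1 := norm_add_le (∫ x, u x ∂fubiniStudy) (∫ x, v x ∂fubiniStudy)
        have h2 := mul_le_mul_of_nonneg_left (norm_add_le (dz u) (dz v)) (Real.sqrt_nonneg 2)
        simp only [sobolevNorm, integral_add, dz_add]
        linarith }

theorem norm_def (u : W12) : ‖u‖ = ‖∫ x, u x ∂fubiniStudy‖ + √2 * ‖dz u‖ := rfl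

instance : NormedSpace ℂ W12 := ⟨fun c u => (sobolevNorm_smul c u).le⟩

end W12

/-! ### The perturbed Markov operators -/

/-- The integrand `(i σ_g(x))^k e^{i ξ σ_g(x)} u(g x)`, where `u(g x) = (g^* u)(x)`. -/
def perturbedIntegrand (k : ℕ) (ξ : ℝ) (u : P1 → ℂ) (x : P1) (g : SL2C) : ℂ :=
  (Complex.I * cocycle g x) ^ k * Complex.exp (Complex.I * ξ * cocycle g x) * u (g • x)

/-- `𝒫_ξ^{(k)} u (x) = ∫ (i σ_g(x))^k e^{i ξ σ_g(x)} u(g x) dμ(g)`; for `k = 0` this is the perturbed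
Markov operator `𝒫_ξ u (x) = ∫ e^{i ξ σ_g(x)} u(g x) dμ(g)`. -/
def perturbedMarkov [MeasurableSpace SL2C] (μ : Measure SL2C) (k : ℕ) (ξ : ℝ) (u : P1 → ℂ)
    (x : P1) : ℂ :=
  ∫ g, perturbedIntegrand k ξ u x g ∂μ

end SobolevP1

end

/-!
The whole argument takes place in the affine chart `z ↦ [z : 1]`, whose complement is a null set.
There an element of `W^{1,2}(ℙ¹)` is a function `U` with `∫ |U|² / (1 + |z|²)² dA < ∞` and weak
derivative `f = ∂U/∂z` in `L²(dA)` (the structure `Sob`), and its squared norm is comparable with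
`energy U f = |∫ U ω_FS|² + ∫ |f|² dA`. The element `g` acts by a Möbius transformation, and
`σ_g = log (Q / q) / 2` with `q = 1 + |z|²` and `Q = |g (z, 1)|²`.

Every operator in the theorem is an average over `g` of operators `U ↦ F(σ_g) g⋆U` with a smooth
symbol `F`. The central estimate, `exists_twist_le`, bounds the norm of such an operator by a multiple
of `(1 + log ‖g‖) sup (|F| + |F'|)`, the supremum being over the range `|s| ≤ log ‖g‖_HS²`
of the cocycle. It rests on three facts.

* The Dirichlet energy `∫ |f|²` is invariant under Möbius transformations (`Sob.comp_mob`).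
* The Poincaré inequality `exists_poincare`, from an explicit Green kernel and Schur's test. The
  Cauchy–Pompeiu formula identifies the kernel, and unitary invariance gives its mass.
* The mean of `g⋆U` differs from that of `U` by a pairing of `f` with the `(0,1)`-form
  `∂̄ log Q - ∂̄ log q`, whose squared pointwise norm is at most `τ / (q Q)`, with `τ = ‖g‖_HS²`.
  Writing `1 / (q Q)` as the integral over `s ∈ [0, 1]` of `1 / ((1 - s) q + s Q)²` and bringing each
  of these Hermitian forms to a standard one gives a bound `O(log τ)`. The same interpolation
  controls `∫ |U|² |∂σ_g|²`, the term of `∂(F(σ_g) g⋆U)` in which the derivative falls on the symbol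
  (`exists_lintegral_mobForm_le`, `exists_lintegral_inv_le`).

By Minkowski's inequality the averages over `μ` are bounded on `W^{1,2}` when the norms are
integrable (`exists_averaged_le`, and `exists_represents` for classes on `ℙ¹`). For
`F(s) = (i s)^k e^{i ξ s}` the bound is of the order of `(1 + log ‖g‖)^(k + 1)`, integrable if
`k + 1 ≤ p`. A shift of `ξ` by `h` inserts a factor `min (2, |h| (1 + log ‖g‖))` into this bound, and
the error in the difference quotient one more power of `1 + log ‖g‖`; dominated convergence then
gives continuity and, if `k + 2 ≤ p`, the derivative (`continuous_of_represents`,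
`hasDerivAt_of_represents`).
-/

noncomputable section

namespace SobolevP1

open ComplexConjugate
open scoped ENNReal NNReal

/-! ### Wirtinger calculus -/

/-- The real-linear map `h ↦ p h + r h̄`. -/
def wirtCLM (p r : ℂ) : ℂ →L[ℝ] ℂ :=
  p • ContinuousLinearMap.id ℝ ℂ + r • (Complex.conjCLE : ℂ →L[ℝ] ℂ)

theorem wirtCLM_apply (p r h : ℂ) : wirtCLM p r h = p * h + r * conj h := by
  simp [wirtCLM]

/-- `φ` is real differentiable at `z` with Wirtinger derivatives `∂φ/∂z = p` and `∂φ/∂z̄ = r`. -/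
def HasWirt (φ : ℂ → ℂ) (p r z : ℂ) : Prop := HasFDerivAt φ (wirtCLM p r) z

namespace HasWirt

theorem wirtinger_eq {φ : ℂ → ℂ} {p r z : ℂ} (h : HasWirt φ p r z) : wirtinger φ z = p := by
  have h1 : fderiv ℝ φ z = wirtCLM p r := HasFDerivAt.fderiv h
  simp only [wirtinger, h1, wirtCLM_apply, map_one, Complex.conj_I]
  linear_combination (-(1 / 2) * p + 1 / 2 * r) * Complex.I_sq

theorem of_eq {φ : ℂ → ℂ} {p r p' r' z : ℂ} (h : HasWirt φ p r z) (hp : p = p') (hr : r = r') :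
    HasWirt φ p' r' z := hp ▸ hr ▸ h

theorem of_hasFDerivAt {φ : ℂ → ℂ} {L : ℂ →L[ℝ] ℂ} {p r z : ℂ} (h : HasFDerivAt φ L z)
    (hL : ∀ w, L w = p * w + r * conj w) : HasWirt φ p r z := by
  have : L = wirtCLM p r := by ext w; simp [hL, wirtCLM_apply]
  rw [HasWirt, ← this]
  exact h

theorem of_differentiableAt {φ : ℂ → ℂ} {z : ℂ} (h : DifferentiableAt ℝ φ z) :
    ∃ r, HasWirt φ (wirtinger φ z) r z := by
  refine ⟨(1 / 2) * (fderiv ℝ φ z 1 + Complex.I * fderiv ℝ φ z Complex.I),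
    of_hasFDerivAt h.hasFDerivAt fun w => ?_⟩
  have h1 : fderiv ℝ φ z w = w.re * fderiv ℝ φ z 1 + w.im * fderiv ℝ φ z Complex.I := by
    have e : w = w.re • (1 : ℂ) + w.im • Complex.I := by
      simp [Complex.re_add_im]
    conv_lhs => rw [e, map_add, map_smul, map_smul]
    simp
  have h2 : conj w = w.re - w.im * Complex.I := by
    apply Complex.ext <;> simp
  have h3 : w = w.re + w.im * Complex.I := (Complex.re_add_im w).symm
  rw [h1, h2]
  conv_rhs => rw [h3]
  simp only [wirtinger, Complex.add_re, Complex.add_im, Complex.ofReal_re, Complex.ofReal_im,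
    Complex.mul_re, Complex.mul_im, Complex.I_re, Complex.I_im]
  push_cast
  linear_combination (w.im * fderiv ℝ φ z Complex.I) * Complex.I_sq

theorem of_hasDerivAt {φ : ℂ → ℂ} {p z : ℂ} (h : HasDerivAt φ p z) : HasWirt φ p 0 z :=
  of_hasFDerivAt (h.hasFDerivAt.restrictScalars ℝ) fun w => by simp [mul_comm]

theorem id (z : ℂ) : HasWirt (fun w => w) 1 0 z := of_hasDerivAt (hasDerivAt_id z)

theorem const (c z : ℂ) : HasWirt (fun _ => c) 0 0 z := of_hasDerivAt (hasDerivAt_const z c)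

theorem add {φ ψ : ℂ → ℂ} {p r p' r' z : ℂ} (h : HasWirt φ p r z) (h' : HasWirt ψ p' r' z) :
    HasWirt (fun w => φ w + ψ w) (p + p') (r + r') z :=
  of_hasFDerivAt (HasFDerivAt.add h h') fun w => by
    simp [wirtCLM_apply]; ring

theorem sub {φ ψ : ℂ → ℂ} {p r p' r' z : ℂ} (h : HasWirt φ p r z) (h' : HasWirt ψ p' r' z) :
    HasWirt (fun w => φ w - ψ w) (p - p') (r - r') z :=
  of_hasFDerivAt (HasFDerivAt.sub h h') fun w => by
    simp [wirtCLM_apply]; ring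

theorem mul {φ ψ : ℂ → ℂ} {p r p' r' z : ℂ} (h : HasWirt φ p r z) (h' : HasWirt ψ p' r' z) :
    HasWirt (fun w => φ w * ψ w) (φ z * p' + p * ψ z) (φ z * r' + r * ψ z) z :=
  of_hasFDerivAt (HasFDerivAt.mul h h') fun w => by
    simp [wirtCLM_apply]; ring

theorem star {φ : ℂ → ℂ} {p r z : ℂ} (h : HasWirt φ p r z) :
    HasWirt (fun w => conj (φ w)) (conj r) (conj p) z :=
  of_hasFDerivAt ((Complex.conjCLE : ℂ →L[ℝ] ℂ).hasFDerivAt.comp z h) fun w => by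
    simp [wirtCLM_apply]; ring

theorem comp {φ m : ℂ → ℂ} {p r p' r' z : ℂ} (h : HasWirt φ p r (m z))
    (h' : HasWirt m p' r' z) :
    HasWirt (fun w => φ (m w)) (p * p' + r * conj r') (p * r' + r * conj p') z :=
  of_hasFDerivAt (HasFDerivAt.comp z h h') fun w => by
    simp [wirtCLM_apply]; ring

theorem div {φ ψ : ℂ → ℂ} {p r p' r' z : ℂ} (h : HasWirt φ p r z) (h' : HasWirt ψ p' r' z)
    (h0 : ψ z ≠ 0) :
    HasWirt (fun w => φ w / ψ w) ((p * ψ z - φ z * p') / ψ z ^ 2)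
      ((r * ψ z - φ z * r') / ψ z ^ 2) z := by
  have h1 := h.mul ((of_hasDerivAt (hasDerivAt_inv h0)).comp h')
  simp only [← div_eq_mul_inv] at h1
  refine h1.of_eq ?_ ?_ <;> field_simp <;> simp <;> ring

/-- Chain rule for a function of a real variable composed with a real-valued function. -/
theorem comp_real {F : ℝ → ℂ} {s : ℂ → ℝ} {F' p z : ℂ}
    (hs : HasWirt (fun w => (s w : ℂ)) p (conj p) z) (hF : HasDerivAt F F' (s z)) :
    HasWirt (fun w => F (s w)) (F' * p) (F' * conj p) z := by
  have h1 : HasFDerivAt s (Complex.reCLM.comp (wirtCLM p (conj p))) z := by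
    have := Complex.reCLM.hasFDerivAt.comp z (f := fun w => (s w : ℂ)) hs
    simpa [Function.comp_def] using this
  refine of_hasFDerivAt (hF.hasFDerivAt.comp z h1) fun w => ?_
  have h2 : ((p * w + conj p * conj w).re : ℂ) = p * w + conj p * conj w := by
    apply Complex.ext <;> simp; ring
  simp only [ContinuousLinearMap.comp_apply, Complex.reCLM_apply, wirtCLM_apply,
    ContinuousLinearMap.toSpanSingleton_apply, Complex.real_smul]
  rw [h2]; ring

end HasWirt

theorem wirtinger_mul {φ ψ : ℂ → ℂ} {z : ℂ} (h : DifferentiableAt ℝ φ z)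
    (h' : DifferentiableAt ℝ ψ z) :
    wirtinger (fun w => φ w * ψ w) z = φ z * wirtinger ψ z + wirtinger φ z * ψ z := by
  obtain ⟨r, hr⟩ := HasWirt.of_differentiableAt h
  obtain ⟨r', hr'⟩ := HasWirt.of_differentiableAt h'
  exact (hr.mul hr').wirtinger_eq

theorem ContDiff.differentiableAt' {φ : ℂ → ℂ} (h : ContDiff ℝ ∞ φ) (z : ℂ) :
    DifferentiableAt ℝ φ z := (h.differentiable (by simp)) z

theorem HasWeakDz.of_contDiff {X : ℂ → ℂ} (h : ContDiff ℝ ∞ X) : HasWeakDz X (wirtinger X) := by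
  refine ⟨h.continuous.locallyIntegrable, (continuous_wirtinger h).locallyIntegrable,
    fun φ h1 h2 => ?_⟩
  have c1 : Continuous fun z => fderiv ℝ X z := h.continuous_fderiv (by simp)
  have c2 : Continuous fun z => fderiv ℝ φ z := h1.continuous_fderiv (by simp)
  have s2 : ∀ v, HasCompactSupport fun z => fderiv ℝ φ z v := fun v =>
    (h2.fderiv (𝕜 := ℝ)).comp_left (g := fun L : ℂ →L[ℝ] ℂ => L v) (by simp)
  have i1 : ∀ v, Integrable fun z => fderiv ℝ X z v * φ z := fun v =>
    ((c1.clm_apply continuous_const).mul h1.continuous).integrable_of_hasCompactSupport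
      h2.mul_left
  have i2 : ∀ v, Integrable fun z => X z * fderiv ℝ φ z v := fun v =>
    (h.continuous.mul (c2.clm_apply continuous_const)).integrable_of_hasCompactSupport
      (s2 v).mul_left
  have i3 : Integrable fun z => X z * φ z :=
    (h.continuous.mul h1.continuous).integrable_of_hasCompactSupport h2.mul_left
  have key : ∀ v, ∫ z, X z * fderiv ℝ φ z v = - ∫ z, fderiv ℝ X z v * φ z := fun v =>
    integral_mul_fderiv_eq_neg_fderiv_mul_of_integrable (i1 v) (i2 v) i3
      (fun z _ => ContDiff.differentiableAt' h z) (fun z _ => ContDiff.differentiableAt' h1 z)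
  have e1 : ∀ z, X z * wirtinger φ z = (1 / 2) * (X z * fderiv ℝ φ z 1)
      - (Complex.I / 2) * (X z * fderiv ℝ φ z Complex.I) := fun z => by
    simp only [wirtinger]; ring
  have e2 : ∀ z, wirtinger X z * φ z = (1 / 2) * (fderiv ℝ X z 1 * φ z)
      - (Complex.I / 2) * (fderiv ℝ X z Complex.I * φ z) := fun z => by
    simp only [wirtinger]; ring
  simp only [e1, e2]
  rw [MeasureTheory.integral_sub ((i2 1).const_mul _) ((i2 _).const_mul _),
    MeasureTheory.integral_sub ((i1 1).const_mul _) ((i1 _).const_mul _),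
    integral_const_mul, integral_const_mul, integral_const_mul, integral_const_mul, key, key]
  ring

/-- The product rule for a weakly differentiable function and a smooth one. -/
theorem HasWeakDz.mul_contDiff {v f G : ℂ → ℂ} (h : HasWeakDz v f) (hG : ContDiff ℝ ∞ G) :
    HasWeakDz (fun z => G z * v z) (fun z => G z * f z + wirtinger G z * v z) := by
  have l1 : LocallyIntegrable fun z => G z * v z := by
    simpa using h.1.continuous_smul hG.continuous
  have l2 : LocallyIntegrable fun z => G z * f z := by
    simpa using h.2.1.continuous_smul hG.continuous
  have l3 : LocallyIntegrable fun z => wirtinger G z * v z := by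
    simpa using h.1.continuous_smul (continuous_wirtinger hG)
  refine ⟨l1, l2.add l3, fun φ h1 h2 => ?_⟩
  have e := h.2.2 (fun z => G z * φ z) (hG.mul h1) h2.mul_left
  have cw := continuous_wirtinger h1
  have sw := hasCompactSupport_wirtinger h2
  have e1 : ∀ z, v z * wirtinger (fun z => G z * φ z) z
      = G z * v z * wirtinger φ z + wirtinger G z * v z * φ z := fun z => by
    rw [wirtinger_mul (ContDiff.differentiableAt' hG z) (ContDiff.differentiableAt' h1 z)]; ring
  have i1 := integrable_mul_test l1 cw sw
  have i2 := integrable_mul_test l2 h1.continuous h2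
  have i3 := integrable_mul_test l3 h1.continuous h2
  simp only [e1] at e
  rw [MeasureTheory.integral_add i1 i3] at e
  simp only [add_mul]
  rw [MeasureTheory.integral_add i2 i3]
  have e2 : ∫ z, f z * (G z * φ z) = ∫ z, G z * f z * φ z :=
    integral_congr_ae (Eventually.of_forall fun z => by simp only; ring)
  rw [e2] at e
  linear_combination e

/-! ### Square-integrability and cutoffs -/

/-- The weight `1 + |z|²`: the squared norm of the vector `(z, 1)`. -/
def fsWeight (z : ℂ) : ℝ := 1 + ‖z‖ ^ 2

theorem one_le_fsWeight (z : ℂ) : 1 ≤ fsWeight z := by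
  unfold fsWeight; nlinarith [sq_nonneg ‖z‖]

theorem fsWeight_pos (z : ℂ) : 0 < fsWeight z := zero_lt_one.trans_le (one_le_fsWeight z)

theorem continuous_fsWeight : Continuous fsWeight := by unfold fsWeight; fun_prop

theorem fsDensity_eq (z : ℂ) : fsDensity z = 1 / (Real.pi * fsWeight z ^ 2) := rfl

theorem integrable_fsDensity : Integrable fsDensity := by
  have h : fubiniStudy Set.univ < ⊤ := measure_lt_top _ _
  rw [fubiniStudy, Measure.map_apply (measurable_chart 0) MeasurableSet.univ, Set.preimage_univ,
    withDensity_apply _ MeasurableSet.univ, Measure.restrict_univ] at h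
  refine ⟨continuous_fsDensity.aestronglyMeasurable, ?_⟩
  rw [hasFiniteIntegral_iff_ofReal (Eventually.of_forall fun z => (fsDensity_pos z).le)]
  exact h

theorem integrable_inv_fsWeight_sq : Integrable fun z => 1 / fsWeight z ^ 2 := by
  refine (integrable_fsDensity.const_mul Real.pi).congr (Eventually.of_forall fun z => ?_)
  have := Real.pi_pos
  have := fsWeight_pos z
  simp only [fsDensity_eq]
  field_simp

theorem memLp_two_iff {f : ℂ → ℂ} (hf : AEStronglyMeasurable f) :
    MemLp f 2 ↔ ∫⁻ z, ‖f z‖ₑ ^ 2 < ⊤ := by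
  rw [MemLp, and_iff_right hf,
    eLpNorm_lt_top_iff_lintegral_rpow_enorm_lt_top (by norm_num) (by norm_num)]
  simp

theorem memLp_inv_fsWeight (C : ℝ) : MemLp (fun z => ((C / fsWeight z : ℝ) : ℂ)) 2 := by
  have hc : Continuous fun z => ((C / fsWeight z : ℝ) : ℂ) :=
    Complex.continuous_ofReal.comp
      (continuous_const.div continuous_fsWeight fun z => (fsWeight_pos z).ne')
  rw [memLp_two_iff_integrable_sq_norm hc.aestronglyMeasurable]
  refine (integrable_inv_fsWeight_sq.const_mul (C ^ 2)).congr (Eventually.of_forall fun z => ?_)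
  simp only [Complex.norm_real, Real.norm_eq_abs, sq_abs]
  ring

theorem memLp_of_norm_le_inv_fsWeight {X : ℂ → ℂ} (hX : AEStronglyMeasurable X) {C : ℝ}
    (h : ∀ z, ‖X z‖ ≤ C / fsWeight z) : MemLp X 2 :=
  (memLp_inv_fsWeight C).mono hX (Eventually.of_forall fun z => by
    simpa [abs_div] using (h z).trans (le_abs_self _))

/-- A function `U` on `ℂ` that is square-integrable for the Fubini–Study measure, with weak
derivative `∂U/∂z = f ∈ L²(dA)`: the description of `W^{1,2}(ℙ¹)` in one affine chart. -/
structure Sob (U f : ℂ → ℂ) : Prop where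
  meas : Measurable U
  meas_dz : Measurable f
  memLp : MemLp (fun z => U z / fsWeight z) 2
  memLp_dz : MemLp f 2
  weak : HasWeakDz U f

theorem Sob.integrable_mul {U f X : ℂ → ℂ} (h : Sob U f) (hX : AEStronglyMeasurable X) {C : ℝ}
    (hb : ∀ z, ‖X z‖ ≤ C / fsWeight z ^ 2) : Integrable fun z => U z * X z := by
  have h1 : MemLp (fun z => fsWeight z * X z) 2 := by
    refine memLp_of_norm_le_inv_fsWeight (C := C)
      ((Complex.continuous_ofReal.comp continuous_fsWeight).aestronglyMeasurable.mul hX)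
      fun z => ?_
    have h0 := fsWeight_pos z
    have := mul_le_mul_of_nonneg_left (hb z) h0.le
    simp only [norm_mul, Complex.norm_real, Real.norm_eq_abs, abs_of_pos h0]
    refine this.trans (le_of_eq ?_)
    field_simp
  refine (h.memLp.integrable_mul h1).congr (Eventually.of_forall fun z => ?_)
  have h0 : (fsWeight z : ℂ) ≠ 0 := by exact_mod_cast (fsWeight_pos z).ne'
  simp only [Pi.mul_apply]
  field_simp

theorem Sob.integrable_dz_mul {U f X : ℂ → ℂ} (h : Sob U f) (hX : AEStronglyMeasurable X) {C : ℝ}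
    (hb : ∀ z, ‖X z‖ ≤ C / fsWeight z) : Integrable fun z => f z * X z :=
  h.memLp_dz.integrable_mul (memLp_of_norm_le_inv_fsWeight hX hb)

theorem lintegral_mul_le_sqrt {α : Type*} [MeasurableSpace α] (μ : Measure α) {f g : α → ℝ≥0∞}
    (hf : AEMeasurable f μ) (hg : AEMeasurable g μ) :
    ∫⁻ a, f a * g a ∂μ ≤ (∫⁻ a, f a ^ 2 ∂μ) ^ (1 / 2 : ℝ) * (∫⁻ a, g a ^ 2 ∂μ) ^ (1 / 2 : ℝ) := by
  have := ENNReal.lintegral_mul_le_Lp_mul_Lq μ Real.HolderConjugate.two_two hf hg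
  simpa using this

theorem sq_lintegral_mul_le {α : Type*} [MeasurableSpace α] (μ : Measure α) {f g : α → ℝ≥0∞}
    (hf : AEMeasurable f μ) (hg : AEMeasurable g μ) :
    (∫⁻ a, f a * g a ∂μ) ^ 2 ≤ (∫⁻ a, f a ^ 2 ∂μ) * ∫⁻ a, g a ^ 2 ∂μ := by
  have h := pow_le_pow_left' (lintegral_mul_le_sqrt μ hf hg) 2
  refine h.trans (le_of_eq ?_)
  rw [mul_pow, ← ENNReal.rpow_natCast, ← ENNReal.rpow_natCast, ← ENNReal.rpow_mul,
    ← ENNReal.rpow_mul]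
  norm_num

/-- Cutoffs `χ(z/(n+1))`: smooth, compactly supported, equal to `1` for `|z| ≤ n + 1`, with
`∂`-derivative of size `O(1/n)` supported in the annulus `n + 1 ≤ |z| ≤ 2(n + 1)`. -/
theorem exists_cutoff : ∃ (χ : ℕ → ℂ → ℂ) (C : ℝ), 0 ≤ C ∧ ∀ n, ContDiff ℝ ∞ (χ n) ∧
    HasCompactSupport (χ n) ∧ (∀ z, ‖χ n z‖ ≤ 1) ∧ (∀ z, ‖z‖ ≤ n + 1 → χ n z = 1) ∧
    (∀ z, ‖wirtinger (χ n) z‖ ≤ C / (n + 1)) ∧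
    (∀ z, ‖z‖ < n + 1 ∨ 2 * (n + 1) < ‖z‖ → wirtinger (χ n) z = 0) := by
  let b : ContDiffBump (0 : ℂ) := ⟨1, 2, zero_lt_one, one_lt_two⟩
  have cb : ContDiff ℝ ∞ fun z => (b z : ℂ) := Complex.ofRealCLM.contDiff.comp b.contDiff
  have sb : HasCompactSupport fun z => (b z : ℂ) :=
    b.hasCompactSupport.comp_left (g := fun t : ℝ => (t : ℂ)) (by simp)
  obtain ⟨C, hC⟩ := (hasCompactSupport_wirtinger sb).exists_bound_of_continuous
    (continuous_wirtinger cb)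
  have hC0 : 0 ≤ C := (norm_nonneg _).trans (hC 0)
  have hw : ∀ (n : ℕ) z, wirtinger (fun z => (b (((n + 1 : ℝ) : ℂ)⁻¹ * z) : ℂ)) z
      = wirtinger (fun z => (b z : ℂ)) (((n + 1 : ℝ) : ℂ)⁻¹ * z) * ((n + 1 : ℝ) : ℂ)⁻¹ :=
    fun n z => by
    obtain ⟨r, hr⟩ := HasWirt.of_differentiableAt
      (ContDiff.differentiableAt' cb (((n + 1 : ℝ) : ℂ)⁻¹ * z))
    have h2 : HasWirt (fun z => ((n + 1 : ℝ) : ℂ)⁻¹ * z) ((n + 1 : ℝ) : ℂ)⁻¹ 0 z := by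
      refine HasWirt.of_hasDerivAt ?_
      simpa using (hasDerivAt_id z).const_mul ((n + 1 : ℝ) : ℂ)⁻¹
    have := (hr.comp (m := fun z => ((n + 1 : ℝ) : ℂ)⁻¹ * z) h2).wirtinger_eq
    simpa using this
  refine ⟨fun n z => (b (((n + 1 : ℝ) : ℂ)⁻¹ * z) : ℂ), C, hC0, fun n => ?_⟩
  have hn : (0 : ℝ) < n + 1 := by positivity
  have hnorm : ∀ z : ℂ, ‖((n + 1 : ℝ) : ℂ)⁻¹ * z‖ = ‖z‖ / (n + 1) := fun z => by
    rw [norm_mul, norm_inv, Complex.norm_real, Real.norm_eq_abs, abs_of_pos hn]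
    field_simp
  have c1 : ContDiff ℝ ∞ fun z : ℂ => ((n + 1 : ℝ) : ℂ)⁻¹ * z := contDiff_const.mul contDiff_id
  refine ⟨cb.comp c1, ?_, fun z => ?_, fun z hz => ?_, fun z => ?_, fun z hz => ?_⟩
  · refine HasCompactSupport.intro (isCompact_closedBall (0 : ℂ) (2 * (n + 1))) fun z hz => ?_
    have hz' : 2 * (n + 1) < ‖z‖ := by simpa using hz
    have : b (((n + 1 : ℝ) : ℂ)⁻¹ * z) = 0 := by
      refine b.zero_of_le_dist ?_
      rw [dist_zero_right, hnorm]
      exact (le_div_iff₀ hn).2 hz'.le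
    simp only [this, Complex.ofReal_zero]
  · rw [Complex.norm_real, Real.norm_eq_abs, abs_of_nonneg b.nonneg]
    exact b.le_one
  · have : b (((n + 1 : ℝ) : ℂ)⁻¹ * z) = 1 := by
      refine b.one_of_mem_closedBall ?_
      rw [mem_closedBall_zero_iff, hnorm]
      exact (div_le_one hn).2 hz
    simp only [this, Complex.ofReal_one]
  · rw [hw, norm_mul, norm_inv, Complex.norm_real, Real.norm_eq_abs, abs_of_pos hn,
      ← div_eq_mul_inv]
    gcongr
    exact hC _
  · have hev : ∃ c : ℂ, (fun z => (b (((n + 1 : ℝ) : ℂ)⁻¹ * z) : ℂ)) =ᶠ[𝓝 z] fun _ => c := by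
      rcases hz with hz | hz
      · refine ⟨1, ?_⟩
        filter_upwards [(isOpen_lt continuous_norm continuous_const).mem_nhds hz] with w hw
        have : b (((n + 1 : ℝ) : ℂ)⁻¹ * w) = 1 := by
          refine b.one_of_mem_closedBall ?_
          rw [mem_closedBall_zero_iff, hnorm]
          exact (div_le_one hn).2 (le_of_lt hw)
        simp only [this, Complex.ofReal_one]
      · refine ⟨0, ?_⟩
        filter_upwards [(isOpen_lt continuous_const continuous_norm).mem_nhds hz] with w hw
        have : b (((n + 1 : ℝ) : ℂ)⁻¹ * w) = 0 := by
          refine b.zero_of_le_dist ?_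
          rw [dist_zero_right, hnorm]
          exact (le_div_iff₀ hn).2 (le_of_lt hw)
        simp only [this, Complex.ofReal_zero]
    obtain ⟨c, hc⟩ := hev
    have h0 : HasWirt (fun z => (b (((n + 1 : ℝ) : ℂ)⁻¹ * z) : ℂ)) 0 0 z :=
      HasFDerivAt.congr_of_eventuallyEq (HasWirt.const c z) hc
    exact h0.wirtinger_eq

/-- Integration by parts on the whole projective line, in one chart: the test function need not
have compact support, as long as it extends to a bounded `(0,1)`-form with bounded derivative. -/
theorem Sob.integral_mul_wirtinger {U f X : ℂ → ℂ} (h : Sob U f) (hX : ContDiff ℝ ∞ X) {C C' : ℝ}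
    (hb : ∀ z, ‖X z‖ ≤ C / fsWeight z) (hb' : ∀ z, ‖wirtinger X z‖ ≤ C' / fsWeight z ^ 2) :
    ∫ z, U z * wirtinger X z = - ∫ z, f z * X z := by
  obtain ⟨χ, A, hA, hχ⟩ := exists_cutoff
  have iU := h.integrable_mul (continuous_wirtinger hX).aestronglyMeasurable hb'
  have iF := h.integrable_dz_mul hX.continuous.aestronglyMeasurable hb
  have hC0 : 0 ≤ C := by
    have h1 := (norm_nonneg _).trans (hb 0)
    rwa [le_div_iff₀ (fsWeight_pos 0), zero_mul] at h1
  have hlim1 : ∀ z, Tendsto (fun n => χ n z) atTop (𝓝 1) := fun z => by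
    obtain ⟨N, hN⟩ := exists_nat_ge ‖z‖
    refine tendsto_const_nhds.congr' ?_
    filter_upwards [eventually_ge_atTop N] with n hn
    refine ((hχ n).2.2.2.1 z ?_).symm
    have : (N : ℝ) ≤ n := by exact_mod_cast hn
    linarith
  -- the integrals of `χₙ` times the two integrands converge by dominated convergence
  have hdom : ∀ {g : ℂ → ℂ}, Integrable g →
      Tendsto (fun n => ∫ z, χ n z * g z) atTop (𝓝 (∫ z, g z)) := fun {g} hg => by
    refine tendsto_integral_of_dominated_convergence (fun z => ‖g z‖)
      (fun n => ((hχ n).1.continuous.aestronglyMeasurable).mul hg.aestronglyMeasurable)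
      hg.norm (fun n => Eventually.of_forall fun z => ?_) (Eventually.of_forall fun z => ?_)
    · rw [norm_mul]
      exact mul_le_of_le_one_left (norm_nonneg _) ((hχ n).2.2.1 z)
    · simpa using (hlim1 z).mul_const (g z)
  -- the boundary term, estimated by Cauchy–Schwarz on the annulus
  have hbd : Tendsto (fun n => ∫ z, U z * (wirtinger (χ n) z * X z)) atTop (𝓝 0) := by
    rw [tendsto_zero_iff_enorm_tendsto_zero]
    let a : ℕ → ℂ → ℝ≥0∞ := fun n z =>
      {z : ℂ | (n : ℝ) + 1 ≤ ‖z‖}.indicator (fun z => ‖U z / fsWeight z‖ₑ) z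
    let b : ℕ → ℂ → ℝ≥0∞ := fun n z =>
      (Metric.closedBall (0 : ℂ) (2 * (n + 1))).indicator
        (fun _ => ENNReal.ofReal (C * A / (n + 1))) z
    have ma0 : Measurable fun z => ‖U z / fsWeight z‖ₑ :=
      (h.meas.div (Complex.continuous_ofReal.comp continuous_fsWeight).measurable).enorm
    have mset : ∀ n : ℕ, MeasurableSet {z : ℂ | (n : ℝ) + 1 ≤ ‖z‖} := fun n =>
      measurableSet_le measurable_const measurable_norm
    have ma : ∀ n, Measurable (a n) := fun n => ma0.indicator (mset n)
    have mb : ∀ n, Measurable (b n) := fun n =>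
      measurable_const.indicator Metric.isClosed_closedBall.measurableSet
    have ha : Tendsto (fun n => ∫⁻ z, a n z ^ 2) atTop (𝓝 0) := by
      have : (0 : ℝ≥0∞) = ∫⁻ _ : ℂ, 0 := by simp
      rw [this]
      refine tendsto_lintegral_of_dominated_convergence (fun z => ‖U z / fsWeight z‖ₑ ^ 2)
        (fun n => (ma n).pow_const 2) (fun n => Eventually.of_forall fun z => ?_)
        ((memLp_two_iff h.memLp.1).1 h.memLp).ne (Eventually.of_forall fun z => ?_)
      · exact pow_le_pow_left' (Set.indicator_le_self _ _ z) 2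
      · obtain ⟨N, hN⟩ := exists_nat_ge ‖z‖
        refine tendsto_const_nhds.congr' ?_
        filter_upwards [eventually_ge_atTop N] with n hn
        have hn' : (N : ℝ) ≤ n := by exact_mod_cast hn
        have : z ∉ {z : ℂ | (n : ℝ) + 1 ≤ ‖z‖} := by
          simp only [Set.mem_ofPred_eq, not_le]; linarith
        simp [a, this]
    have hbb : ∀ n, ∫⁻ z, b n z ^ 2 ≤ ENNReal.ofReal ((C * A) ^ 2 * 4) * NNReal.pi := fun n => by
      have e : ∀ z, b n z ^ 2 = (Metric.closedBall (0 : ℂ) (2 * (n + 1))).indicator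
          (fun _ => ENNReal.ofReal (C * A / (n + 1)) ^ 2) z := fun z => by
        by_cases hz : z ∈ Metric.closedBall (0 : ℂ) (2 * (n + 1))
        · simp [b, hz]
        · simp only [b, Set.indicator_of_notMem hz]; simp
      have hn : (0 : ℝ) < n + 1 := by positivity
      simp only [e]
      rw [lintegral_indicator Metric.isClosed_closedBall.measurableSet, setLIntegral_const,
        Complex.volume_closedBall, ← mul_assoc, ← ENNReal.ofReal_pow (by positivity),
        ← ENNReal.ofReal_pow (by positivity), ← ENNReal.ofReal_mul (by positivity)]
      refine le_of_eq ?_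
      congr 2
      field_simp
      norm_num
    have hpt : ∀ n z, ‖U z * (wirtinger (χ n) z * X z)‖ₑ ≤ a n z * b n z := fun n z => by
      by_cases hz : ‖z‖ < n + 1 ∨ 2 * (n + 1) < ‖z‖
      · rw [(hχ n).2.2.2.2.2 z hz]; simp
      · push Not at hz
        have h1 : z ∈ {z : ℂ | (n : ℝ) + 1 ≤ ‖z‖} := hz.1
        have h2 : z ∈ Metric.closedBall (0 : ℂ) (2 * (n + 1)) := by simpa using hz.2
        simp only [a, b, Set.indicator_of_mem h1, Set.indicator_of_mem h2]
        rw [← ofReal_norm, ← ofReal_norm, ← ENNReal.ofReal_mul (norm_nonneg _)]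
        refine ENNReal.ofReal_le_ofReal ?_
        rw [norm_mul, norm_mul, norm_div, Complex.norm_real, Real.norm_eq_abs,
          abs_of_pos (fsWeight_pos z)]
        have h3 := mul_le_mul ((hχ n).2.2.2.2.1 z) (hb z) (norm_nonneg _) (by positivity)
        calc ‖U z‖ * (‖wirtinger (χ n) z‖ * ‖X z‖)
            ≤ ‖U z‖ * (A / (n + 1) * (C / fsWeight z)) := by gcongr
          _ = _ := by ring
    refine tendsto_of_tendsto_of_tendsto_of_le_of_le tendsto_const_nhds (h := fun n =>
      (∫⁻ z, a n z ^ 2) ^ (1 / 2 : ℝ) *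
        (ENNReal.ofReal ((C * A) ^ 2 * 4) * NNReal.pi) ^ (1 / 2 : ℝ)) ?_
      (fun _ => zero_le) (fun n => ?_)
    · have h1 := (ENNReal.continuous_rpow_const (y := (1 / 2 : ℝ))).tendsto 0 |>.comp ha
      rw [ENNReal.zero_rpow_of_pos (by norm_num)] at h1
      have h2 := ENNReal.Tendsto.mul_const (b :=
        (ENNReal.ofReal ((C * A) ^ 2 * 4) * NNReal.pi) ^ (1 / 2 : ℝ)) h1
        (Or.inr (ENNReal.rpow_ne_top_of_nonneg (by norm_num)
          (ENNReal.mul_ne_top ENNReal.ofReal_ne_top ENNReal.coe_ne_top)))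
      simpa using h2
    · calc ‖∫ z, U z * (wirtinger (χ n) z * X z)‖ₑ
          ≤ ∫⁻ z, ‖U z * (wirtinger (χ n) z * X z)‖ₑ := enorm_integral_le_lintegral_enorm _
        _ ≤ ∫⁻ z, a n z * b n z := lintegral_mono (hpt n)
        _ ≤ _ := lintegral_mul_le_sqrt _ (ma n).aemeasurable (mb n).aemeasurable
        _ ≤ _ := mul_le_mul_right (ENNReal.rpow_le_rpow (hbb n) (by norm_num)) _
  have hid : ∀ n, (∫ z, χ n z * (U z * wirtinger X z)) + ∫ z, U z * (wirtinger (χ n) z * X z)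
      = - ∫ z, χ n z * (f z * X z) := fun n => by
    have i1 : Integrable fun z => χ n z * (U z * wirtinger X z) := by
      refine iU.bdd_mul (c := 1) (hχ n).1.continuous.aestronglyMeasurable
        (Eventually.of_forall (hχ n).2.2.1)
    have i2 : Integrable fun z => U z * (wirtinger (χ n) z * X z) :=
      integrable_mul_test h.weak.1 ((continuous_wirtinger (hχ n).1).mul hX.continuous)
        (hasCompactSupport_wirtinger (hχ n).2.1).mul_right
    rw [← MeasureTheory.integral_add i1 i2]
    have e := h.weak.2.2 (fun z => χ n z * X z) ((hχ n).1.mul hX) (hχ n).2.1.mul_right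
    have e1 : ∀ z, U z * wirtinger (fun z => χ n z * X z) z
        = χ n z * (U z * wirtinger X z) + U z * (wirtinger (χ n) z * X z) := fun z => by
      rw [wirtinger_mul (ContDiff.differentiableAt' (hχ n).1 z) (ContDiff.differentiableAt' hX z)]
      ring
    simp only [e1] at e
    rw [e]
    congr 2
    ext z; ring
  have t1 := (hdom iU).add hbd
  have t2 := (hdom iF).neg
  simp only [hid, add_zero] at t1
  exact tendsto_nhds_unique t1 t2

/-! ### Hermitian forms on `ℂ²` in an affine chart -/

/-- The value at `(z, 1)` of the Hermitian form on `ℂ²` with diagonal coefficients `P`, `M` and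
off-diagonal coefficient `N`. -/
def hermForm (P M : ℝ) (N : ℂ) (z : ℂ) : ℝ := P * ‖z‖ ^ 2 + 2 * (conj z * N).re + M

theorem ofReal_norm_sq (z : ℂ) : ((‖z‖ : ℂ)) ^ 2 = z * conj z := by
  rw [Complex.mul_conj, Complex.normSq_eq_norm_sq]; push_cast; ring

theorem ofReal_hermForm (P M : ℝ) (N z : ℂ) :
    (hermForm P M N z : ℂ) = P * (z * conj z) + (N * conj z + conj N * z) + M := by
  have h : ((2 * (conj z * N).re : ℝ) : ℂ) = N * conj z + conj N * z := by
    apply Complex.ext <;> simp <;> ring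
  rw [hermForm, Complex.ofReal_add, Complex.ofReal_add, h, Complex.ofReal_mul,
    Complex.ofReal_pow, ofReal_norm_sq]

theorem continuous_hermForm (P M : ℝ) (N : ℂ) : Continuous (hermForm P M N) := by
  unfold hermForm
  exact ((by fun_prop : Continuous fun z : ℂ => P * ‖z‖ ^ 2).add (continuous_const.mul
    (Complex.continuous_re.comp (Complex.continuous_conj.mul continuous_const)))).add
    continuous_const

theorem fsWeight_eq_hermForm (z : ℂ) : fsWeight z = hermForm 1 1 0 z := by
  simp [fsWeight, hermForm]; ring

/-- Completing the square. -/
theorem mul_hermForm (P M : ℝ) (N z : ℂ) :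
    P * hermForm P M N z = ‖P * z + N‖ ^ 2 + (P * M - ‖N‖ ^ 2) := by
  apply Complex.ofReal_injective
  push_cast
  rw [ofReal_hermForm, ofReal_norm_sq, ofReal_norm_sq]
  simp only [map_add, map_mul, Complex.conj_ofReal]
  ring

theorem hermForm_pos {P M : ℝ} {N : ℂ} (hP : 0 < P) (hD : 0 < P * M - ‖N‖ ^ 2) (z : ℂ) :
    0 < hermForm P M N z := by
  have h := mul_hermForm P M N z
  have : 0 < P * hermForm P M N z := by rw [h]; positivity
  exact pos_of_mul_pos_right this hP.le

/-- With `q = 1 + |z|²` and `Q = hermForm P M N`, this is `q ∂Q/∂z - Q ∂q/∂z`. -/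
def formWronskian (P M : ℝ) (N z : ℂ) : ℂ := (P - M) * conj z + conj N - N * conj z ^ 2

/-- For a Hermitian matrix `H` of trace `τ` and determinant `1`, Cayley–Hamilton gives
`|H v|² = τ ⟨H v, v⟩ - |v|²`; the component of `H v` orthogonal to `v` then has squared length
`(τ q Q - q² - Q²) / q`. -/
theorem norm_sq_formWronskian {P M : ℝ} {N : ℂ} (hD : P * M - ‖N‖ ^ 2 = 1) (z : ℂ) :
    ‖formWronskian P M N z‖ ^ 2 = (P + M) * fsWeight z * hermForm P M N z - fsWeight z ^ 2
      - hermForm P M N z ^ 2 := by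
  have hD' : (P : ℂ) * M - N * conj N = 1 := by
    rw [← ofReal_norm_sq]; exact_mod_cast hD
  apply Complex.ofReal_injective
  rw [fsWeight_eq_hermForm]
  push_cast
  rw [ofReal_norm_sq, ofReal_hermForm, ofReal_hermForm]
  simp only [formWronskian, map_add, map_sub, map_mul, map_pow, Complex.conj_conj,
    Complex.conj_ofReal, map_zero, Complex.ofReal_one]
  linear_combination (1 + z * conj z) ^ 2 * -hD'

theorem hasWirt_conj (z : ℂ) : HasWirt (fun w => conj w) 0 1 z := by
  simpa using (HasWirt.id z).star

theorem hasWirt_hermForm (P M : ℝ) (N z : ℂ) :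
    HasWirt (fun w => (hermForm P M N w : ℂ)) (P * conj z + conj N) (P * z + N) z := by
  simp only [ofReal_hermForm]
  have h1 := ((HasWirt.const P z).mul ((HasWirt.id z).mul (hasWirt_conj z))).add
    (((HasWirt.const N z).mul (hasWirt_conj z)).add
      ((HasWirt.const (conj N) z).mul (HasWirt.id z)))
  refine (h1.add (HasWirt.const M z)).of_eq ?_ ?_ <;> ring

theorem contDiff_conj : ContDiff ℝ ∞ fun z : ℂ => conj z :=
  (Complex.conjCLE : ℂ →L[ℝ] ℂ).contDiff

theorem contDiff_hermForm (P M : ℝ) (N : ℂ) : ContDiff ℝ ∞ (hermForm P M N) := by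
  have h : hermForm P M N = fun z => Complex.reCLM
      (P * (z * conj z) + (N * conj z + conj N * z) + M) := by
    ext z; rw [← ofReal_hermForm]; simp
  rw [h]
  refine Complex.reCLM.contDiff.comp ?_
  exact ((contDiff_const.mul (contDiff_id.mul contDiff_conj)).add
    ((contDiff_const.mul contDiff_conj).add (contDiff_const.mul contDiff_id))).add contDiff_const

/-! ### Möbius transformations -/

theorem SL2C.det_eq (g : SL2C) : g 0 0 * g 1 1 - g 0 1 * g 1 0 = 1 := by
  have := g.2
  rwa [Matrix.det_fin_two] at this

theorem SL2C.inv_apply (g : SL2C) : g⁻¹ 0 0 = g 1 1 ∧ g⁻¹ 0 1 = -g 0 1 ∧ g⁻¹ 1 0 = -g 1 0 ∧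
    g⁻¹ 1 1 = g 0 0 := by
  rw [Matrix.SpecialLinearGroup.SL2_inv_expl g]
  simp

/-- The numerator `a z + b` of the Möbius transformation. -/
def mobNum (g : SL2C) (z : ℂ) : ℂ := g 0 0 * z + g 0 1

/-- The denominator `c z + d` of the Möbius transformation. -/
def mobDen (g : SL2C) (z : ℂ) : ℂ := g 1 0 * z + g 1 1

/-- The Möbius transformation `z ↦ (a z + b) / (c z + d)`, with value `0` at the pole. -/
def mob (g : SL2C) (z : ℂ) : ℂ := mobNum g z / mobDen g z

/-- The derivative `1 / (c z + d)²` of the Möbius transformation, with value `0` at the pole. -/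
def mobDeriv (g : SL2C) (z : ℂ) : ℂ := 1 / mobDen g z ^ 2

/-- The squared norm of `g (z, 1)`. -/
def mobForm (g : SL2C) (z : ℂ) : ℝ := ‖mobNum g z‖ ^ 2 + ‖mobDen g z‖ ^ 2

/-- The upper left coefficient of `g⋆ g`. -/
def coefP (g : SL2C) : ℝ := ‖g 0 0‖ ^ 2 + ‖g 1 0‖ ^ 2

/-- The lower right coefficient of `g⋆ g`. -/
def coefM (g : SL2C) : ℝ := ‖g 0 1‖ ^ 2 + ‖g 1 1‖ ^ 2

/-- The upper right coefficient of `g⋆ g`. -/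
def coefN (g : SL2C) : ℂ := conj (g 0 0) * g 0 1 + conj (g 1 0) * g 1 1

/-- The squared Hilbert–Schmidt norm of `g`. -/
def hsNormSq (g : SL2C) : ℝ := coefP g + coefM g

theorem mobForm_eq (g : SL2C) (z : ℂ) :
    mobForm g z = hermForm (coefP g) (coefM g) (coefN g) z := by
  apply Complex.ofReal_injective
  rw [ofReal_hermForm]
  simp only [mobForm, coefP, coefM, coefN, mobNum, mobDen]
  push_cast
  simp only [ofReal_norm_sq, map_add, map_mul, Complex.conj_conj]
  ring

theorem coef_det (g : SL2C) : coefP g * coefM g - ‖coefN g‖ ^ 2 = 1 := by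
  apply Complex.ofReal_injective
  have h := SL2C.det_eq g
  have h' := congrArg conj h
  simp only [map_sub, map_mul, map_one] at h'
  simp only [coefP, coefM, coefN]
  push_cast
  simp only [ofReal_norm_sq, map_add, map_mul, Complex.conj_conj]
  linear_combination (conj (g 0 0) * conj (g 1 1) - conj (g 0 1) * conj (g 1 0)) * h + h'

theorem coefP_pos (g : SL2C) : 0 < coefP g := by
  have h := coef_det g
  have h1 : 0 ≤ coefP g := by unfold coefP; positivity
  refine lt_of_le_of_ne h1 fun h0 => ?_
  rw [← h0] at h
  nlinarith [sq_nonneg ‖coefN g‖]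

theorem two_le_hsNormSq (g : SL2C) : 2 ≤ hsNormSq g := by
  have h := coef_det g
  have h1 := coefP_pos g
  unfold hsNormSq
  have hM : 0 ≤ coefM g := by unfold coefM; positivity
  nlinarith [sq_nonneg (coefP g - coefM g), sq_nonneg ‖coefN g‖]

theorem mobForm_pos (g : SL2C) (z : ℂ) : 0 < mobForm g z := by
  rw [mobForm_eq]
  exact hermForm_pos (coefP_pos g) (by rw [coef_det]; exact one_pos) z

theorem continuous_mobForm (g : SL2C) : Continuous (mobForm g) := by
  have : mobForm g = hermForm (coefP g) (coefM g) (coefN g) := funext (mobForm_eq g)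
  rw [this]
  exact continuous_hermForm _ _ _

/-- The Wronskian `q ∂Q/∂z - Q ∂q/∂z` of `q = 1 + |z|²` and `Q = |g (z, 1)|²`. -/
def mobWronskian (g : SL2C) (z : ℂ) : ℂ := formWronskian (coefP g) (coefM g) (coefN g) z

theorem norm_sq_mobWronskian (g : SL2C) (z : ℂ) : ‖mobWronskian g z‖ ^ 2 =
    hsNormSq g * fsWeight z * mobForm g z - fsWeight z ^ 2 - mobForm g z ^ 2 := by
  rw [mobWronskian, norm_sq_formWronskian (coef_det g), mobForm_eq, hsNormSq]

theorem fsWeight_le (g : SL2C) (z : ℂ) : fsWeight z ≤ hsNormSq g * mobForm g z := by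
  have h := norm_sq_mobWronskian g z
  have h1 := fsWeight_pos z
  have h2 := mobForm_pos g z
  have h3 : 0 ≤ fsWeight z * (hsNormSq g * mobForm g z - fsWeight z) := by
    nlinarith [sq_nonneg ‖mobWronskian g z‖, sq_nonneg (mobForm g z)]
  nlinarith [nonneg_of_mul_nonneg_right h3 h1]

theorem mobForm_le (g : SL2C) (z : ℂ) : mobForm g z ≤ hsNormSq g * fsWeight z := by
  have h := norm_sq_mobWronskian g z
  have h1 := fsWeight_pos z
  have h2 := mobForm_pos g z
  have h3 : 0 ≤ mobForm g z * (hsNormSq g * fsWeight z - mobForm g z) := by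
    nlinarith [sq_nonneg ‖mobWronskian g z‖, sq_nonneg (fsWeight z)]
  nlinarith [nonneg_of_mul_nonneg_right h3 h2]

theorem mobNum_inv (g : SL2C) (z : ℂ) : mobNum g⁻¹ z = g 1 1 * z - g 0 1 := by
  obtain ⟨h1, h2, -, -⟩ := SL2C.inv_apply g
  rw [mobNum, h1, h2]; ring

theorem mobDen_inv (g : SL2C) (z : ℂ) : mobDen g⁻¹ z = g 0 0 - g 1 0 * z := by
  obtain ⟨-, -, h3, h4⟩ := SL2C.inv_apply g
  rw [mobDen, h3, h4]; ring

theorem hsNormSq_inv (g : SL2C) : hsNormSq g⁻¹ = hsNormSq g := by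
  obtain ⟨h1, h2, h3, h4⟩ := SL2C.inv_apply g
  simp only [hsNormSq, coefP, coefM, h1, h2, h3, h4, norm_neg]
  ring

theorem mobDen_inv_mob (g : SL2C) {z : ℂ} (hz : mobDen g z ≠ 0) :
    mobDen g⁻¹ (mob g z) = 1 / mobDen g z := by
  have h := SL2C.det_eq g
  rw [mobDen_inv, mob]
  field_simp
  rw [mobDen, mobNum]
  linear_combination h

theorem mob_inv_mob (g : SL2C) {z : ℂ} (hz : mobDen g z ≠ 0) : mob g⁻¹ (mob g z) = z := by
  have h := SL2C.det_eq g
  rw [mob, mobDen_inv_mob g hz, mobNum_inv, mob]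
  field_simp
  rw [mobDen, mobNum]
  linear_combination z * h

theorem mobDeriv_inv_mob (g : SL2C) {z : ℂ} (hz : mobDen g z ≠ 0) :
    mobDeriv g⁻¹ (mob g z) * mobDeriv g z = 1 := by
  rw [mobDeriv, mobDeriv, mobDen_inv_mob g hz]
  field_simp

theorem fsWeight_mob (g : SL2C) {z : ℂ} (hz : mobDen g z ≠ 0) :
    fsWeight (mob g z) = mobForm g z / ‖mobDen g z‖ ^ 2 := by
  have : ‖mobDen g z‖ ≠ 0 := by simpa using hz
  rw [fsWeight, mob, norm_div, mobForm]
  field_simp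
  ring

theorem mobForm_inv_mob (g : SL2C) {z : ℂ} (hz : mobDen g z ≠ 0) :
    mobForm g⁻¹ (mob g z) = fsWeight z / ‖mobDen g z‖ ^ 2 := by
  have h0 : ‖mobDen g z‖ ≠ 0 := by simpa using hz
  have h1 : mobDen g⁻¹ (mob g z) ≠ 0 := by
    rw [mobDen_inv_mob g hz]; simpa using hz
  have h := fsWeight_mob g⁻¹ h1
  rw [mob_inv_mob g hz, mobDen_inv_mob g hz, norm_div, norm_one] at h
  rw [h]
  field_simp

theorem hasDerivAt_mob (g : SL2C) {z : ℂ} (hz : mobDen g z ≠ 0) :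
    HasDerivAt (mob g) (mobDeriv g z) z := by
  have h1 : HasDerivAt (mobNum g) (g 0 0) z := by
    have := ((hasDerivAt_id z).const_mul (g 0 0)).add_const (g 0 1)
    rwa [mul_one] at this
  have h2 : HasDerivAt (mobDen g) (g 1 0) z := by
    have := ((hasDerivAt_id z).const_mul (g 1 0)).add_const (g 1 1)
    rwa [mul_one] at this
  refine (h1.div h2 hz).congr_deriv ?_
  rw [mobDeriv]
  congr 1
  rw [mobDen, mobNum]
  linear_combination SL2C.det_eq g

theorem mobDen_zero_subsingleton (g : SL2C) : {z | mobDen g z = 0}.Subsingleton := by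
  intro z hz w hw
  simp only [Set.mem_ofPred_eq, mobDen] at hz hw
  have h := SL2C.det_eq g
  have h1 : g 1 0 * (z - w) = 0 := by linear_combination hz - hw
  rcases mul_eq_zero.1 h1 with h2 | h2
  · rw [h2] at h hz
    simp only [zero_mul, zero_add] at hz
    rw [hz] at h
    simp at h
  · exact sub_eq_zero.1 h2

theorem ae_mobDen_ne_zero (g : SL2C) : ∀ᵐ z, mobDen g z ≠ 0 := by
  have := (mobDen_zero_subsingleton g).measure_zero (volume : Measure ℂ)
  simpa [ae_iff] using this

theorem measurable_mob (g : SL2C) : Measurable (mob g) := by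
  unfold mob mobNum mobDen; fun_prop

theorem measurable_mobDeriv (g : SL2C) : Measurable (mobDeriv g) := by
  unfold mobDeriv mobDen; fun_prop

theorem mob_image (g : SL2C) : mob g '' {z | mobDen g z ≠ 0} = {z | mobDen g⁻¹ z ≠ 0} := by
  ext w
  constructor
  · rintro ⟨z, hz, rfl⟩
    simp only [Set.mem_ofPred_eq] at hz ⊢
    rw [mobDen_inv_mob g hz]
    simpa using hz
  · intro hw
    have hw' : mobDen g⁻¹ w ≠ 0 := hw
    have h1 := mob_inv_mob g⁻¹ hw'
    have h2 := mobDen_inv_mob g⁻¹ hw'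
    rw [inv_inv] at h1 h2
    exact ⟨mob g⁻¹ w, by simp only [Set.mem_ofPred_eq]; rw [h2]; simpa using hw', h1⟩

theorem mob_injOn (g : SL2C) : Set.InjOn (mob g) {z | mobDen g z ≠ 0} := fun z hz w hw h => by
  rw [← mob_inv_mob g (z := z) hz, h, mob_inv_mob g (z := w) hw]

theorem det_wirtCLM (p : ℂ) : (wirtCLM p 0).det = ‖p‖ ^ 2 := by
  have : wirtCLM p 0 = (ContinuousLinearMap.toSpanSingleton ℂ p).restrictScalars ℝ := by
    ext
    simp [wirtCLM_apply, mul_comm]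
  rw [this]
  simp [ContinuousLinearMap.det, LinearMap.det_restrictScalars,
      Algebra.norm_complex_eq, Complex.normSq_eq_norm_sq]

theorem measurableSet_mobDen_ne (g : SL2C) : MeasurableSet {z | mobDen g z ≠ 0} := by
  have h : Measurable (mobDen g) := by unfold mobDen; fun_prop
  exact (measurableSet_eq_fun h measurable_const).compl

theorem setLIntegral_mobDen_ne (g : SL2C) (G : ℂ → ℝ≥0∞) :
    ∫⁻ z in {z | mobDen g z ≠ 0}, G z = ∫⁻ z, G z := by
  have : (volume : Measure ℂ).restrict {z | mobDen g z ≠ 0} = volume :=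
    Measure.restrict_eq_self_of_ae_mem (ae_mobDen_ne_zero g)
  rw [this]

theorem setIntegral_mobDen_ne (g : SL2C) (G : ℂ → ℂ) :
    ∫ z in {z | mobDen g z ≠ 0}, G z = ∫ z, G z := by
  have : (volume : Measure ℂ).restrict {z | mobDen g z ≠ 0} = volume :=
    Measure.restrict_eq_self_of_ae_mem (ae_mobDen_ne_zero g)
  rw [this]

theorem lintegral_comp_mob (g : SL2C) (G : ℂ → ℝ≥0∞) :
    ∫⁻ z, ENNReal.ofReal (‖mobDeriv g z‖ ^ 2) * G (mob g z) = ∫⁻ w, G w := by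
  have h := lintegral_image_eq_lintegral_abs_det_fderiv_mul volume (measurableSet_mobDen_ne g)
    (fun z hz => (HasFDerivAt.hasFDerivWithinAt
      (show HasFDerivAt (mob g) (wirtCLM (mobDeriv g z) 0) z from
        HasWirt.of_hasDerivAt (hasDerivAt_mob g hz)))) (mob_injOn g) G
  rw [mob_image, setLIntegral_mobDen_ne, setLIntegral_mobDen_ne] at h
  rw [h]
  refine lintegral_congr fun z => ?_
  rw [det_wirtCLM, abs_of_nonneg (by positivity)]

theorem integral_comp_mob (g : SL2C) (G : ℂ → ℂ) :
    ∫ z, (‖mobDeriv g z‖ ^ 2 : ℝ) • G (mob g z) = ∫ w, G w := by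
  have h := integral_image_eq_integral_abs_det_fderiv_smul volume (measurableSet_mobDen_ne g)
    (fun z hz => (HasFDerivAt.hasFDerivWithinAt
      (show HasFDerivAt (mob g) (wirtCLM (mobDeriv g z) 0) z from
        HasWirt.of_hasDerivAt (hasDerivAt_mob g hz)))) (mob_injOn g) G
  rw [mob_image, setIntegral_mobDen_ne, setIntegral_mobDen_ne] at h
  rw [h]
  congr 1
  ext z
  rw [det_wirtCLM, abs_of_nonneg (by positivity)]

/-! ### Möbius invariance of the Sobolev space -/

theorem locallyIntegrable_of_memLp {U : ℂ → ℂ} (h : MemLp (fun z => U z / fsWeight z) 2) :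
    LocallyIntegrable U := by
  have h1 : LocallyIntegrable fun z => (fsWeight z : ℂ) • (U z / fsWeight z) :=
    (h.locallyIntegrable (by norm_num)).continuous_smul
      (Complex.continuous_ofReal.comp continuous_fsWeight)
  refine h1.congr (Eventually.of_forall fun z => ?_)
  have h0 : (fsWeight z : ℂ) ≠ 0 := by exact_mod_cast (fsWeight_pos z).ne'
  simp only [smul_eq_mul]
  field_simp

theorem norm_mobDeriv (g : SL2C) (z : ℂ) : ‖mobDeriv g z‖ = 1 / ‖mobDen g z‖ ^ 2 := by
  simp [mobDeriv]

/-- Change of variables in an integral against the Fubini–Study measure. -/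
theorem lintegral_comp_mob_fsWeight (g : SL2C) (G : ℂ → ℝ≥0∞) :
    ∫⁻ z, G (mob g z) * ENNReal.ofReal (1 / fsWeight z ^ 2)
      = ∫⁻ w, G w * ENNReal.ofReal (1 / mobForm g⁻¹ w ^ 2) := by
  rw [← lintegral_comp_mob g⁻¹]
  refine lintegral_congr_ae ?_
  filter_upwards [ae_mobDen_ne_zero g⁻¹] with w hw
  have h1 := mob_inv_mob g⁻¹ hw
  rw [inv_inv] at h1
  have h0 : 0 < ‖mobDen g⁻¹ w‖ := by simpa using hw
  have h2 := mobForm_pos g⁻¹ w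
  rw [h1, fsWeight_mob g⁻¹ hw, norm_mobDeriv, mul_left_comm, ← ENNReal.ofReal_mul (by positivity)]
  congr 2
  field_simp

theorem integral_comp_mob_fsDensity (g : SL2C) (U : ℂ → ℂ) :
    ∫ z, U (mob g z) * fsDensity z
      = ∫ w, U w * ((1 / (Real.pi * mobForm g⁻¹ w ^ 2) : ℝ) : ℂ) := by
  rw [← integral_comp_mob g⁻¹]
  refine integral_congr_ae ?_
  filter_upwards [ae_mobDen_ne_zero g⁻¹] with w hw
  have h1 := mob_inv_mob g⁻¹ hw
  rw [inv_inv] at h1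
  have h0 : 0 < ‖mobDen g⁻¹ w‖ := by simpa using hw
  have h2 := mobForm_pos g⁻¹ w
  have hpi := Real.pi_pos
  rw [h1, fsDensity_eq, fsWeight_mob g⁻¹ hw, norm_mobDeriv, Complex.real_smul, mul_left_comm,
    ← Complex.ofReal_mul]
  congr 2
  field_simp

theorem enorm_sq_eq_ofReal (x : ℂ) : ‖x‖ₑ ^ 2 = ENNReal.ofReal (‖x‖ ^ 2) := by
  rw [ENNReal.ofReal_pow (norm_nonneg _), ofReal_norm]

theorem enorm_div_fsWeight_sq (x z : ℂ) :
    ‖x / fsWeight z‖ₑ ^ 2 = ‖x‖ₑ ^ 2 * ENNReal.ofReal (1 / fsWeight z ^ 2) := by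
  rw [enorm_sq_eq_ofReal, enorm_sq_eq_ofReal, ← ENNReal.ofReal_mul (by positivity), norm_div,
    Complex.norm_real, Real.norm_eq_abs, abs_of_pos (fsWeight_pos z)]
  congr 1
  ring

/-- Conformal invariance of the Dirichlet energy. -/
theorem lintegral_dz_comp_mob (g : SL2C) (f : ℂ → ℂ) :
    ∫⁻ z, ‖f (mob g z) * mobDeriv g z‖ₑ ^ 2 = ∫⁻ w, ‖f w‖ₑ ^ 2 := by
  rw [← lintegral_comp_mob g fun w => ‖f w‖ₑ ^ 2]
  refine lintegral_congr fun z => ?_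
  rw [enorm_mul, mul_pow, enorm_sq_eq_ofReal (mobDeriv g z), mul_comm]

theorem measurable_div_fsWeight {U : ℂ → ℂ} (h : Measurable U) :
    Measurable fun z => U z / fsWeight z :=
  h.div (Complex.continuous_ofReal.comp continuous_fsWeight).measurable

theorem contDiff_mobNum (g : SL2C) : ContDiff ℝ ∞ (mobNum g) :=
  (contDiff_const.mul contDiff_id).add contDiff_const

theorem contDiff_mobDen (g : SL2C) : ContDiff ℝ ∞ (mobDen g) :=
  (contDiff_const.mul contDiff_id).add contDiff_const

theorem contDiffAt_mob (g : SL2C) {z : ℂ} (hz : mobDen g z ≠ 0) : ContDiffAt ℝ ∞ (mob g) z :=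
  (contDiff_mobNum g).contDiffAt.mul ((contDiff_mobDen g).contDiffAt.inv hz)

theorem contDiffAt_mobDeriv (g : SL2C) {z : ℂ} (hz : mobDen g z ≠ 0) :
    ContDiffAt ℝ ∞ (mobDeriv g) z :=
  contDiffAt_const.mul (((contDiff_mobDen g).pow 2).contDiffAt.inv (pow_ne_zero 2 hz))

theorem hasDerivAt_mobDeriv (g : SL2C) {z : ℂ} (hz : mobDen g z ≠ 0) :
    ∃ d, HasDerivAt (mobDeriv g) d z := by
  unfold mobDeriv
  have h2 : HasDerivAt (mobDen g) (g 1 0) z := by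
    have := ((hasDerivAt_id z).const_mul (g 1 0)).add_const (g 1 1)
    rwa [mul_one] at this
  exact ⟨_, (hasDerivAt_const z (1 : ℂ)).div (h2.pow 2) (pow_ne_zero 2 hz)⟩

theorem mobNum_ne_zero (g : SL2C) {z : ℂ} (hz : mobDen g z = 0) : mobNum g z ≠ 0 := by
  intro h
  have := mobForm_pos g z
  simp [mobForm, h, hz] at this

/-- The pullback `φ(g w) conj(g'(w))` of the `(0,1)`-form `φ dz̄`; a smooth function of `w`, also at
the pole of `g`, when `φ` has compact support. -/
def pullbackForm (g : SL2C) (φ : ℂ → ℂ) (w : ℂ) : ℂ := φ (mob g w) * conj (mobDeriv g w)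

theorem pullbackForm_eventuallyEq_zero (g : SL2C) {φ : ℂ → ℂ} (hc : HasCompactSupport φ) {w : ℂ}
    (hw : mobDen g w = 0) : pullbackForm g φ =ᶠ[𝓝 w] fun _ => 0 := by
  obtain ⟨R, hR⟩ := hc.isCompact.isBounded.subset_closedBall 0
  have h1 : Continuous fun w => ‖mobNum g w‖ - R * ‖mobDen g w‖ := by
    unfold mobNum mobDen; fun_prop
  have h2 : 0 < ‖mobNum g w‖ - R * ‖mobDen g w‖ := by
    rw [hw, norm_zero, mul_zero, sub_zero]
    exact norm_pos_iff.2 (mobNum_ne_zero g hw)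
  filter_upwards [h1.continuousAt.eventually (lt_mem_nhds h2)] with v hv
  by_cases hv0 : mobDen g v = 0
  · simp [pullbackForm, mobDeriv, hv0]
  · have h0 : 0 < ‖mobDen g v‖ := by simpa using hv0
    have : φ (mob g v) = 0 := by
      refine image_eq_zero_of_notMem_tsupport fun hmem => ?_
      have := hR hmem
      rw [mem_closedBall_zero_iff, mob, norm_div, div_le_iff₀ h0] at this
      linarith
    simp [pullbackForm, this]

theorem contDiff_pullbackForm (g : SL2C) {φ : ℂ → ℂ} (h : ContDiff ℝ ∞ φ)
    (hc : HasCompactSupport φ) : ContDiff ℝ ∞ (pullbackForm g φ) := by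
  rw [contDiff_iff_contDiffAt]
  intro w
  by_cases hw : mobDen g w = 0
  · exact contDiffAt_const.congr_of_eventuallyEq (pullbackForm_eventuallyEq_zero g hc hw)
  · exact (h.contDiffAt.comp w (contDiffAt_mob g hw)).mul
      (contDiff_conj.contDiffAt.comp w (contDiffAt_mobDeriv g hw))

theorem wirtinger_pullbackForm (g : SL2C) {φ : ℂ → ℂ} (h : ContDiff ℝ ∞ φ)
    (hc : HasCompactSupport φ) (w : ℂ) :
    wirtinger (pullbackForm g φ) w = wirtinger φ (mob g w) * (‖mobDeriv g w‖ ^ 2 : ℝ) := by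
  by_cases hw : mobDen g w = 0
  · have h0 : HasWirt (pullbackForm g φ) 0 0 w :=
      HasFDerivAt.congr_of_eventuallyEq (HasWirt.const 0 w)
        (pullbackForm_eventuallyEq_zero g hc hw)
    rw [h0.wirtinger_eq]
    simp [mobDeriv, hw]
  · obtain ⟨r, hr⟩ := HasWirt.of_differentiableAt (ContDiff.differentiableAt' h (mob g w))
    obtain ⟨d, hd⟩ := hasDerivAt_mobDeriv g hw
    have h1 := (hr.comp (HasWirt.of_hasDerivAt (hasDerivAt_mob g hw))).mul
      (HasWirt.of_hasDerivAt hd).star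
    have h2 := h1.wirtinger_eq
    simp only [map_zero, mul_zero, add_zero, zero_add] at h2
    change wirtinger (fun w => φ (mob g w) * conj (mobDeriv g w)) w = _
    rw [h2, Complex.ofReal_pow, ofReal_norm_sq]
    ring

theorem exists_bound_pullback (g : SL2C) {ψ : ℂ → ℂ} (h : Continuous ψ)
    (hc : HasCompactSupport ψ) :
    ∃ C, 0 ≤ C ∧ ∀ w, ‖ψ (mob g w)‖ * ‖mobDeriv g w‖ ≤ C / fsWeight w ∧
      ‖ψ (mob g w)‖ * ‖mobDeriv g w‖ ^ 2 ≤ C / fsWeight w ^ 2 := by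
  obtain ⟨R, hR⟩ := hc.isCompact.isBounded.subset_closedBall 0
  obtain ⟨A, hA⟩ := hc.exists_bound_of_continuous h
  have hA0 : 0 ≤ A := (norm_nonneg _).trans (hA 0)
  have hτ := two_le_hsNormSq g
  let K := (1 + R ^ 2) * hsNormSq g
  have hK1 : 1 ≤ K := by
    have : 1 ≤ 1 + R ^ 2 := by nlinarith [sq_nonneg R]
    change 1 ≤ (1 + R ^ 2) * hsNormSq g
    nlinarith
  refine ⟨A * K ^ 2, by positivity, fun w => ?_⟩
  have hq := fsWeight_pos w
  by_cases hw : mobDen g w = 0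
  · simp only [mobDeriv, hw]
    constructor <;> (simp; positivity)
  by_cases hs : mob g w ∈ tsupport ψ
  · have hb := hR hs
    have h0 : 0 < ‖mobDen g w‖ := by simpa using hw
    rw [mem_closedBall_zero_iff] at hb
    have h1 : ‖mob g w‖ ^ 2 ≤ R ^ 2 := by gcongr
    have h2 := fsWeight_le g w
    have h3 := fsWeight_mob g hw
    rw [fsWeight, eq_div_iff (by positivity)] at h3
    have h4 : ‖mobDeriv g w‖ ≤ K / fsWeight w := by
      rw [norm_mobDeriv, div_le_div_iff₀ (by positivity) hq, one_mul]
      calc fsWeight w ≤ hsNormSq g * ((1 + ‖mob g w‖ ^ 2) * ‖mobDen g w‖ ^ 2) := by rwa [h3]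
        _ ≤ hsNormSq g * ((1 + R ^ 2) * ‖mobDen g w‖ ^ 2) := by gcongr
        _ = _ := by ring
    constructor
    · calc ‖ψ (mob g w)‖ * ‖mobDeriv g w‖ ≤ A * (K / fsWeight w) := by gcongr; exact hA _
        _ ≤ A * K ^ 2 / fsWeight w := by
          rw [← mul_div_assoc]; gcongr; nlinarith
    · calc ‖ψ (mob g w)‖ * ‖mobDeriv g w‖ ^ 2 ≤ A * (K / fsWeight w) ^ 2 := by gcongr; exact hA _
        _ = _ := by ring
  · rw [image_eq_zero_of_notMem_tsupport hs]
    constructor <;> (simp; positivity)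

/-- `SL₂(ℂ)` acts on the Sobolev space by pullback. -/
theorem Sob.comp_mob {U f : ℂ → ℂ} (h : Sob U f) (g : SL2C) :
    Sob (fun z => U (mob g z)) (fun z => f (mob g z) * mobDeriv g z) := by
  have mU : Measurable fun z => U (mob g z) := h.meas.comp (measurable_mob g)
  have mf : Measurable fun z => f (mob g z) * mobDeriv g z :=
    (h.meas_dz.comp (measurable_mob g)).mul (measurable_mobDeriv g)
  have hU : MemLp (fun z => U (mob g z) / fsWeight z) 2 := by
    rw [memLp_two_iff (measurable_div_fsWeight mU).aestronglyMeasurable]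
    simp only [enorm_div_fsWeight_sq]
    rw [lintegral_comp_mob_fsWeight g fun w => ‖U w‖ₑ ^ 2]
    have h1 := (memLp_two_iff h.memLp.1).1 h.memLp
    simp only [enorm_div_fsWeight_sq] at h1
    have h2 : ∀ w, ‖U w‖ₑ ^ 2 * ENNReal.ofReal (1 / mobForm g⁻¹ w ^ 2)
        ≤ ENNReal.ofReal (hsNormSq g⁻¹ ^ 2) *
          (‖U w‖ₑ ^ 2 * ENNReal.ofReal (1 / fsWeight w ^ 2)) := fun w => by
      rw [mul_left_comm, ← ENNReal.ofReal_mul (by positivity)]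
      gcongr
      have e1 := mobForm_pos g⁻¹ w
      have e2 := fsWeight_pos w
      rw [mul_one_div, div_le_div_iff₀ (by positivity) (by positivity), one_mul, ← mul_pow]
      gcongr
      exact fsWeight_le _ _
    refine (lintegral_mono h2).trans_lt ?_
    rw [lintegral_const_mul' _ _ ENNReal.ofReal_ne_top]
    exact ENNReal.mul_lt_top ENNReal.ofReal_lt_top h1
  have hf : MemLp (fun z => f (mob g z) * mobDeriv g z) 2 := by
    rw [memLp_two_iff mf.aestronglyMeasurable, lintegral_dz_comp_mob]
    exact (memLp_two_iff h.memLp_dz.1).1 h.memLp_dz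
  refine ⟨mU, mf, hU, hf, locallyIntegrable_of_memLp hU,
    hf.locallyIntegrable (by norm_num), fun φ h1 h2 => ?_⟩
  obtain ⟨C, -, hC⟩ := exists_bound_pullback g⁻¹ h1.continuous h2
  obtain ⟨C', -, hC'⟩ := exists_bound_pullback g⁻¹ (continuous_wirtinger h1)
    (hasCompactSupport_wirtinger h2)
  have hX := contDiff_pullbackForm g⁻¹ h1 h2
  have key := h.integral_mul_wirtinger hX (C := C) (C' := C')
    (fun w => by simpa [pullbackForm] using (hC w).1)
    (fun w => by
      rw [wirtinger_pullbackForm g⁻¹ h1 h2, norm_mul, Complex.norm_real, Real.norm_eq_abs,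
        abs_of_nonneg (by positivity)]
      exact (hC' w).2)
  rw [← integral_comp_mob g⁻¹, ← integral_comp_mob g⁻¹ fun z => _ * φ z]
  refine (integral_congr_ae ?_).trans (key.trans (congrArg _ (integral_congr_ae ?_)))
  · filter_upwards [ae_mobDen_ne_zero g⁻¹] with w hw
    have e1 := mob_inv_mob g⁻¹ hw
    rw [inv_inv] at e1
    rw [wirtinger_pullbackForm g⁻¹ h1 h2, e1, Complex.real_smul]
    ring
  · filter_upwards [ae_mobDen_ne_zero g⁻¹] with w hw
    have e1 := mob_inv_mob g⁻¹ hw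
    have e2 := mobDeriv_inv_mob g⁻¹ hw
    rw [inv_inv] at e1 e2
    rw [e1, Complex.real_smul, pullbackForm, Complex.ofReal_pow, ofReal_norm_sq]
    linear_combination (-f w * φ (mob g⁻¹ w) * conj (mobDeriv g⁻¹ w)) * e2

/-! ### The Cauchy transform -/

/-- The mass `∫ ω_FS` of the Fubini–Study form. -/
def fsMass : ℝ := ∫ z, fsDensity z

theorem fsMass_pos : 0 < fsMass := by
  refine (integral_pos_iff_support_of_nonneg (fun z => (fsDensity_pos z).le)
    integrable_fsDensity).2 ?_
  have : Function.support fsDensity = Set.univ := by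
    ext z; simp [(fsDensity_pos z).ne']
  rw [this]
  simp

theorem finrank_complex_gt : (1 : ℝ) < Module.finrank ℝ ℂ := by
  rw [Complex.finrank_real_complex]; norm_num

/-- The kernel `1 / (π w̄)`, the fundamental solution of `∂/∂w`. -/
def cauchyKernel (w : ℂ) : ℂ := 1 / (Real.pi * conj w)

theorem measurable_cauchyKernel : Measurable cauchyKernel := by
  unfold cauchyKernel
  exact measurable_const.div (measurable_const.mul Complex.continuous_conj.measurable)

theorem locallyIntegrable_cauchyKernel : LocallyIntegrable cauchyKernel := by
  refine locallyIntegrable_of_norm_le_rpow (C := 1 / Real.pi) (α := 1)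
    (by rw [Complex.finrank_real_complex]; norm_num) finrank_complex_gt
    (Eventually.of_forall fun w => ?_) measurable_cauchyKernel.aestronglyMeasurable
  rw [cauchyKernel, Real.rpow_neg_one, norm_div, norm_mul, Complex.norm_real, RCLike.norm_conj,
    Real.norm_eq_abs, abs_of_pos Real.pi_pos, norm_one]
  apply le_of_eq; field_simp

theorem hasWirt_regularized {ε : ℝ} (hε : 0 < ε) (w : ℂ) :
    HasWirt (fun w => w / ((hermForm 1 (ε ^ 2) 0 w : ℝ) : ℂ))
      (ε ^ 2 / (hermForm 1 (ε ^ 2) 0 w : ℂ) ^ 2) (-w ^ 2 / (hermForm 1 (ε ^ 2) 0 w : ℂ) ^ 2) w := by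
  have h0 : (hermForm 1 (ε ^ 2) 0 w : ℂ) ≠ 0 := by
    exact_mod_cast (hermForm_pos one_pos (by simp; positivity) w).ne'
  refine ((HasWirt.id w).div (hasWirt_hermForm 1 (ε ^ 2) 0 w) h0).of_eq ?_ ?_
  · congr 1
    rw [ofReal_hermForm]
    push_cast
    simp
  · congr 1
    simp
    ring

/-- The Cauchy–Pompeiu formula at the origin. The constant `fsMass` is `1`, but its value is
immaterial below, and leaving it in this form avoids polar coordinates: up to the factor `1 / π`,
the formula is the limit `ε → 0` of
`∫ ∂ψ(w) w / (|w|² + ε²) = - ∫ ψ(w) ε² / (|w|² + ε²)² = - ∫ ψ(ε v) / (1 + |v|²)²`. -/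
theorem integral_wirtinger_mul_cauchyKernel {ψ : ℂ → ℂ} (h : ContDiff ℝ ∞ ψ)
    (hc : HasCompactSupport ψ) :
    ∫ w, cauchyKernel w * wirtinger ψ w = - (fsMass * ψ 0) := by
  have cw := continuous_wirtinger h
  have sw := hasCompactSupport_wirtinger hc
  let ε : ℕ → ℝ := fun n => 1 / ((n : ℝ) + 1)
  have hε : ∀ n, 0 < ε n := fun n => by positivity
  have hε0 : Tendsto ε atTop (𝓝 0) := tendsto_one_div_add_atTop_nhds_zero_nat
  have hpos : ∀ n w, 0 < hermForm 1 (ε n ^ 2) 0 w := fun n w =>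
    hermForm_pos one_pos (by have := hε n; simp; positivity) w
  have hform : ∀ n w, hermForm 1 (ε n ^ 2) 0 w = ‖w‖ ^ 2 + ε n ^ 2 := fun n w => by
    simp [hermForm]
  have hsm : ∀ n, ContDiff ℝ ∞ fun w : ℂ => w / ((hermForm 1 (ε n ^ 2) 0 w : ℝ) : ℂ) :=
    fun n => contDiff_id.mul ((Complex.ofRealCLM.contDiff.comp (contDiff_hermForm _ _ _)).inv
      fun w => Complex.ofReal_ne_zero.2 (hpos n w).ne')
  have key : ∀ n, ∫ w, w / ((hermForm 1 (ε n ^ 2) 0 w : ℝ) : ℂ) * wirtinger ψ w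
      = - ∫ v, ((1 / fsWeight v ^ 2 : ℝ) : ℂ) * ψ (ε n • v) := fun n => by
    rw [(HasWeakDz.of_contDiff (hsm n)).2.2 ψ h hc]
    congr 1
    have hs := Measure.integral_comp_smul (volume : Measure ℂ) (fun w =>
      wirtinger (fun w : ℂ => w / ((hermForm 1 (ε n ^ 2) 0 w : ℝ) : ℂ)) w * ψ w) (ε n)
    have e0 := hε n
    have e1 : ∫ w, wirtinger (fun w : ℂ => w / ((hermForm 1 (ε n ^ 2) 0 w : ℝ) : ℂ)) w * ψ w
        = (ε n ^ 2 : ℝ) • ∫ v, wirtinger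
          (fun w : ℂ => w / ((hermForm 1 (ε n ^ 2) 0 w : ℝ) : ℂ)) (ε n • v) * ψ (ε n • v) := by
      rw [hs, Complex.finrank_real_complex, abs_of_pos (by positivity), smul_smul,
        mul_inv_cancel₀ (by positivity), one_smul]
    rw [e1, ← integral_smul]
    refine MeasureTheory.integral_congr_ae (Eventually.of_forall fun v => ?_)
    have e2 := (fsWeight_pos v).ne'
    have e3 : hermForm 1 (ε n ^ 2) 0 (ε n • v) = ε n ^ 2 * fsWeight v := by
      rw [hform, norm_smul, Real.norm_eq_abs, abs_of_pos e0, fsWeight]; ring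
    simp only [(hasWirt_regularized e0 _).wirtinger_eq, e3]
    simp only [Complex.real_smul]
    have e4 : (fsWeight v : ℂ) ≠ 0 := by exact_mod_cast e2
    have e5 : (ε n : ℂ) ≠ 0 := by exact_mod_cast e0.ne'
    push_cast
    field_simp
  have iL : Integrable fun w => cauchyKernel w * wirtinger ψ w :=
    integrable_mul_test locallyIntegrable_cauchyKernel cw sw
  have hL : Tendsto (fun n => ∫ w, w / ((hermForm 1 (ε n ^ 2) 0 w : ℝ) : ℂ) * wirtinger ψ w) atTop
      (𝓝 (∫ w, Real.pi * (cauchyKernel w * wirtinger ψ w))) := by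
    refine tendsto_integral_of_dominated_convergence
      (fun w => ‖(Real.pi : ℂ) * (cauchyKernel w * wirtinger ψ w)‖)
      (fun n => ((hsm n).continuous.mul cw).aestronglyMeasurable) (iL.const_mul _).norm
      (fun n => Eventually.of_forall fun w => ?_) (Eventually.of_forall fun w => ?_)
    · rw [← mul_assoc, norm_mul, norm_mul]
      gcongr
      by_cases hw : w = 0
      · simp [hw]
      have h1 : 0 < ‖w‖ := by simpa using hw
      have h2 := hpos n w
      have hpi := Real.pi_pos
      rw [cauchyKernel, norm_div, norm_mul, norm_div, norm_mul, RCLike.norm_conj, norm_one,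
        Complex.norm_real, Complex.norm_real, Real.norm_eq_abs, Real.norm_eq_abs,
        abs_of_pos h2, abs_of_pos hpi]
      have e : Real.pi * (1 / (Real.pi * ‖w‖)) = 1 / ‖w‖ := by field_simp
      rw [e, div_le_div_iff₀ h2 h1, hform]
      nlinarith [sq_nonneg (ε n)]
    · by_cases hw : w = 0
      · simp [hw, cauchyKernel]
      · have h1 : (Real.pi : ℂ) * (cauchyKernel w * wirtinger ψ w)
            = w / (((‖w‖ ^ 2 + 0 ^ 2 : ℝ)) : ℂ) * wirtinger ψ w := by
          have hpi : (Real.pi : ℂ) ≠ 0 := by exact_mod_cast Real.pi_ne_zero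
          have hcw : conj w ≠ 0 := by simpa using hw
          rw [cauchyKernel]
          push_cast
          rw [ofReal_norm_sq]
          field_simp
          ring
        rw [h1]
        refine Tendsto.mul_const _ (Tendsto.div tendsto_const_nhds ?_ ?_)
        · simp only [hform]
          exact (Complex.continuous_ofReal.tendsto _).comp ((hε0.pow 2).const_add _)
        · simpa using hw
  have hR : Tendsto (fun n => ∫ v, ((1 / fsWeight v ^ 2 : ℝ) : ℂ) * ψ (ε n • v)) atTop
      (𝓝 (∫ v, ((1 / fsWeight v ^ 2 : ℝ) : ℂ) * ψ 0)) := by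
    obtain ⟨A, hA⟩ := hc.exists_bound_of_continuous h.continuous
    have iw := integrable_inv_fsWeight_sq
    refine tendsto_integral_of_dominated_convergence (fun v => 1 / fsWeight v ^ 2 * A)
      (fun n => iw.ofReal.aestronglyMeasurable.mul
        (h.continuous.comp (continuous_const_smul (ε n))).aestronglyMeasurable)
      (iw.mul_const _) (fun n => Eventually.of_forall fun v => ?_)
      (Eventually.of_forall fun v => ?_)
    · rw [norm_mul, Complex.norm_real, Real.norm_eq_abs, abs_of_nonneg (by positivity)]
      gcongr
      exact hA _
    · refine Tendsto.const_mul _ ((h.continuous.tendsto 0).comp ?_)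
      simpa using hε0.smul_const v
  have e := tendsto_nhds_unique hL (by simpa only [key] using hR.neg)
  rw [integral_const_mul, integral_mul_const] at e
  have e2 : ∫ v, ((1 / fsWeight v ^ 2 : ℝ) : ℂ) = Real.pi * fsMass := by
    rw [integral_complex_ofReal, fsMass, ← Complex.ofReal_mul, ← integral_const_mul]
    congr 2
    ext z
    have := fsWeight_pos z
    have := Real.pi_pos
    rw [fsDensity_eq]; field_simp
  rw [e2] at e
  have hpi : (Real.pi : ℂ) ≠ 0 := by exact_mod_cast Real.pi_ne_zero
  apply mul_left_cancel₀ hpi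
  rw [e]; ring

open scoped Convolution in
/-- The Cauchy transform of `ψ`. -/
def cauchyTransform (ψ : ℂ → ℂ) : ℂ → ℂ :=
  cauchyKernel ⋆[ContinuousLinearMap.mul ℝ ℂ] ψ

theorem contDiff_cauchyTransform {ψ : ℂ → ℂ} (h : ContDiff ℝ ∞ ψ) (hc : HasCompactSupport ψ) :
    ContDiff ℝ ∞ (cauchyTransform ψ) :=
  hc.contDiff_convolution_right (n := ⊤) _ locallyIntegrable_cauchyKernel h

theorem wirtinger_cauchyTransform {ψ : ℂ → ℂ} (h : ContDiff ℝ ∞ ψ) (hc : HasCompactSupport ψ)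
    (w : ℂ) : wirtinger (cauchyTransform ψ) w = fsMass * ψ w := by
  have hd := hc.hasFDerivAt_convolution_right (ContinuousLinearMap.mul ℝ ℂ)
    locallyIntegrable_cauchyKernel (h.of_le (by simp)) w
  have e1 : ∀ v, fderiv ℝ (cauchyTransform ψ) w v
      = ∫ t, cauchyKernel t * fderiv ℝ ψ (w - t) v := fun v => by
    have : fderiv ℝ (cauchyTransform ψ) w = _ := hd.fderiv
    rw [this, convolution_precompR_apply _ locallyIntegrable_cauchyKernel (hc.fderiv (𝕜 := ℝ))
      (h.continuous_fderiv (by simp))]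
    rfl
  -- apply the Cauchy–Pompeiu formula to the reflected translate of `ψ`
  let ψ' : ℂ → ℂ := fun t => ψ (w - t)
  have c' : ContDiff ℝ ∞ ψ' := h.comp (contDiff_const.sub contDiff_id)
  have s' : HasCompactSupport ψ' := hc.comp_homeomorph (Homeomorph.subLeft w)
  have e2 : ∀ t v, fderiv ℝ ψ' t v = - fderiv ℝ ψ (w - t) v := fun t v => by
    have h1 : HasFDerivAt ψ' ((fderiv ℝ ψ (w - t)).comp (-ContinuousLinearMap.id ℝ ℂ)) t := by
      refine HasFDerivAt.comp t (ContDiff.differentiableAt' h (w - t)).hasFDerivAt ?_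
      simpa using (hasFDerivAt_id (𝕜 := ℝ) t).const_sub w
    rw [h1.fderiv]
    simp
  have i2 : ∀ v, Integrable fun t => cauchyKernel t * fderiv ℝ ψ' t v := fun v =>
    integrable_mul_test locallyIntegrable_cauchyKernel
      ((c'.continuous_fderiv (by simp)).clm_apply continuous_const)
      ((s'.fderiv (𝕜 := ℝ)).comp_left (g := fun L : ℂ →L[ℝ] ℂ => L v) (by simp))
  have e3 : ∀ v, fderiv ℝ (cauchyTransform ψ) w v
      = - ∫ t, cauchyKernel t * fderiv ℝ ψ' t v := fun v => by
    rw [e1, ← integral_neg]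
    congr 1
    ext t
    rw [e2]; ring
  have e4 := integral_wirtinger_mul_cauchyKernel c' s'
  have e5 : ∀ t, cauchyKernel t * wirtinger ψ' t = (1 / 2) * (cauchyKernel t * fderiv ℝ ψ' t 1)
      - (Complex.I / 2) * (cauchyKernel t * fderiv ℝ ψ' t Complex.I) := fun t => by
    simp only [wirtinger]; ring
  simp only [e5] at e4
  rw [MeasureTheory.integral_sub ((i2 1).const_mul _) ((i2 _).const_mul _), integral_const_mul,
    integral_const_mul] at e4
  rw [wirtinger, e3, e3]
  simp only [ψ', sub_zero] at e4
  linear_combination -e4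

/-! ### The Poincaré inequality -/

/-- The kernel `K(z, w)` such that `∂K(z, ·) = δ_z - ω_FS`, up to normalization. -/
def greenKernel (z w : ℂ) : ℂ := cauchyKernel (w - z) - w / (Real.pi * fsWeight w)

/-- The `(0,1)`-form `Φ` with `∂Φ = ψ - (∫ ψ) ω_FS`, up to normalization. -/
def greenForm (ψ : ℂ → ℂ) (w : ℂ) : ℂ :=
  cauchyTransform ψ w - (∫ z, ψ z) * (w / (Real.pi * fsWeight w))

theorem greenForm_eq_integral {ψ : ℂ → ℂ} (h : ContDiff ℝ ∞ ψ) (hc : HasCompactSupport ψ) (w : ℂ) :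
    greenForm ψ w = ∫ z, ψ z * greenKernel z w := by
  have e1 : cauchyTransform ψ w = ∫ z, ψ z * cauchyKernel (w - z) := by
    have := integral_sub_left_eq_self (fun t => cauchyKernel t * ψ (w - t)) volume w
    simp only [sub_sub_cancel] at this
    change ∫ t, cauchyKernel t * ψ (w - t) = _
    rw [← this]
    congr 1
    ext z; ring
  have i1 : Integrable fun z => ψ z * cauchyKernel (w - z) := by
    have h1 : Integrable fun t => cauchyKernel t * ψ (w - t) :=
      integrable_mul_test locallyIntegrable_cauchyKernel
        (h.continuous.comp (continuous_const.sub continuous_id))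
        (hc.comp_homeomorph (Homeomorph.subLeft w))
    refine (h1.comp_sub_left w).congr (Eventually.of_forall fun z => ?_)
    simp only [sub_sub_cancel]; ring
  have i2 : Integrable ψ := h.continuous.integrable_of_hasCompactSupport hc
  simp only [greenKernel, mul_sub]
  rw [MeasureTheory.integral_sub i1 (i2.mul_const _), integral_mul_const, greenForm, e1]

theorem hasWirt_ofReal_fsWeight (w : ℂ) :
    HasWirt (fun w => (fsWeight w : ℂ)) (conj w) w w := by
  have h := hasWirt_hermForm 1 1 0 w
  simp only [← fsWeight_eq_hermForm] at h
  exact h.of_eq (by simp) (by simp)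

theorem ofReal_fsWeight (w : ℂ) : (fsWeight w : ℂ) = 1 + w * conj w := by
  rw [fsWeight_eq_hermForm, ofReal_hermForm]; simp; ring

theorem ofReal_fsWeight_ne_zero (w : ℂ) : (fsWeight w : ℂ) ≠ 0 :=
  Complex.ofReal_ne_zero.2 (fsWeight_pos w).ne'

theorem contDiff_fsWeight : ContDiff ℝ ∞ fsWeight := by
  have : fsWeight = hermForm 1 1 0 := funext fsWeight_eq_hermForm
  rw [this]; exact contDiff_hermForm _ _ _

theorem contDiff_greenForm {ψ : ℂ → ℂ} (h : ContDiff ℝ ∞ ψ) (hc : HasCompactSupport ψ) :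
    ContDiff ℝ ∞ (greenForm ψ) := by
  refine (contDiff_cauchyTransform h hc).sub (contDiff_const.mul (contDiff_id.mul
    (ContDiff.inv (contDiff_const.mul (Complex.ofRealCLM.contDiff.comp contDiff_fsWeight)) ?_)))
  intro w
  exact mul_ne_zero (by exact_mod_cast Real.pi_ne_zero) (ofReal_fsWeight_ne_zero w)

theorem wirtinger_greenForm {ψ : ℂ → ℂ} (h : ContDiff ℝ ∞ ψ) (hc : HasCompactSupport ψ) (w : ℂ) :
    wirtinger (greenForm ψ) w = fsMass * ψ w - (∫ z, ψ z) * fsDensity w := by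
  obtain ⟨r, hr⟩ := HasWirt.of_differentiableAt
    (ContDiff.differentiableAt' (contDiff_cauchyTransform h hc) w)
  have hpi : (Real.pi : ℂ) ≠ 0 := by exact_mod_cast Real.pi_ne_zero
  have h0 := ofReal_fsWeight_ne_zero w
  have h2 := (hr.sub ((HasWirt.const (∫ z, ψ z) w).mul ((HasWirt.id w).div
    ((HasWirt.const (Real.pi : ℂ) w).mul (hasWirt_ofReal_fsWeight w))
    (mul_ne_zero hpi h0)))).wirtinger_eq
  change wirtinger (greenForm ψ) w = _ at h2
  rw [h2, wirtinger_cauchyTransform h hc, fsDensity_eq]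
  push_cast
  congr 1
  field_simp
  rw [ofReal_fsWeight]
  ring

theorem greenKernel_eq {z w : ℂ} (h : w ≠ z) :
    greenKernel z w = (1 + w * conj z) / (Real.pi * conj (w - z) * fsWeight w) := by
  have hpi : (Real.pi : ℂ) ≠ 0 := by exact_mod_cast Real.pi_ne_zero
  have h0 := ofReal_fsWeight_ne_zero w
  have h1 : conj (w - z) ≠ 0 := (map_ne_zero _).2 (sub_ne_zero.2 h)
  rw [greenKernel, cauchyKernel]
  field_simp
  rw [ofReal_fsWeight, map_sub]
  ring

/-- The inverse of the chordal tangent distance between `z` and `w`; it equals `|k w|⁻¹` for a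
unitary `k` with `k z = 0`. -/
def chordKernel (z w : ℂ) : ℝ := ‖1 + w * conj z‖ / ‖w - z‖

theorem chordKernel_comm (z w : ℂ) : chordKernel z w = chordKernel w z := by
  have h : 1 + z * conj w = conj (1 + w * conj z) := by simp; ring
  rw [chordKernel, chordKernel, h, RCLike.norm_conj, norm_sub_rev]

theorem chordKernel_nonneg (z w : ℂ) : 0 ≤ chordKernel z w := by unfold chordKernel; positivity

theorem norm_greenKernel {z w : ℂ} (h : w ≠ z) :
    ‖greenKernel z w‖ = chordKernel z w / (Real.pi * fsWeight w) := by
  rw [greenKernel_eq h, norm_div, norm_mul, norm_mul, Complex.norm_real, Complex.norm_real,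
    RCLike.norm_conj, Real.norm_eq_abs, Real.norm_eq_abs, abs_of_pos Real.pi_pos,
    abs_of_pos (fsWeight_pos w), chordKernel]
  ring

theorem exists_bound_greenForm {ψ : ℂ → ℂ} (h : ContDiff ℝ ∞ ψ) (hc : HasCompactSupport ψ) :
    ∃ C, ∀ w, ‖greenForm ψ w‖ ≤ C / fsWeight w := by
  obtain ⟨R₀, hR₀⟩ := hc.isCompact.isBounded.subset_closedBall 0
  let R := max R₀ 1
  have hR1 : 1 ≤ R := le_max_right _ _
  have hR : tsupport ψ ⊆ Metric.closedBall 0 R :=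
    hR₀.trans (Metric.closedBall_subset_closedBall (le_max_left _ _))
  obtain ⟨A, hA⟩ := (isCompact_closedBall (0 : ℂ) (2 * R)).exists_bound_of_continuousOn
    (contDiff_greenForm h hc).continuous.continuousOn
  have hA0 : 0 ≤ A := (norm_nonneg _).trans (hA 0 (by simp; linarith))
  have i2 : Integrable ψ := h.continuous.integrable_of_hasCompactSupport hc
  let B := ∫ z, ‖ψ z‖
  have hB : 0 ≤ B := integral_nonneg fun _ => norm_nonneg _
  refine ⟨A * (1 + (2 * R) ^ 2) + B * (2 + 2 * R), fun w => ?_⟩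
  have hq := fsWeight_pos w
  rw [le_div_iff₀ hq]
  rcases le_or_gt ‖w‖ (2 * R) with hw | hw
  · have h1 := hA w (by simpa using hw)
    have h2 : fsWeight w ≤ 1 + (2 * R) ^ 2 := by unfold fsWeight; gcongr
    have := mul_le_mul h1 h2 hq.le hA0
    nlinarith [mul_nonneg hB (by linarith : 0 ≤ 2 + 2 * R)]
  · have h3 : ‖greenForm ψ w‖ ≤ B * ((2 + 2 * R) / fsWeight w) := by
      rw [greenForm_eq_integral h hc, ← integral_mul_const]
      refine norm_integral_le_of_norm_le (i2.norm.mul_const _) (Eventually.of_forall fun z => ?_)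
      by_cases hz : z ∈ tsupport ψ
      · have hz' : ‖z‖ ≤ R := by simpa using hR hz
        have hne : w ≠ z := by
          rintro rfl
          linarith
        rw [norm_mul, norm_greenKernel hne]
        refine mul_le_mul_of_nonneg_left ?_ (norm_nonneg _)
        have h4 : ‖w‖ / 2 ≤ ‖w - z‖ := by
          have := norm_sub_norm_le w z
          linarith
        have h5 : ‖1 + w * conj z‖ ≤ 1 + ‖w‖ * R := by
          refine (norm_add_le _ _).trans ?_
          rw [norm_one, norm_mul, RCLike.norm_conj]
          gcongr
        have h6 : chordKernel z w ≤ 2 + 2 * R := by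
          rw [chordKernel, div_le_iff₀ (by linarith)]
          nlinarith
        have h7 : 1 ≤ Real.pi := by linarith [Real.pi_gt_three]
        calc chordKernel z w / (Real.pi * fsWeight w)
            ≤ (2 + 2 * R) / (1 * fsWeight w) := by gcongr
          _ = _ := by rw [one_mul]
      · rw [image_eq_zero_of_notMem_tsupport hz]
        simp
    rw [mul_div_assoc', le_div_iff₀ hq] at h3
    nlinarith [mul_nonneg hA0 (by positivity : 0 ≤ 1 + (2 * R) ^ 2)]

/-- A unitary matrix whose Möbius transformation sends `z` to `0`. -/
def unitaryAt (z : ℂ) : SL2C :=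
  ⟨!![((1 / √(fsWeight z) : ℝ) : ℂ), -z * (1 / √(fsWeight z) : ℝ);
      conj z * (1 / √(fsWeight z) : ℝ), ((1 / √(fsWeight z) : ℝ) : ℂ)], by
    have h0 : (√(fsWeight z) : ℂ) ^ 2 = fsWeight z := by
      exact_mod_cast Real.sq_sqrt (fsWeight_pos z).le
    have h1 : (√(fsWeight z) : ℂ) ≠ 0 :=
      Complex.ofReal_ne_zero.2 (Real.sqrt_pos.2 (fsWeight_pos z)).ne'
    rw [Matrix.det_fin_two_of]
    push_cast
    field_simp
    rw [h0, ofReal_fsWeight]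
    ring⟩

theorem norm_mob_unitaryAt (z w : ℂ) : 1 / ‖mob (unitaryAt z) w‖ = chordKernel z w := by
  have h1 : ((1 / √(fsWeight z) : ℝ) : ℂ) ≠ 0 :=
    Complex.ofReal_ne_zero.2 (one_div_ne_zero (Real.sqrt_pos.2 (fsWeight_pos z)).ne')
  have e1 : mobNum (unitaryAt z) w = ((1 / √(fsWeight z) : ℝ) : ℂ) * (w - z) := by
    simp [mobNum, unitaryAt]; ring
  have e2 : mobDen (unitaryAt z) w = ((1 / √(fsWeight z) : ℝ) : ℂ) * (1 + w * conj z) := by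
    simp [mobDen, unitaryAt]; ring
  rw [mob, e1, e2, mul_div_mul_left _ _ h1, norm_div, one_div_div, chordKernel]

theorem mobForm_unitaryAt_inv (z w : ℂ) : mobForm (unitaryAt z)⁻¹ w = fsWeight w := by
  have h0 : (√(fsWeight z) : ℂ) ^ 2 = fsWeight z := by
    exact_mod_cast Real.sq_sqrt (fsWeight_pos z).le
  have h1 : (√(fsWeight z) : ℂ) ≠ 0 :=
    Complex.ofReal_ne_zero.2 (Real.sqrt_pos.2 (fsWeight_pos z)).ne'
  have e1 : mobNum (unitaryAt z)⁻¹ w = (w + z) / √(fsWeight z) := by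
    rw [mobNum_inv]; simp [unitaryAt]; ring
  have e2 : mobDen (unitaryAt z)⁻¹ w = (1 - w * conj z) / √(fsWeight z) := by
    rw [mobDen_inv]; simp [unitaryAt]; ring
  apply Complex.ofReal_injective
  rw [mobForm, e1, e2]
  push_cast
  simp only [ofReal_norm_sq, map_div₀, map_add, map_sub, map_mul, map_one, Complex.conj_conj,
    Complex.conj_ofReal]
  field_simp
  rw [h0, ofReal_fsWeight, ofReal_fsWeight]
  ring

/-- The mass of the Green kernel, which does not depend on the pole. -/
def chordMass : ℝ≥0∞ := ∫⁻ w : ℂ, ENNReal.ofReal (1 / ‖w‖) * ENNReal.ofReal (1 / fsWeight w ^ 2)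

theorem chordMass_lt_top : chordMass < ⊤ := by
  have i1 : IntegrableOn (fun w : ℂ => 1 / ‖w‖) (Metric.ball 0 1) := by
    refine integrableOn_ball_of_norm_le_rpow (C := 1) (α := 1)
      (by rw [Complex.finrank_real_complex]; norm_num) finrank_complex_gt
      (Eventually.of_forall fun w => ?_)
      (measurable_const.div measurable_norm).aestronglyMeasurable
    rw [Real.rpow_neg_one]; simp
  have i2 := (integrable_indicator_iff Metric.isOpen_ball.measurableSet).2 i1
  have i3 := i2.add integrable_inv_fsWeight_sq
  refine lt_of_le_of_lt (lintegral_mono fun w => ?_) i3.lintegral_lt_top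
  have hq := one_le_fsWeight w
  rw [← ENNReal.ofReal_mul (by positivity)]
  refine ENNReal.ofReal_le_ofReal ?_
  have h1 : 1 / fsWeight w ^ 2 ≤ 1 := by
    rw [div_le_one (by positivity)]; nlinarith
  by_cases hw : w ∈ Metric.ball (0 : ℂ) 1
  · simp only [Pi.add_apply, Set.indicator_of_mem hw]
    have : 0 ≤ 1 / ‖w‖ := by positivity
    have : 0 ≤ 1 / fsWeight w ^ 2 := by positivity
    nlinarith
  · simp only [Pi.add_apply, Set.indicator_of_notMem hw, zero_add]
    have h2 : 1 ≤ ‖w‖ := by simpa using hw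
    have : 1 / ‖w‖ ≤ 1 := by rw [div_le_one (by linarith)]; exact h2
    have : 0 ≤ 1 / fsWeight w ^ 2 := by positivity
    nlinarith

theorem lintegral_chordKernel (z : ℂ) :
    ∫⁻ w, ENNReal.ofReal (chordKernel z w) * ENNReal.ofReal (1 / fsWeight w ^ 2) = chordMass := by
  have h := lintegral_comp_mob_fsWeight (unitaryAt z) fun w => ENNReal.ofReal (1 / ‖w‖)
  simp only [norm_mob_unitaryAt, mobForm_unitaryAt_inv] at h
  exact h

theorem measurable_chordKernel : Measurable fun x : ℂ × ℂ => chordKernel x.1 x.2 := by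
  unfold chordKernel
  refine Measurable.div ?_ ?_
  · exact (Continuous.measurable (by fun_prop))
  · exact (Continuous.measurable (by fun_prop))

theorem measurable_greenKernel : Measurable fun x : ℂ × ℂ => greenKernel x.1 x.2 := by
  unfold greenKernel
  refine Measurable.sub (measurable_cauchyKernel.comp (measurable_snd.sub measurable_fst)) ?_
  exact measurable_snd.div (measurable_const.mul
    ((Complex.continuous_ofReal.comp continuous_fsWeight).measurable.comp measurable_snd))

/-- Schur's test for the operator with kernel `greenKernel`. -/
theorem lintegral_greenKernel_le {f : ℂ → ℂ} (hf : Measurable f) :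
    ∫⁻ z, (∫⁻ w, ‖f w * greenKernel z w‖ₑ) ^ 2 * ENNReal.ofReal (1 / fsWeight z ^ 2)
      ≤ chordMass ^ 2 * ∫⁻ w, ‖f w‖ₑ ^ 2 := by
  have mk : Measurable fun x : ℂ × ℂ => ENNReal.ofReal (chordKernel x.1 x.2) :=
    measurable_chordKernel.ennreal_ofReal
  have mq : Measurable fun z => ENNReal.ofReal (1 / fsWeight z ^ 2) :=
    (measurable_const.div (continuous_fsWeight.measurable.pow_const 2)).ennreal_ofReal
  have h1 : ∀ z, (∫⁻ w, ‖f w * greenKernel z w‖ₑ) ^ 2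
      ≤ chordMass * ∫⁻ w, ‖f w‖ₑ ^ 2 * ENNReal.ofReal (chordKernel z w) := fun z => by
    have mkz : Measurable fun w => √(chordKernel z w) :=
      (measurable_chordKernel.comp measurable_prodMk_left).sqrt
    have e1 : ∫⁻ w, ‖f w * greenKernel z w‖ₑ ≤ ∫⁻ w, (‖f w‖ₑ * ENNReal.ofReal √(chordKernel z w)) *
        (ENNReal.ofReal (√(chordKernel z w) * (1 / fsWeight w))) := by
      refine lintegral_mono_ae ?_
      have : ∀ᵐ w : ℂ, w ≠ z := by simp [ae_iff]
      filter_upwards [this] with w hw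
      have hq := fsWeight_pos w
      have hk := chordKernel_nonneg z w
      rw [enorm_mul, mul_assoc, ← ENNReal.ofReal_mul (Real.sqrt_nonneg _), ← mul_assoc (√_),
        Real.mul_self_sqrt hk, ← ofReal_norm (greenKernel z w), norm_greenKernel hw]
      gcongr
      rw [mul_one_div]
      have h7 : 1 ≤ Real.pi := by linarith [Real.pi_gt_three]
      gcongr
      nlinarith
    calc (∫⁻ w, ‖f w * greenKernel z w‖ₑ) ^ 2 ≤ _ := pow_le_pow_left' e1 2
      _ ≤ _ := sq_lintegral_mul_le _ (hf.enorm.mul mkz.ennreal_ofReal).aemeasurable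
          ((mkz.mul (measurable_const.div
            continuous_fsWeight.measurable)).ennreal_ofReal).aemeasurable
      _ = _ := by
          rw [mul_comm]
          congr 1
          · rw [← lintegral_chordKernel z]
            refine lintegral_congr fun w => ?_
            have hq := fsWeight_pos w
            rw [← ENNReal.ofReal_pow (by positivity), mul_pow,
              Real.sq_sqrt (chordKernel_nonneg z w),
              ENNReal.ofReal_mul (chordKernel_nonneg z w), one_div_pow]
          · refine lintegral_congr fun w => ?_
            rw [mul_pow, ← ENNReal.ofReal_pow (by positivity),
              Real.sq_sqrt (chordKernel_nonneg z w)]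
  calc ∫⁻ z, (∫⁻ w, ‖f w * greenKernel z w‖ₑ) ^ 2 * ENNReal.ofReal (1 / fsWeight z ^ 2)
      ≤ ∫⁻ z, chordMass * ∫⁻ w, ‖f w‖ₑ ^ 2 *
          (ENNReal.ofReal (chordKernel w z) * ENNReal.ofReal (1 / fsWeight z ^ 2)) := by
        refine lintegral_mono fun z => ?_
        refine (mul_le_mul_left (h1 z) _).trans (le_of_eq ?_)
        rw [mul_assoc, ← lintegral_mul_const' _ _ ENNReal.ofReal_ne_top]
        congr 1
        refine lintegral_congr fun w => ?_
        rw [mul_assoc, chordKernel_comm]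
    _ = chordMass * ∫⁻ w, ∫⁻ z, ‖f w‖ₑ ^ 2 *
          (ENNReal.ofReal (chordKernel w z) * ENNReal.ofReal (1 / fsWeight z ^ 2)) := by
        rw [lintegral_const_mul' _ _ chordMass_lt_top.ne, lintegral_lintegral_swap]
        refine Measurable.aemeasurable ?_
        exact ((hf.comp measurable_snd).enorm.pow_const 2).mul
          ((mk.comp measurable_swap).mul (mq.comp measurable_fst))
    _ = chordMass * ∫⁻ w, ‖f w‖ₑ ^ 2 * chordMass := by
        congr 1
        refine lintegral_congr fun w => ?_
        rw [lintegral_const_mul' _ _ (by simp), lintegral_chordKernel]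
    _ = _ := by
        rw [lintegral_mul_const' _ _ chordMass_lt_top.ne]; ring

/-- The mean of `U` against the Fubini–Study form. -/
def fsMean (U : ℂ → ℂ) : ℂ := ∫ z, U z * fsDensity z

/-- The squared Sobolev norm of `U`, up to normalization, where `f = ∂U/∂z`. -/
def energy (U f : ℂ → ℂ) : ℝ≥0∞ := ‖fsMean U‖ₑ ^ 2 + ∫⁻ z, ‖f z‖ₑ ^ 2

theorem Sob.integrable_fsDensity {U f : ℂ → ℂ} (h : Sob U f) :
    Integrable fun z => U z * fsDensity z := by
  refine h.integrable_mul
    (Complex.continuous_ofReal.comp continuous_fsDensity).aestronglyMeasurable (C := 1) fun z => ?_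
  rw [Complex.norm_real, Real.norm_eq_abs, abs_of_pos (fsDensity_pos z), fsDensity_eq]
  have := fsWeight_pos z
  have h7 : 1 ≤ Real.pi := by linarith [Real.pi_gt_three]
  gcongr
  nlinarith [sq_nonneg (fsWeight z)]

theorem sq_add_le (a b : ℝ≥0∞) : (a + b) ^ 2 ≤ 2 * (a ^ 2 + b ^ 2) := by
  have := ENNReal.rpow_add_le_mul_rpow_add_rpow a b (p := 2) (by norm_num)
  norm_num at this
  exact this

/-- The representation of a Sobolev function by its `∂`-derivative. -/
theorem Sob.fsMass_mul_eq {U f : ℂ → ℂ} (h : Sob U f) :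
    ∀ᵐ z, fsMass * U z = fsMean U - ∫ w, f w * greenKernel z w := by
  have hf2 := (memLp_two_iff h.memLp_dz.1).1 h.memLp_dz
  have mjoint : Measurable fun x : ℂ × ℂ => f x.2 * greenKernel x.1 x.2 :=
    (h.meas_dz.comp measurable_snd).mul measurable_greenKernel
  have mT : Measurable fun z => ∫⁻ w, ‖f w * greenKernel z w‖ₑ :=
    mjoint.enorm.lintegral_prod_right'
  have mK : Measurable fun z => ∫ w, f w * greenKernel z w :=
    (mjoint.stronglyMeasurable.integral_prod_right').measurable
  have hSchur : ∫⁻ z, (∫⁻ w, ‖f w * greenKernel z w‖ₑ) ^ 2 *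
      ENNReal.ofReal (1 / fsWeight z ^ 2) < ⊤ :=
    (lintegral_greenKernel_le h.meas_dz).trans_lt
      (ENNReal.mul_lt_top (ENNReal.pow_lt_top chordMass_lt_top) hf2)
  have hKmem : MemLp (fun z => (∫ w, f w * greenKernel z w) / fsWeight z) 2 := by
    rw [memLp_two_iff (measurable_div_fsWeight mK).aestronglyMeasurable]
    simp only [enorm_div_fsWeight_sq]
    refine lt_of_le_of_lt (lintegral_mono fun z => ?_) hSchur
    gcongr
    exact enorm_integral_le_lintegral_enorm _
  have hloc : LocallyIntegrable fun z => fsMass * U z - fsMean U + ∫ w, f w * greenKernel z w := by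
    refine LocallyIntegrable.add (LocallyIntegrable.sub ?_ ?_) (locallyIntegrable_of_memLp hKmem)
    · exact h.weak.1.smul (fsMass : ℂ)
    · exact locallyIntegrable_const _
  have key := ae_eq_zero_of_integral_contDiff_smul_eq_zero hloc fun g h1 h2 => by
    have c1 : ContDiff ℝ ∞ fun z => (g z : ℂ) := Complex.ofRealCLM.contDiff.comp h1
    have c2 : HasCompactSupport fun z => (g z : ℂ) :=
      h2.comp_left (g := fun t : ℝ => (t : ℂ)) (by simp)
    set ψ : ℂ → ℂ := fun z => (g z : ℂ) with hψ
    obtain ⟨C, hC⟩ := exists_bound_greenForm c1 c2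
    have hcs : ∃ B, ∀ z, ‖ψ z‖ ≤ B / fsWeight z ^ 2 := by
      obtain ⟨B, hB⟩ :=
        (c2.mul_right (f' := fun z => ((fsWeight z : ℂ)) ^ 2)).exists_bound_of_continuous
        (c1.continuous.mul ((Complex.continuous_ofReal.comp continuous_fsWeight).pow 2))
      refine ⟨B, fun z => ?_⟩
      have hq := fsWeight_pos z
      rw [le_div_iff₀ (by positivity)]
      simpa [abs_of_pos hq] using hB z
    obtain ⟨B, hB⟩ := hcs
    have hB' : ∀ w, ‖wirtinger (greenForm ψ) w‖
        ≤ (fsMass * B + ‖∫ z, ψ z‖) / fsWeight w ^ 2 := fun w => by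
      rw [wirtinger_greenForm c1 c2]
      refine (norm_sub_le _ _).trans ?_
      rw [norm_mul, norm_mul, Complex.norm_real fsMass, Complex.norm_real (fsDensity w),
        Real.norm_of_nonneg fsMass_pos.le, Real.norm_of_nonneg (fsDensity_pos w).le, add_div]
      have hq := fsWeight_pos w
      have h7 : 1 ≤ Real.pi := by linarith [Real.pi_gt_three]
      refine add_le_add ?_ ?_
      · rw [mul_div_assoc]
        exact mul_le_mul_of_nonneg_left (hB w) fsMass_pos.le
      · rw [← mul_one_div]
        refine mul_le_mul_of_nonneg_left ?_ (norm_nonneg _)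
        rw [fsDensity_eq]
        gcongr
        nlinarith [sq_nonneg (fsWeight w)]
    have e := h.integral_mul_wirtinger (contDiff_greenForm c1 c2) hC hB'
    simp only [wirtinger_greenForm c1 c2] at e
    have iψ : Integrable ψ := c1.continuous.integrable_of_hasCompactSupport c2
    have i1 : Integrable fun z => U z * ψ z := integrable_mul_test h.weak.1 c1.continuous c2
    have i2 := h.integrable_fsDensity
    have e1 : ∀ z, U z * (fsMass * ψ z - (∫ z, ψ z) * fsDensity z)
        = fsMass * (U z * ψ z) - (∫ z, ψ z) * (U z * fsDensity z) := fun z => by ring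
    simp only [e1] at e
    rw [MeasureTheory.integral_sub (i1.const_mul _) (i2.const_mul _), integral_const_mul,
      integral_const_mul] at e
    -- Fubini's theorem for the right-hand side
    have hint : Integrable (fun x : ℂ × ℂ => ψ x.1 * (f x.2 * greenKernel x.1 x.2))
        (volume.prod volume) := by
      have mm : Measurable fun x : ℂ × ℂ => ψ x.1 * (f x.2 * greenKernel x.1 x.2) :=
        (c1.continuous.measurable.comp measurable_fst).mul mjoint
      refine ⟨mm.aestronglyMeasurable, ?_⟩
      rw [HasFiniteIntegral, lintegral_prod _ mm.enorm.aemeasurable]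
      have e3 : ∀ z, ∫⁻ w, ‖ψ z * (f w * greenKernel z w)‖ₑ
          = (‖ψ z‖ₑ * ENNReal.ofReal (fsWeight z)) * ((∫⁻ w, ‖f w * greenKernel z w‖ₑ) *
            ENNReal.ofReal (1 / fsWeight z)) := fun z => by
        have hq := fsWeight_pos z
        simp only [enorm_mul (ψ z)]
        rw [lintegral_const_mul' _ _ enorm_ne_top, mul_assoc, mul_left_comm (ENNReal.ofReal _),
          ← ENNReal.ofReal_mul hq.le, mul_one_div_cancel hq.ne', ENNReal.ofReal_one, mul_one]
      simp only [e3]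
      refine lt_of_le_of_lt (lintegral_mul_le_sqrt _
        (c1.continuous.measurable.enorm.mul
          continuous_fsWeight.measurable.ennreal_ofReal).aemeasurable
        (mT.mul (measurable_const.div continuous_fsWeight.measurable).ennreal_ofReal).aemeasurable)
        (ENNReal.mul_lt_top (ENNReal.rpow_lt_top_of_nonneg (by norm_num) ?_)
          (ENNReal.rpow_lt_top_of_nonneg (by norm_num) ?_))
      · have c3 : Continuous fun z => ψ z * fsWeight z :=
          c1.continuous.mul (Complex.continuous_ofReal.comp continuous_fsWeight)
        have m3 : MemLp (fun z => ψ z * fsWeight z) 2 :=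
          c3.memLp_of_hasCompactSupport c2.mul_right
        have := (memLp_two_iff m3.1).1 m3
        refine ne_of_lt (lt_of_le_of_lt (lintegral_mono fun z => ?_) this)
        rw [enorm_mul, ← ofReal_norm ((fsWeight z : ℂ)), Complex.norm_real, Real.norm_eq_abs,
          abs_of_pos (fsWeight_pos z)]
      · refine ne_of_lt (lt_of_le_of_lt (lintegral_mono fun z => ?_) hSchur)
        have hq := fsWeight_pos z
        rw [mul_pow, ← ENNReal.ofReal_pow (by positivity), one_div_pow]
    have e4 : ∫ w, f w * greenForm ψ w = ∫ z, ψ z * ∫ w, f w * greenKernel z w := by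
      have s := integral_integral_swap (f := fun z w => ψ z * (f w * greenKernel z w)) hint
      simp only [integral_const_mul] at s
      rw [s]
      congr 1
      ext w
      rw [greenForm_eq_integral c1 c2, ← integral_const_mul]
      congr 1
      ext z; ring
    have i3 : Integrable fun z => ψ z * ∫ w, f w * greenKernel z w := by
      have := hint.integral_prod_left
      simpa only [integral_const_mul] using this
    have e5 : ∀ z, g z • (fsMass * U z - fsMean U + ∫ w, f w * greenKernel z w)
        = (fsMass * (U z * ψ z) - fsMean U * ψ z) + ψ z * ∫ w, f w * greenKernel z w :=
      fun z => by rw [Complex.real_smul]; ring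
    simp only [e5]
    have i4 : Integrable fun z => fsMass * (U z * ψ z) - fsMean U * ψ z :=
      (i1.const_mul _).sub (iψ.const_mul _)
    rw [MeasureTheory.integral_add i4 i3,
      MeasureTheory.integral_sub (i1.const_mul _) (iψ.const_mul _), integral_const_mul,
      integral_const_mul, ← e4]
    change _ - (∫ z, ψ z) * fsMean U = _ at e
    linear_combination e
  filter_upwards [key] with z hz
  linear_combination hz

/-- The Poincaré inequality on `ℙ¹`. -/
theorem exists_poincare : ∃ C : ℝ≥0, ∀ U f, Sob U f →
    ∫⁻ z, ‖U z‖ₑ ^ 2 * ENNReal.ofReal (1 / fsWeight z ^ 2) ≤ C * energy U f := by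
  have hA : ∫⁻ z, ENNReal.ofReal (1 / fsWeight z ^ 2) < ⊤ :=
    integrable_inv_fsWeight_sq.lintegral_lt_top
  set A := ∫⁻ z, ENNReal.ofReal (1 / fsWeight z ^ 2) with hAdef
  have hC : ENNReal.ofReal (1 / fsMass ^ 2) * (2 * (A + chordMass ^ 2)) < ⊤ := by
    refine ENNReal.mul_lt_top ENNReal.ofReal_lt_top (ENNReal.mul_lt_top (by simp) ?_)
    exact ENNReal.add_lt_top.2 ⟨hA, ENNReal.pow_lt_top chordMass_lt_top⟩
  refine ⟨(ENNReal.ofReal (1 / fsMass ^ 2) * (2 * (A + chordMass ^ 2))).toNNReal,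
    fun U f h => ?_⟩
  rw [ENNReal.coe_toNNReal hC.ne]
  have mq : Measurable fun z => ENNReal.ofReal (1 / fsWeight z ^ 2) :=
    (measurable_const.div (continuous_fsWeight.measurable.pow_const 2)).ennreal_ofReal
  have h1 : ∀ᵐ z, ‖U z‖ₑ ^ 2 * ENNReal.ofReal (1 / fsWeight z ^ 2)
      ≤ ENNReal.ofReal (1 / fsMass ^ 2) * (2 *
        (‖fsMean U‖ₑ ^ 2 * ENNReal.ofReal (1 / fsWeight z ^ 2) +
          (∫⁻ w, ‖f w * greenKernel z w‖ₑ) ^ 2 * ENNReal.ofReal (1 / fsWeight z ^ 2))) := by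
    filter_upwards [h.fsMass_mul_eq] with z hz
    have e : ‖U z‖ₑ ^ 2 = ENNReal.ofReal (1 / fsMass ^ 2) * ‖(fsMass : ℂ) * U z‖ₑ ^ 2 := by
      have := fsMass_pos
      rw [enorm_sq_eq_ofReal, enorm_sq_eq_ofReal, ← ENNReal.ofReal_mul (by positivity), norm_mul,
        Complex.norm_real, Real.norm_eq_abs, abs_of_pos this]
      congr 1
      field_simp
    rw [e, hz, mul_assoc, ← add_mul, ← mul_assoc (2 : ℝ≥0∞)]
    gcongr
    refine le_trans ?_ (sq_add_le _ _)
    gcongr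
    exact enorm_sub_le.trans (add_le_add_right (enorm_integral_le_lintegral_enorm _) _)
  refine (lintegral_mono_ae h1).trans ?_
  have mT : Measurable fun z => ∫⁻ w, ‖f w * greenKernel z w‖ₑ :=
    ((h.meas_dz.comp measurable_snd).mul measurable_greenKernel).enorm.lintegral_prod_right'
  rw [lintegral_const_mul' _ _ (by simp), lintegral_const_mul' _ _ (by simp),
    lintegral_add_left (mq.const_mul _), lintegral_const_mul' _ _ (by simp), mul_assoc, mul_assoc]
  refine mul_le_mul_right (mul_le_mul_right ?_ _) _
  refine (add_le_add_right (lintegral_greenKernel_le h.meas_dz) _).trans ?_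
  rw [energy, add_mul, mul_add, mul_add, mul_comm A]
  refine add_le_add ?_ ?_
  · exact le_self_add
  · exact le_add_self

/-! ### Growth of the `L²`-norm under the action -/

/-- The size `1 + log (‖g‖_HS²)` of `g`, comparable with `1 + log ‖g‖`. -/
def size (g : SL2C) : ℝ := 1 + Real.log (hsNormSq g)

theorem one_le_size (g : SL2C) : 1 ≤ size g := by
  have := Real.log_nonneg (by linarith [two_le_hsNormSq g] : 1 ≤ hsNormSq g)
  unfold size; linarith

/-- Cholesky factorization: a positive definite Hermitian form of determinant `D` is, up to the
factor `√D`, the squared norm of `g (z, 1)` for some `g ∈ SL₂(ℂ)`. -/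
theorem exists_mobForm_eq {P M : ℝ} {N : ℂ} (hP : 0 < P) {D : ℝ} (hD : 0 < D)
    (hPM : P * M - ‖N‖ ^ 2 = D) :
    ∃ g : SL2C, (∀ z, hermForm P M N z = √D * mobForm g z) ∧ hsNormSq g = (P + M) / √D := by
  have hd : 0 < √D := Real.sqrt_pos.2 hD
  have hdd : √D ^ 2 = D := Real.sq_sqrt hD.le
  set α : ℝ := √(P / √D) with hα
  have hα0 : 0 < α := Real.sqrt_pos.2 (by positivity)
  have hαα : α ^ 2 = P / √D := Real.sq_sqrt (by positivity)
  have hαc : (α : ℂ) ≠ 0 := Complex.ofReal_ne_zero.2 hα0.ne'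
  have hdc : (√D : ℂ) ≠ 0 := Complex.ofReal_ne_zero.2 hd.ne'
  let g : SL2C := ⟨!![(α : ℂ), N / (√D * α); 0, 1 / α], by
    rw [Matrix.det_fin_two_of]; field_simp; ring⟩
  have eP : coefP g = P / √D := by
    simp [coefP, g, hαα]
  have eM : coefM g = M / √D := by
    have h1 : coefM g = (‖N‖ / (√D * α)) ^ 2 + (1 / α) ^ 2 := by
      simp [coefM, g, abs_of_pos hα0, abs_of_pos hd]
    rw [h1, div_pow, div_pow, mul_pow, hαα, hdd]
    field_simp
    rw [hdd]
    linear_combination -D * hPM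
  have eN : coefN g = N / √D := by
    simp only [coefN, g]
    simp
    field_simp
  refine ⟨g, fun z => ?_, by rw [hsNormSq, eP, eM, add_div]⟩
  rw [mobForm_eq, eP, eM, eN]
  apply Complex.ofReal_injective
  rw [Complex.ofReal_mul, ofReal_hermForm, ofReal_hermForm]
  push_cast
  simp only [map_div₀, Complex.conj_ofReal]
  field_simp

/-- The determinant of `(1 - s) I + s g⋆ g`. -/
def interpDet (g : SL2C) (s : ℝ) : ℝ := 1 + s * (1 - s) * (hsNormSq g - 2)

theorem one_le_interpDet (g : SL2C) {s : ℝ} (h0 : 0 ≤ s) (h1 : s ≤ 1) : 1 ≤ interpDet g s := by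
  have h2 := two_le_hsNormSq g
  have : 0 ≤ s * (1 - s) * (hsNormSq g - 2) :=
    mul_nonneg (mul_nonneg h0 (by linarith)) (by linarith)
  unfold interpDet; linarith

/-- The forms `(1 - s) |v|² + s |g v|²` interpolating between the two Hermitian norms are, up to
normalization, of the form `|g' v|²` with `g'` not larger than `g`. -/
theorem exists_mobForm_interp (g : SL2C) {s : ℝ} (h0 : 0 ≤ s) (h1 : s ≤ 1) :
    ∃ g' : SL2C, (∀ z, (1 - s) * fsWeight z + s * mobForm g z = √(interpDet g s) * mobForm g' z) ∧
      hsNormSq g' ≤ hsNormSq g := by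
  have hτ := two_le_hsNormSq g
  have hD := one_le_interpDet g h0 h1
  have hP := coefP_pos g
  have hPs : 0 < (1 - s) + s * coefP g := by
    rcases h0.eq_or_lt with rfl | h
    · simp
    · have := mul_pos h hP; linarith
  have hdet := coef_det g
  obtain ⟨g', e1, e2⟩ := exists_mobForm_eq (P := (1 - s) + s * coefP g)
    (M := (1 - s) + s * coefM g) (N := s * coefN g) (D := interpDet g s) hPs
    (by linarith) (by
      rw [norm_mul, Complex.norm_real, Real.norm_of_nonneg h0, interpDet, hsNormSq]
      linear_combination s ^ 2 * hdet)
  refine ⟨g', fun z => ?_, ?_⟩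
  · rw [← e1, mobForm_eq, fsWeight_eq_hermForm]
    apply Complex.ofReal_injective
    push_cast
    simp only [ofReal_hermForm]
    push_cast
    simp only [map_zero, map_mul, Complex.conj_ofReal]
    ring
  · have h3 : 1 ≤ √(interpDet g s) := Real.one_le_sqrt.2 hD
    rw [e2]
    have h4 : (1 - s) + s * coefP g + ((1 - s) + s * coefM g) = 2 * (1 - s) + s * hsNormSq g := by
      unfold hsNormSq; ring
    rw [h4]
    refine (div_le_self (by nlinarith) h3).trans ?_
    nlinarith

theorem lintegral_Ioc_inv_sq {a b : ℝ} (ha : 0 < a) (hb : 0 < b) :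
    ∫⁻ s in Set.Ioc (0 : ℝ) 1, ENNReal.ofReal (1 / ((1 - s) * a + s * b) ^ 2)
      = ENNReal.ofReal (1 / (a * b)) := by
  have hpos : ∀ s ∈ Set.uIcc (0 : ℝ) 1, 0 < (1 - s) * a + s * b := fun s hs => by
    rw [Set.uIcc_of_le zero_le_one] at hs
    rcases hs.1.eq_or_lt with h | h
    · rw [← h]; linarith
    · have h1 := mul_pos h hb
      have h2 : 0 ≤ (1 - s) * a := mul_nonneg (by linarith [hs.2]) ha.le
      linarith
  have hcont : ContinuousOn (fun s : ℝ => 1 / ((1 - s) * a + s * b) ^ 2) (Set.uIcc 0 1) :=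
    continuousOn_const.div (by fun_prop) fun s hs => (pow_pos (hpos s hs) 2).ne'
  have hd : ∀ s ∈ Set.uIcc (0 : ℝ) 1, HasDerivAt (fun s => s / (a * ((1 - s) * a + s * b)))
      (1 / ((1 - s) * a + s * b) ^ 2) s := fun s hs => by
    have h0 := hpos s hs
    have h1 : HasDerivAt (fun s : ℝ => a * ((1 - s) * a + s * b)) (a * (-1 * a + 1 * b)) s :=
      ((((hasDerivAt_id s).const_sub 1).mul_const a).add ((hasDerivAt_id s).mul_const b)).const_mul
        a
    refine ((hasDerivAt_id s).div h1 (by positivity)).congr_deriv ?_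
    have := h0.ne'
    simp only [id]
    rw [div_eq_div_iff (by positivity) (by positivity)]
    ring
  have hint := intervalIntegral.integral_eq_sub_of_hasDerivAt hd hcont.intervalIntegrable
  rw [intervalIntegral.integral_of_le zero_le_one] at hint
  have hi : IntegrableOn (fun s : ℝ => 1 / ((1 - s) * a + s * b) ^ 2) (Set.Ioc 0 1) :=
    (intervalIntegrable_iff_integrableOn_Ioc_of_le zero_le_one).1 hcont.intervalIntegrable
  rw [← ofReal_integral_eq_lintegral_ofReal hi (Eventually.of_forall fun s => by positivity), hint]
  congr 1
  simp

/-- The total mass of the measure `τ ds / interpDet` on `[0, 1]` is at most logarithmic in `τ`. -/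
theorem lintegral_interpDet_le (g : SL2C) :
    ∫⁻ s in Set.Ioc (0 : ℝ) 1, ENNReal.ofReal (hsNormSq g / interpDet g s)
      ≤ ENNReal.ofReal (8 * size g) := by
  have hτ := two_le_hsNormSq g
  set τ := hsNormSq g with hτdef
  have hpt : ∀ s ∈ Set.Ioc (0 : ℝ) 1,
      τ / interpDet g s ≤ 2 * τ / (1 + s * τ) + 2 * τ / (1 + (1 - s) * τ) := fun s hs => by
    have hD := one_le_interpDet g hs.1.le hs.2
    have p1 : 0 < 1 + s * τ := by nlinarith [hs.1]
    have p2 : 0 < 1 + (1 - s) * τ := by nlinarith [hs.2]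
    rcases le_total s (1 / 2) with h | h
    · have : τ / interpDet g s ≤ 2 * τ / (1 + s * τ) := by
        rw [div_le_div_iff₀ (by linarith) p1]
        have : 1 + s * τ ≤ 2 * interpDet g s := by
          unfold interpDet
          nlinarith [mul_nonneg (mul_nonneg hs.1.le (by linarith : 0 ≤ 1 - 2 * s))
            (by linarith : 0 ≤ τ - 2), hs.1]
        nlinarith
      have : 0 ≤ 2 * τ / (1 + (1 - s) * τ) := by positivity
      linarith
    · have : τ / interpDet g s ≤ 2 * τ / (1 + (1 - s) * τ) := by
        rw [div_le_div_iff₀ (by linarith) p2]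
        have : 1 + (1 - s) * τ ≤ 2 * interpDet g s := by
          unfold interpDet
          nlinarith [mul_nonneg (mul_nonneg (by linarith [hs.2] : 0 ≤ 1 - s)
            (by linarith : 0 ≤ 2 * s - 1)) (by linarith : 0 ≤ τ - 2), hs.2]
        nlinarith
      have : 0 ≤ 2 * τ / (1 + s * τ) := by positivity
      linarith
  have hcont : ContinuousOn (fun s : ℝ => 2 * τ / (1 + s * τ) + 2 * τ / (1 + (1 - s) * τ))
      (Set.uIcc 0 1) := by
    rw [Set.uIcc_of_le zero_le_one]
    refine ContinuousOn.add (continuousOn_const.div (by fun_prop) fun s hs => ?_)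
      (continuousOn_const.div (by fun_prop) fun s hs => ?_)
    · have := mul_nonneg hs.1 (by linarith : 0 ≤ τ); positivity
    · have := mul_nonneg (sub_nonneg.2 hs.2) (by linarith : 0 ≤ τ); positivity
  have hd : ∀ s ∈ Set.uIcc (0 : ℝ) 1,
      HasDerivAt (fun s => 2 * Real.log (1 + s * τ) - 2 * Real.log (1 + (1 - s) * τ))
        (2 * τ / (1 + s * τ) + 2 * τ / (1 + (1 - s) * τ)) s := fun s hs => by
    rw [Set.uIcc_of_le zero_le_one] at hs
    have q1 := mul_nonneg hs.1 (by linarith : 0 ≤ τ)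
    have q2 := mul_nonneg (sub_nonneg.2 hs.2) (by linarith : 0 ≤ τ)
    have h1 : HasDerivAt (fun s : ℝ => 1 + s * τ) (1 * τ) s :=
      ((hasDerivAt_id s).mul_const τ).const_add 1
    have h2 : HasDerivAt (fun s : ℝ => 1 + (1 - s) * τ) (-1 * τ) s :=
      (((hasDerivAt_id s).const_sub 1).mul_const τ).const_add 1
    refine (((h1.log (by positivity)).const_mul 2).sub
      ((h2.log (by positivity)).const_mul 2)).congr_deriv ?_
    ring
  have hint := intervalIntegral.integral_eq_sub_of_hasDerivAt hd hcont.intervalIntegrable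
  rw [intervalIntegral.integral_of_le zero_le_one] at hint
  have hi : IntegrableOn (fun s : ℝ => 2 * τ / (1 + s * τ) + 2 * τ / (1 + (1 - s) * τ))
      (Set.Ioc 0 1) :=
    (intervalIntegrable_iff_integrableOn_Ioc_of_le zero_le_one).1 hcont.intervalIntegrable
  have hnn : 0 ≤ᵐ[volume.restrict (Set.Ioc (0 : ℝ) 1)]
      fun s : ℝ => 2 * τ / (1 + s * τ) + 2 * τ / (1 + (1 - s) * τ) := by
    refine (ae_restrict_iff' measurableSet_Ioc).2 (Eventually.of_forall fun s hs => ?_)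
    have q1 := mul_nonneg hs.1.le (by linarith : 0 ≤ τ)
    have q2 := mul_nonneg (sub_nonneg.2 hs.2) (by linarith : 0 ≤ τ)
    change 0 ≤ 2 * τ / (1 + s * τ) + 2 * τ / (1 + (1 - s) * τ)
    positivity
  calc ∫⁻ s in Set.Ioc (0 : ℝ) 1, ENNReal.ofReal (τ / interpDet g s)
      ≤ ∫⁻ s in Set.Ioc (0 : ℝ) 1,
          ENNReal.ofReal (2 * τ / (1 + s * τ) + 2 * τ / (1 + (1 - s) * τ)) :=
        setLIntegral_mono' measurableSet_Ioc fun s hs => ENNReal.ofReal_le_ofReal (hpt s hs)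
    _ = ENNReal.ofReal (4 * Real.log (1 + τ)) := by
        rw [← ofReal_integral_eq_lintegral_ofReal hi hnn, hint]
        congr 1
        simp
        ring
    _ ≤ _ := by
        refine ENNReal.ofReal_le_ofReal ?_
        have h1 : Real.log (1 + τ) ≤ Real.log (τ ^ 2) :=
          Real.log_le_log (by linarith) (by nlinarith)
        rw [Real.log_pow] at h1
        push_cast at h1
        unfold size
        linarith

/-- Since `1 / (q Q) = ∫₀¹ ds / ((1 - s) q + s Q)²`, integrals against `τ dA / (q Q)` are
superpositions of integrals against the Fubini–Study forms of Hermitian metrics not larger than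
that of `g`, of total mass `O(log τ)`. -/
theorem lintegral_mul_inv_le (g : SL2C) {u : ℂ → ℝ≥0∞} (hu : Measurable u) {K : ℝ≥0∞}
    (hK : ∀ g' : SL2C, hsNormSq g' ≤ hsNormSq g →
      ∫⁻ z, u z * ENNReal.ofReal (1 / mobForm g' z ^ 2) ≤ K) :
    ∫⁻ z, u z * ENNReal.ofReal (hsNormSq g / (fsWeight z * mobForm g z))
      ≤ ENNReal.ofReal (8 * size g) * K := by
  have hτ := two_le_hsNormSq g
  have mjoint : Measurable fun x : ℂ × ℝ =>
      ENNReal.ofReal (1 / ((1 - x.2) * fsWeight x.1 + x.2 * mobForm g x.1) ^ 2) := by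
    have c1 := continuous_fsWeight.comp (continuous_fst (X := ℂ) (Y := ℝ))
    have c2 := (continuous_mobForm g).comp (continuous_fst (X := ℂ) (Y := ℝ))
    have c3 : Continuous fun x : ℂ × ℝ => (1 - x.2) * fsWeight x.1 + x.2 * mobForm g x.1 :=
      ((continuous_const.sub continuous_snd).mul c1).add (continuous_snd.mul c2)
    exact (measurable_const.div (c3.measurable.pow_const 2)).ennreal_ofReal
  calc ∫⁻ z, u z * ENNReal.ofReal (hsNormSq g / (fsWeight z * mobForm g z))
      = ∫⁻ z, ∫⁻ s in Set.Ioc (0 : ℝ) 1, ENNReal.ofReal (hsNormSq g) * (u z *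
          ENNReal.ofReal (1 / ((1 - s) * fsWeight z + s * mobForm g z) ^ 2)) := by
        refine lintegral_congr fun z => ?_
        have mz : Measurable fun s : ℝ =>
            ENNReal.ofReal (1 / ((1 - s) * fsWeight z + s * mobForm g z) ^ 2) :=
          (Measurable.div measurable_const (by fun_prop)).ennreal_ofReal
        have e1 := lintegral_const_mul (μ := volume.restrict (Set.Ioc (0 : ℝ) 1)) (u z) mz
        have e2 := lintegral_const_mul' (μ := volume.restrict (Set.Ioc (0 : ℝ) 1))
          (ENNReal.ofReal (hsNormSq g)) (fun s : ℝ => u z *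
            ENNReal.ofReal (1 / ((1 - s) * fsWeight z + s * mobForm g z) ^ 2))
          ENNReal.ofReal_ne_top
        rw [e2, e1, lintegral_Ioc_inv_sq (fsWeight_pos z) (mobForm_pos g z), mul_left_comm,
          ← ENNReal.ofReal_mul (by linarith), mul_one_div]
    _ = ∫⁻ s in Set.Ioc (0 : ℝ) 1, ∫⁻ z, ENNReal.ofReal (hsNormSq g) * (u z *
          ENNReal.ofReal (1 / ((1 - s) * fsWeight z + s * mobForm g z) ^ 2)) := by
        rw [lintegral_lintegral_swap]
        exact (((hu.comp measurable_fst).mul mjoint).const_mul _).aemeasurable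
    _ ≤ ∫⁻ s in Set.Ioc (0 : ℝ) 1, ENNReal.ofReal (hsNormSq g / interpDet g s) * K := by
        refine setLIntegral_mono' measurableSet_Ioc fun s hs => ?_
        obtain ⟨g', e1, e2⟩ := exists_mobForm_interp g hs.1.le hs.2
        have hD := one_le_interpDet g hs.1.le hs.2
        have e3 : ∀ z, ENNReal.ofReal (hsNormSq g) * (u z *
            ENNReal.ofReal (1 / ((1 - s) * fsWeight z + s * mobForm g z) ^ 2))
            = ENNReal.ofReal (hsNormSq g / interpDet g s) *
              (u z * ENNReal.ofReal (1 / mobForm g' z ^ 2)) := fun z => by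
          have h0 := mobForm_pos g' z
          rw [e1, mul_pow, Real.sq_sqrt (by linarith), mul_left_comm, mul_left_comm _ (u z),
            ← ENNReal.ofReal_mul (by linarith), ← ENNReal.ofReal_mul (by positivity)]
          congr 2
          field_simp
        simp only [e3]
        rw [lintegral_const_mul' _ _ ENNReal.ofReal_ne_top]
        gcongr
        exact hK g' e2
    _ ≤ _ := by
        have m : Measurable fun s => ENNReal.ofReal (hsNormSq g / interpDet g s) := by
          unfold interpDet
          exact (Measurable.div measurable_const (by fun_prop)).ennreal_ofReal
        rw [lintegral_mul_const _ m]
        gcongr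
        exact lintegral_interpDet_le g

/-- The `(0,1)`-form `∂̄ log (|g v|² / |v|²)`, whose `∂`-derivative is the difference of the
pulled back and the original Fubini–Study forms. -/
def logRatioForm (g : SL2C) (w : ℂ) : ℂ :=
  (coefP g * w + coefN g) / mobForm g w - w / fsWeight w

theorem hasWirt_ofReal_mobForm (g : SL2C) (w : ℂ) :
    HasWirt (fun w => (mobForm g w : ℂ)) (coefP g * conj w + conj (coefN g))
      (coefP g * w + coefN g) w := by
  simp only [mobForm_eq]
  exact hasWirt_hermForm _ _ _ w

theorem ofReal_mobForm_ne_zero (g : SL2C) (w : ℂ) : (mobForm g w : ℂ) ≠ 0 :=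
  Complex.ofReal_ne_zero.2 (mobForm_pos g w).ne'

theorem contDiff_mobForm (g : SL2C) : ContDiff ℝ ∞ (mobForm g) := by
  have : mobForm g = hermForm (coefP g) (coefM g) (coefN g) := funext (mobForm_eq g)
  rw [this]
  exact contDiff_hermForm _ _ _

theorem contDiff_logRatioForm (g : SL2C) : ContDiff ℝ ∞ (logRatioForm g) :=
  (((contDiff_const.mul contDiff_id).add contDiff_const).mul
    ((Complex.ofRealCLM.contDiff.comp (contDiff_mobForm g)).inv
      fun w => ofReal_mobForm_ne_zero g w)).sub
    (contDiff_id.mul ((Complex.ofRealCLM.contDiff.comp contDiff_fsWeight).inv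
      fun w => ofReal_fsWeight_ne_zero w))

theorem wirtinger_logRatioForm (g : SL2C) (w : ℂ) :
    wirtinger (logRatioForm g) w = ((1 / mobForm g w ^ 2 - 1 / fsWeight w ^ 2 : ℝ) : ℂ) := by
  have h1 := ((((HasWirt.const (coefP g : ℂ) w).mul (HasWirt.id w)).add
    (HasWirt.const (coefN g) w)).div (hasWirt_ofReal_mobForm g w)
    (ofReal_mobForm_ne_zero g w)).sub
    ((HasWirt.id w).div (hasWirt_ofReal_fsWeight w) (ofReal_fsWeight_ne_zero w))
  have h2 := h1.wirtinger_eq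
  change wirtinger (logRatioForm g) w = _ at h2
  have e1 := mul_hermForm (coefP g) (coefM g) (coefN g) w
  rw [coef_det, ← mobForm_eq] at e1
  have e2 : (coefP g : ℂ) * mobForm g w
      = (coefP g * w + coefN g) * (coefP g * conj w + conj (coefN g)) + 1 := by
    have := congrArg (fun x : ℝ => (x : ℂ)) e1
    push_cast at this
    rw [this, ofReal_norm_sq]
    simp
  rw [h2]
  push_cast
  congr 1
  · congr 1
    simp only [zero_mul, add_zero, mul_one]
    linear_combination e2
  · congr 1
    rw [ofReal_fsWeight]
    ring

theorem logRatioForm_eq (g : SL2C) (w : ℂ) :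
    logRatioForm g w = conj (mobWronskian g w) / (fsWeight w * mobForm g w) := by
  have h1 := ofReal_mobForm_ne_zero g w
  have h2 := ofReal_fsWeight_ne_zero w
  rw [logRatioForm, div_sub_div _ _ h1 h2, mul_comm (fsWeight w : ℂ)]
  congr 1
  rw [ofReal_fsWeight, mobForm_eq, ofReal_hermForm, mobWronskian, formWronskian]
  simp only [map_add, map_sub, map_mul, map_pow, Complex.conj_conj, Complex.conj_ofReal]
  ring

theorem norm_sq_div_le (g : SL2C) (w : ℂ) :
    (‖mobWronskian g w‖ / (fsWeight w * mobForm g w)) ^ 2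
      ≤ hsNormSq g / (fsWeight w * mobForm g w) := by
  have h1 := fsWeight_pos w
  have h2 := mobForm_pos g w
  rw [div_pow, div_le_div_iff₀ (by positivity) (by positivity), norm_sq_mobWronskian]
  have h3 : 0 ≤ (fsWeight w ^ 2 + mobForm g w ^ 2) * (fsWeight w * mobForm g w) := by positivity
  nlinarith

theorem norm_logRatioForm (g : SL2C) (w : ℂ) :
    ‖logRatioForm g w‖ = ‖mobWronskian g w‖ / (fsWeight w * mobForm g w) := by
  rw [logRatioForm_eq, norm_div, RCLike.norm_conj, norm_mul, Complex.norm_real, Complex.norm_real,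
    Real.norm_of_nonneg (fsWeight_pos w).le, Real.norm_of_nonneg (mobForm_pos g w).le]

theorem norm_logRatioForm_le (g : SL2C) (w : ℂ) :
    ‖logRatioForm g w‖ ≤ hsNormSq g / fsWeight w := by
  have h1 := fsWeight_pos w
  have h2 := mobForm_pos g w
  have h3 := fsWeight_le g w
  have hτ := two_le_hsNormSq g
  refine abs_le_of_sq_le_sq' ?_ (by positivity) |>.2
  rw [norm_logRatioForm]
  refine (norm_sq_div_le g w).trans ?_
  rw [div_pow, div_le_div_iff₀ (by positivity) (by positivity)]
  nlinarith [mul_le_mul_of_nonneg_left h3 (by positivity : 0 ≤ hsNormSq g * fsWeight w)]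

theorem one_div_mobForm_sq_le (g : SL2C) (w : ℂ) :
    1 / mobForm g w ^ 2 ≤ hsNormSq g ^ 2 / fsWeight w ^ 2 := by
  have h1 := fsWeight_pos w
  have h2 := mobForm_pos g w
  rw [div_le_div_iff₀ (by positivity) (by positivity), one_mul, ← mul_pow]
  have := fsWeight_le g w
  gcongr

/-- The mean of the pullback `g⋆U` differs from the mean of `U` by an integral of `∂U`. -/
theorem Sob.fsMean_comp_mob {U f : ℂ → ℂ} (h : Sob U f) (g : SL2C) :
    fsMean (fun z => U (mob g⁻¹ z)) = fsMean U - (1 / Real.pi) * ∫ w, f w * logRatioForm g w := by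
  have e := h.integral_mul_wirtinger (contDiff_logRatioForm g) (norm_logRatioForm_le g)
    (C' := hsNormSq g ^ 2 + 1) fun w => by
      have h1 := fsWeight_pos w
      have h2 := mobForm_pos g w
      rw [wirtinger_logRatioForm, Complex.norm_real]
      refine (norm_sub_le _ _).trans ?_
      rw [Real.norm_of_nonneg (by positivity), Real.norm_of_nonneg (by positivity), add_div]
      exact add_le_add_left (one_div_mobForm_sq_le g w) _
  rw [fsMean, integral_comp_mob_fsDensity, inv_inv, fsMean]
  have i1 : Integrable fun w => U w * ((1 / (Real.pi * mobForm g w ^ 2) : ℝ) : ℂ) := by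
    refine h.integrable_mul (Complex.continuous_ofReal.comp (continuous_const.div
      (continuous_const.mul ((continuous_mobForm g).pow 2)) fun w => ?_)).aestronglyMeasurable
      (C := hsNormSq g ^ 2) fun w => ?_
    · exact (mul_pos Real.pi_pos (pow_pos (mobForm_pos g w) 2)).ne'
    · have h2 := mobForm_pos g w
      have h7 : 1 ≤ Real.pi := by linarith [Real.pi_gt_three]
      have h8 := one_div_mobForm_sq_le g w
      rw [Complex.norm_real, Real.norm_of_nonneg (by positivity)]
      refine le_trans ?_ h8
      gcongr
      nlinarith [sq_nonneg (mobForm g w)]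
  have hpi : (Real.pi : ℂ) ≠ 0 := by exact_mod_cast Real.pi_ne_zero
  have e2 : ∀ w, U w * wirtinger (logRatioForm g) w
      = Real.pi * (U w * ((1 / (Real.pi * mobForm g w ^ 2) : ℝ) : ℂ) - U w * fsDensity w) :=
    fun w => by
    have h1 := ofReal_fsWeight_ne_zero w
    have h2 := ofReal_mobForm_ne_zero g w
    rw [wirtinger_logRatioForm, fsDensity_eq]
    push_cast
    field_simp
  simp only [e2] at e
  rw [integral_const_mul, MeasureTheory.integral_sub i1 h.integrable_fsDensity] at e
  apply mul_left_cancel₀ hpi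
  field_simp
  linear_combination e

theorem enorm_mul_integral_sq_le {f X : ℂ → ℂ} (hf : Measurable f) (hX : Measurable X) :
    ‖∫ w, f w * X w‖ₑ ^ 2 ≤ (∫⁻ w, ‖f w‖ₑ ^ 2) * ∫⁻ w, ‖X w‖ₑ ^ 2 := by
  refine le_trans (pow_le_pow_left' (enorm_integral_le_lintegral_enorm _) 2) ?_
  simp only [enorm_mul]
  exact sq_lintegral_mul_le _ hf.enorm.aemeasurable hX.enorm.aemeasurable

theorem size_mono {g g' : SL2C} (h : hsNormSq g' ≤ hsNormSq g) : size g' ≤ size g := by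
  have := Real.log_le_log (by linarith [two_le_hsNormSq g'] : 0 < hsNormSq g') h
  unfold size; linarith

/-- The `L²`-norm of the pullback of `U` grows at most like `√(log ‖g‖)`. -/
theorem exists_lintegral_mobForm_le : ∃ C : ℝ≥0, ∀ U f, Sob U f → ∀ g : SL2C,
    ∫⁻ z, ‖U z‖ₑ ^ 2 * ENNReal.ofReal (1 / mobForm g z ^ 2)
      ≤ C * ENNReal.ofReal (size g) * energy U f := by
  obtain ⟨C, hC⟩ := exists_poincare
  have hA : ∫⁻ z, ENNReal.ofReal (1 / fsWeight z ^ 2) < ⊤ :=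
    integrable_inv_fsWeight_sq.lintegral_lt_top
  set A := (∫⁻ z, ENNReal.ofReal (1 / fsWeight z ^ 2)).toNNReal with hAdef
  have hA' : ∫⁻ z, ENNReal.ofReal (1 / fsWeight z ^ 2) = A := (ENNReal.coe_toNNReal hA.ne).symm
  refine ⟨C * (3 + 16 * A), fun U f h g => ?_⟩
  have hs := one_le_size g
  have hV := hC _ _ (h.comp_mob g⁻¹)
  rw [lintegral_comp_mob_fsWeight g⁻¹ fun w => ‖U w‖ₑ ^ 2, inv_inv] at hV
  refine hV.trans ?_
  rw [energy, lintegral_dz_comp_mob, h.fsMean_comp_mob]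
  have hX : ∫⁻ w, ‖logRatioForm g w‖ₑ ^ 2 ≤ ENNReal.ofReal (8 * size g) * A := by
    have h1 := lintegral_mul_inv_le g (u := fun _ => 1) measurable_const (K := A) fun g' _ => by
      have := lintegral_comp_mob_fsWeight g'⁻¹ fun _ => 1
      rw [inv_inv] at this
      rw [← this]
      simp only [one_mul]
      exact hA'.le
    refine le_trans (lintegral_mono fun w => ?_) h1
    rw [one_mul, enorm_sq_eq_ofReal, norm_logRatioForm]
    exact ENNReal.ofReal_le_ofReal (norm_sq_div_le g w)
  have hm : ‖(1 / Real.pi : ℂ) * ∫ w, f w * logRatioForm g w‖ₑ ^ 2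
      ≤ (∫⁻ w, ‖f w‖ₑ ^ 2) * (ENNReal.ofReal (8 * size g) * A) := by
    refine le_trans ?_ ((enorm_mul_integral_sq_le h.meas_dz
      (contDiff_logRatioForm g).continuous.measurable).trans (mul_le_mul_right hX _))
    refine pow_le_pow_left' ?_ 2
    rw [enorm_mul]
    refine mul_le_of_le_one_left' ?_
    rw [← ofReal_norm, norm_div, norm_one, Complex.norm_real, Real.norm_of_nonneg Real.pi_pos.le]
    rw [← ENNReal.ofReal_one]
    refine ENNReal.ofReal_le_ofReal ?_
    rw [div_le_one Real.pi_pos]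
    linarith [Real.pi_gt_three]
  have hsub : ‖fsMean U - (1 / Real.pi) * ∫ w, f w * logRatioForm g w‖ₑ ^ 2
      ≤ 2 * (‖fsMean U‖ₑ ^ 2 + (∫⁻ w, ‖f w‖ₑ ^ 2) * (ENNReal.ofReal (8 * size g) * A)) := by
    refine le_trans (pow_le_pow_left' enorm_sub_le 2) ((sq_add_le _ _).trans ?_)
    gcongr
  have hs1 : 1 ≤ ENNReal.ofReal (size g) := by
    rw [← ENNReal.ofReal_one]; exact ENNReal.ofReal_le_ofReal hs
  rw [ENNReal.ofReal_mul (by norm_num)] at hsub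
  norm_num at hsub
  set S := ENNReal.ofReal (size g)
  set m := ‖fsMean U‖ₑ ^ 2
  set E := ∫⁻ w, ‖f w‖ₑ ^ 2
  push_cast
  rw [energy, mul_assoc (C : ℝ≥0∞), mul_assoc (C : ℝ≥0∞)]
  gcongr
  calc _ ≤ 2 * (m + E * (8 * S * A)) + E := add_le_add_left (by simpa using hsub) _
    _ = 2 * m + (E + 16 * A * S * E) := by ring
    _ ≤ 2 * (S * m) + (S * E + 16 * A * S * E) := by
        gcongr
        · exact le_mul_of_one_le_left' hs1
        · exact le_mul_of_one_le_left' hs1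
    _ ≤ 2 * (S * m) + (S * E + 16 * A * S * E) + (S * m + 16 * A * S * m + 2 * S * E) :=
        le_self_add
    _ = _ := by ring

/-- The weighted `L²`-estimate behind the boundedness of multiplication by the norm cocycle:
`τ / (4 q Q)` dominates `|∂σ_g|²`. -/
theorem exists_lintegral_inv_le : ∃ C : ℝ≥0, ∀ U f, Sob U f → ∀ g : SL2C,
    ∫⁻ z, ‖U z‖ₑ ^ 2 * ENNReal.ofReal (hsNormSq g / (fsWeight z * mobForm g z))
      ≤ C * ENNReal.ofReal (size g ^ 2) * energy U f := by
  obtain ⟨C, hC⟩ := exists_lintegral_mobForm_le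
  refine ⟨8 * C, fun U f h g => ?_⟩
  have hs := one_le_size g
  refine (lintegral_mul_inv_le g (h.meas.enorm.pow_const 2)
    (K := C * ENNReal.ofReal (size g) * energy U f) fun g' hg' => ?_).trans (le_of_eq ?_)
  · refine (hC U f h g').trans ?_
    gcongr
    exact size_mono hg'
  · rw [ENNReal.ofReal_mul (by norm_num), ENNReal.ofReal_pow (by linarith)]
    push_cast
    norm_num
    ring

/-! ### Multiplication by functions of the norm cocycle -/

/-- The norm cocycle `σ_g` in the affine chart. -/
def chartCocycle (g : SL2C) (z : ℂ) : ℝ := Real.log (mobForm g z / fsWeight z) / 2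

theorem abs_chartCocycle_le (g : SL2C) (z : ℂ) : |chartCocycle g z| ≤ Real.log (hsNormSq g) := by
  have h1 := fsWeight_pos z
  have h2 := mobForm_pos g z
  have hτ := two_le_hsNormSq g
  have h3 : Real.log (mobForm g z / fsWeight z) ≤ Real.log (hsNormSq g) :=
    Real.log_le_log (by positivity) ((div_le_iff₀ h1).2 (mobForm_le g z))
  have h4 : -Real.log (hsNormSq g) ≤ Real.log (mobForm g z / fsWeight z) := by
    rw [← Real.log_inv]
    refine Real.log_le_log (by positivity) ?_
    rw [inv_eq_one_div, div_le_div_iff₀ (by linarith) h1, one_mul, mul_comm]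
    exact fsWeight_le g z
  have h5 := Real.log_nonneg (by linarith : 1 ≤ hsNormSq g)
  rw [chartCocycle, abs_le]
  constructor <;> linarith

theorem contDiff_chartCocycle (g : SL2C) : ContDiff ℝ ∞ (chartCocycle g) := by
  unfold chartCocycle
  refine ContDiff.div_const (ContDiff.log ((contDiff_mobForm g).div contDiff_fsWeight
    fun z => (fsWeight_pos z).ne') fun z => ?_) 2
  exact (div_pos (mobForm_pos g z) (fsWeight_pos z)).ne'

theorem hasWirt_chartCocycle (g : SL2C) (z : ℂ) :
    HasWirt (fun z => (chartCocycle g z : ℂ)) (conj (logRatioForm g z) / 2)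
      (conj (conj (logRatioForm g z) / 2)) z := by
  have hlog : ∀ {t : ℝ}, 0 < t → HasDerivAt (fun t : ℝ => (Real.log t : ℂ)) ((t⁻¹ : ℝ) : ℂ) t :=
    fun ht => (Real.hasDerivAt_log ht.ne').ofReal_comp
  have h1 := HasWirt.comp_real (F := fun t => (Real.log t : ℂ))
    ((hasWirt_ofReal_mobForm g z).of_eq rfl (r' := conj (coefP g * conj z + conj (coefN g)))
      (by simp)) (hlog (mobForm_pos g z))
  have h2 := HasWirt.comp_real (F := fun t => (Real.log t : ℂ))
    ((hasWirt_ofReal_fsWeight z).of_eq rfl (r' := conj (conj z)) (by simp)) (hlog (fsWeight_pos z))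
  have h3 := (HasWirt.const (1 / 2) z).mul (h1.sub h2)
  have e : (fun z => (chartCocycle g z : ℂ)) = fun w =>
      1 / 2 * ((Real.log (mobForm g w) : ℂ) - (Real.log (fsWeight w) : ℂ)) := by
    ext w
    rw [chartCocycle, Real.log_div (mobForm_pos g w).ne' (fsWeight_pos w).ne']
    push_cast
    ring
  rw [e]
  refine h3.of_eq ?_ ?_ <;>
  · rw [logRatioForm]
    simp only [map_sub, map_div₀, map_add, map_mul, Complex.conj_conj, Complex.conj_ofReal,
      map_ofNat]
    push_cast
    simp
    ring

theorem contDiff_comp_chartCocycle {F : ℝ → ℂ} (hF : ContDiff ℝ ∞ F) (g : SL2C) :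
    ContDiff ℝ ∞ fun z => F (chartCocycle g z) := hF.comp (contDiff_chartCocycle g)

theorem wirtinger_comp_chartCocycle {F : ℝ → ℂ} (hF : ContDiff ℝ ∞ F) (g : SL2C) (z : ℂ) :
    wirtinger (fun z => F (chartCocycle g z)) z
      = deriv F (chartCocycle g z) * (conj (logRatioForm g z) / 2) :=
  ((hasWirt_chartCocycle g z).comp_real
    ((hF.differentiable (by simp)) _).hasDerivAt).wirtinger_eq

/-- `F(σ_g) g⋆U` in the affine chart. -/
def twist (F : ℝ → ℂ) (U : ℂ → ℂ) (g : SL2C) (z : ℂ) : ℂ := F (chartCocycle g z) * U (mob g z)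

/-- The `∂`-derivative of `F(σ_g) g⋆U` in the affine chart. -/
def twistDz (F : ℝ → ℂ) (U f : ℂ → ℂ) (g : SL2C) (z : ℂ) : ℂ :=
  F (chartCocycle g z) * (f (mob g z) * mobDeriv g z) +
    deriv F (chartCocycle g z) * (conj (logRatioForm g z) / 2) * U (mob g z)

theorem Sob.hasWeakDz_twist {U f : ℂ → ℂ} (h : Sob U f) {F : ℝ → ℂ} (hF : ContDiff ℝ ∞ F)
    (g : SL2C) : HasWeakDz (twist F U g) (twistDz F U f g) := by
  have h1 := (h.comp_mob g).weak.mul_contDiff (contDiff_comp_chartCocycle hF g)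
  simp only [wirtinger_comp_chartCocycle hF] at h1
  exact h1

/-- Change of variables in an integral against `|∂σ_g|²`; it reflects `σ_g ∘ g⁻¹ = -σ_{g⁻¹}`. -/
theorem lintegral_comp_mob_inv (g : SL2C) (u : ℂ → ℝ≥0∞) :
    ∫⁻ z, u (mob g z) * ENNReal.ofReal (hsNormSq g / (fsWeight z * mobForm g z))
      = ∫⁻ w, u w * ENNReal.ofReal (hsNormSq g⁻¹ / (fsWeight w * mobForm g⁻¹ w)) := by
  have h := lintegral_comp_mob_fsWeight g fun w =>
    u w * ENNReal.ofReal (hsNormSq g * mobForm g⁻¹ w / fsWeight w)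
  have hτ := two_le_hsNormSq g
  calc _ = _ := lintegral_congr_ae ?_
    _ = _ := h
    _ = _ := lintegral_congr fun w => ?_
  · filter_upwards [ae_mobDen_ne_zero g] with z hz
    have h0 : 0 < ‖mobDen g z‖ := by simpa using hz
    have h1 := fsWeight_pos z
    have h2 := mobForm_pos g z
    rw [mobForm_inv_mob g hz, fsWeight_mob g hz, mul_assoc, ← ENNReal.ofReal_mul (by positivity)]
    congr 2
    field_simp
  · have h1 := fsWeight_pos w
    have h2 := mobForm_pos g⁻¹ w
    rw [mul_assoc, ← ENNReal.ofReal_mul (by positivity), hsNormSq_inv]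
    congr 2
    field_simp

/-- The basic estimate: the pullback by `g`, followed by multiplication by `F(σ_g)`, is bounded on
the Sobolev space by a multiple of `(1 + log ‖g‖) sup (|F| + |F'|)`, the supremum being taken over
the range of `σ_g`. -/
theorem exists_twist_le : ∃ C : ℝ≥0, ∀ U f, Sob U f → ∀ F : ℝ → ℂ, ∀ g : SL2C, ∀ B : ℝ, 0 ≤ B →
    (∀ s, |s| ≤ Real.log (hsNormSq g) → ‖F s‖ ≤ B ∧ ‖deriv F s‖ ≤ B) →
    ∫⁻ z, ‖twist F U g z / fsWeight z‖ₑ ^ 2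
        ≤ ENNReal.ofReal (B * size g) ^ 2 * (C * energy U f) ∧
      ∫⁻ z, ‖twistDz F U f g z‖ₑ ^ 2 ≤ ENNReal.ofReal (B * size g) ^ 2 * (C * energy U f) := by
  obtain ⟨C₁, h₁⟩ := exists_lintegral_mobForm_le
  obtain ⟨C₂, h₂⟩ := exists_lintegral_inv_le
  refine ⟨C₁ + 2 * (1 + C₂), fun U f h F g B hB hF => ?_⟩
  have hs := one_le_size g
  have hs1 : 1 ≤ ENNReal.ofReal (size g) := by
    rw [← ENNReal.ofReal_one]; exact ENNReal.ofReal_le_ofReal hs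
  have hFz : ∀ z, ‖F (chartCocycle g z)‖ₑ ≤ ENNReal.ofReal B := fun z => by
    rw [← ofReal_norm]
    exact ENNReal.ofReal_le_ofReal (hF _ (abs_chartCocycle_le g z)).1
  have hFz' : ∀ z, ‖deriv F (chartCocycle g z)‖ₑ ≤ ENNReal.ofReal B := fun z => by
    rw [← ofReal_norm]
    exact ENNReal.ofReal_le_ofReal (hF _ (abs_chartCocycle_le g z)).2
  rw [ENNReal.ofReal_mul hB, mul_pow]
  have hb : ENNReal.ofReal B ^ 2 ≠ ⊤ := by simp
  have e1 := h₁ U f h g⁻¹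
  have e2 := h₂ U f h g⁻¹
  have hsz : size g⁻¹ = size g := by rw [size, hsNormSq_inv, size]
  rw [hsz] at e1 e2
  rw [ENNReal.ofReal_pow (by linarith)] at e2
  set S := ENNReal.ofReal (size g)
  set E := energy U f with hE
  have hSS : S ≤ S ^ 2 := by
    rw [sq]; exact le_mul_of_one_le_left' hs1
  have hfE : ∫⁻ w, ‖f w‖ₑ ^ 2 ≤ E := le_add_self
  constructor
  · calc ∫⁻ z, ‖twist F U g z / fsWeight z‖ₑ ^ 2
        ≤ ∫⁻ z, ENNReal.ofReal B ^ 2 * (‖U (mob g z)‖ₑ ^ 2 *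
            ENNReal.ofReal (1 / fsWeight z ^ 2)) := by
          refine lintegral_mono fun z => ?_
          rw [enorm_div_fsWeight_sq, twist, enorm_mul, mul_pow, mul_assoc]
          gcongr
          exact hFz z
      _ = ENNReal.ofReal B ^ 2 * ∫⁻ w, ‖U w‖ₑ ^ 2 * ENNReal.ofReal (1 / mobForm g⁻¹ w ^ 2) := by
          rw [lintegral_const_mul' _ _ hb, lintegral_comp_mob_fsWeight g fun w => ‖U w‖ₑ ^ 2]
      _ ≤ ENNReal.ofReal B ^ 2 * (C₁ * S ^ 2 * E) := by
          gcongr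
          exact e1.trans (by gcongr)
      _ ≤ ENNReal.ofReal B ^ 2 * (C₁ * S ^ 2 * E) +
          ENNReal.ofReal B ^ 2 * (2 * (1 + C₂) * S ^ 2 * E) := le_self_add
      _ = _ := by push_cast; ring
  · have m1 : Measurable fun z => 2 * (ENNReal.ofReal B ^ 2 * ‖f (mob g z) * mobDeriv g z‖ₑ ^ 2) :=
      (((h.meas_dz.comp (measurable_mob g)).mul (measurable_mobDeriv g)).enorm.pow_const
        2).const_mul _ |>.const_mul _
    calc ∫⁻ z, ‖twistDz F U f g z‖ₑ ^ 2
        ≤ ∫⁻ z, (2 * (ENNReal.ofReal B ^ 2 * ‖f (mob g z) * mobDeriv g z‖ₑ ^ 2) +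
            2 * (ENNReal.ofReal B ^ 2 * (‖U (mob g z)‖ₑ ^ 2 *
              ENNReal.ofReal (hsNormSq g / (fsWeight z * mobForm g z))))) := by
          refine lintegral_mono fun z => ?_
          rw [← mul_add]
          refine (pow_le_pow_left' (enorm_add_le _ _) 2).trans ((sq_add_le _ _).trans ?_)
          gcongr
          · rw [enorm_mul, mul_pow]
            gcongr
            exact hFz z
          · rw [enorm_mul, enorm_mul, mul_pow, mul_pow, mul_assoc]
            refine mul_le_mul' (pow_le_pow_left' (hFz' z) 2) ?_
            · rw [mul_comm]
              refine mul_le_mul_right ?_ _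
              rw [enorm_sq_eq_ofReal, norm_div, RCLike.norm_conj, norm_logRatioForm]
              refine ENNReal.ofReal_le_ofReal (le_trans ?_ (norm_sq_div_le g z))
              have : 0 ≤ ‖mobWronskian g z‖ / (fsWeight z * mobForm g z) := by
                have := fsWeight_pos z
                have := mobForm_pos g z
                positivity
              rw [RCLike.norm_ofNat]
              exact pow_le_pow_left₀ (div_nonneg this (by norm_num))
                (div_le_self this (by norm_num)) 2
      _ = 2 * (ENNReal.ofReal B ^ 2 * ∫⁻ w, ‖f w‖ₑ ^ 2) + 2 * (ENNReal.ofReal B ^ 2 *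
            ∫⁻ w, ‖U w‖ₑ ^ 2 *
              ENNReal.ofReal (hsNormSq g⁻¹ / (fsWeight w * mobForm g⁻¹ w))) := by
          rw [lintegral_add_left m1, lintegral_const_mul' _ _ (by simp),
            lintegral_const_mul' _ _ hb, lintegral_const_mul' _ _ (by simp),
            lintegral_const_mul' _ _ hb, lintegral_dz_comp_mob,
            lintegral_comp_mob_inv g fun w => ‖U w‖ₑ ^ 2]
      _ ≤ 2 * (ENNReal.ofReal B ^ 2 * (S ^ 2 * E)) + 2 * (ENNReal.ofReal B ^ 2 *
            (C₂ * S ^ 2 * E)) := by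
          gcongr
          exact hfE.trans (le_mul_of_one_le_left' (one_le_pow_of_one_le' hs1 2))
      _ ≤ 2 * (ENNReal.ofReal B ^ 2 * (S ^ 2 * E)) + 2 * (ENNReal.ofReal B ^ 2 *
            (C₂ * S ^ 2 * E)) + ENNReal.ofReal B ^ 2 * S ^ 2 * (C₁ * E) := le_self_add
      _ = _ := by push_cast; ring

/-! ### Averaging a family of Sobolev functions -/

section Average

variable {G : Type*} [MeasurableSpace G] {μ : Measure G} [SFinite μ]

/-- Minkowski's integral inequality in `L²`, with a prescribed bound `b` on the norms. -/
theorem lintegral_sq_lintegral_le {H : ℂ → G → ℝ≥0∞} (hH : Measurable (Function.uncurry H))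
    {b : G → ℝ≥0∞} (hb : Measurable b) (hb0 : ∀ g, b g ≠ 0) (hb1 : ∀ g, b g ≠ ⊤) {E : ℝ≥0∞}
    (h : ∀ g, ∫⁻ z, H z g ^ 2 ≤ b g ^ 2 * E) :
    ∫⁻ z, (∫⁻ g, H z g ∂μ) ^ 2 ≤ (∫⁻ g, b g ∂μ) ^ 2 * E := by
  have mH : ∀ z, Measurable (H z) := fun z => hH.comp measurable_prodMk_left
  -- Cauchy–Schwarz for `H = √b · (H / √b)`
  have h1 : ∀ z, (∫⁻ g, H z g ∂μ) ^ 2 ≤ (∫⁻ g, b g ∂μ) * ∫⁻ g, H z g ^ 2 * (b g)⁻¹ ∂μ := fun z => by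
    have hs : ∀ g, b g ^ (1 / 2 : ℝ) ≠ 0 := fun g => by
      simp [ENNReal.rpow_eq_zero_iff, hb0 g, hb1 g]
    have ht : ∀ g, b g ^ (1 / 2 : ℝ) ≠ ⊤ := fun g =>
      ENNReal.rpow_ne_top_of_nonneg (by norm_num) (hb1 g)
    have e0 : ∀ g, (b g ^ (1 / 2 : ℝ)) ^ 2 = b g := fun g => by
      rw [← ENNReal.rpow_natCast, ← ENNReal.rpow_mul]; norm_num
    have ms : Measurable fun g => b g ^ (1 / 2 : ℝ) := hb.pow_const _
    have := sq_lintegral_mul_le μ (f := fun g => b g ^ (1 / 2 : ℝ))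
      (g := fun g => H z g * (b g ^ (1 / 2 : ℝ))⁻¹) ms.aemeasurable
      ((mH z).mul ms.inv).aemeasurable
    have e1 : ∀ g, b g ^ (1 / 2 : ℝ) * (H z g * (b g ^ (1 / 2 : ℝ))⁻¹) = H z g := fun g => by
      rw [mul_left_comm, ENNReal.mul_inv_cancel (hs g) (ht g), mul_one]
    simpa only [e1, e0, mul_pow, ← ENNReal.inv_pow] using this
  calc ∫⁻ z, (∫⁻ g, H z g ∂μ) ^ 2
      ≤ ∫⁻ z, (∫⁻ g, b g ∂μ) * ∫⁻ g, H z g ^ 2 * (b g)⁻¹ ∂μ := lintegral_mono h1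
    _ = (∫⁻ g, b g ∂μ) * ∫⁻ g, (∫⁻ z, H z g ^ 2 * (b g)⁻¹) ∂μ := by
        have mm : Measurable fun x : ℂ × G => H x.1 x.2 ^ 2 * (b x.2)⁻¹ :=
          (hH.pow_const 2).mul (hb.comp measurable_snd).inv
        rw [lintegral_const_mul _ mm.lintegral_prod_right', lintegral_lintegral_swap]
        exact mm.aemeasurable
    _ ≤ (∫⁻ g, b g ∂μ) * ∫⁻ g, b g * E ∂μ := by
        gcongr with g
        rw [lintegral_mul_const' _ _ (ENNReal.inv_ne_top.2 (hb0 g))]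
        refine (mul_le_mul_left (h g) _).trans (le_of_eq ?_)
        rw [sq, mul_right_comm, mul_assoc (b g), ENNReal.mul_inv_cancel (hb0 g) (hb1 g), mul_one]
    _ = _ := by rw [lintegral_mul_const _ hb]; ring

theorem integrable_prod_mul {H : ℂ → G → ℂ} (hH : Measurable (Function.uncurry H))
    (h : ∫⁻ z, (∫⁻ g, ‖H z g‖ₑ ∂μ) ^ 2 < ⊤) {θ : ℂ → ℂ} (hθ : Measurable θ) (hθ2 : MemLp θ 2) :
    Integrable (fun x : ℂ × G => H x.1 x.2 * θ x.1) (volume.prod μ) := by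
  have mm : Measurable fun x : ℂ × G => H x.1 x.2 * θ x.1 := hH.mul (hθ.comp measurable_fst)
  refine ⟨mm.aestronglyMeasurable, ?_⟩
  rw [HasFiniteIntegral, lintegral_prod _ mm.enorm.aemeasurable]
  simp only [enorm_mul]
  have e : ∀ z, ∫⁻ g, ‖H z g‖ₑ * ‖θ z‖ₑ ∂μ = (∫⁻ g, ‖H z g‖ₑ ∂μ) * ‖θ z‖ₑ := fun z =>
    lintegral_mul_const' _ _ enorm_ne_top
  simp only [e]
  refine (lintegral_mul_le_sqrt _ hH.enorm.lintegral_prod_right'.aemeasurable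
    hθ.enorm.aemeasurable).trans_lt (ENNReal.mul_lt_top
      (ENNReal.rpow_lt_top_of_nonneg (by norm_num) h.ne)
      (ENNReal.rpow_lt_top_of_nonneg (by norm_num) ((memLp_two_iff hθ2.1).1 hθ2).ne))

/-- The average of a family of Sobolev functions with integrable norms is a Sobolev function, whose
weak derivative is the average of the weak derivatives. -/
theorem sob_average {v f : ℂ → G → ℂ} (hv : Measurable (Function.uncurry v))
    (hf : Measurable (Function.uncurry f)) {b : G → ℝ≥0∞} (hb : Measurable b)
    (hb0 : ∀ g, b g ≠ 0) (hb1 : ∀ g, b g ≠ ⊤) (hbI : ∫⁻ g, b g ∂μ < ⊤) {E : ℝ≥0∞} (hE : E < ⊤)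
    (h1 : ∀ g, ∫⁻ z, ‖v z g / fsWeight z‖ₑ ^ 2 ≤ b g ^ 2 * E)
    (h2 : ∀ g, ∫⁻ z, ‖f z g‖ₑ ^ 2 ≤ b g ^ 2 * E)
    (hw : ∀ g, HasWeakDz (fun z => v z g) fun z => f z g) :
    Sob (fun z => ∫ g, v z g ∂μ) (fun z => ∫ g, f z g ∂μ) ∧
      (∀ᵐ z, Integrable (v z) μ) ∧
      ∫⁻ z, ‖(∫ g, v z g ∂μ) / fsWeight z‖ₑ ^ 2 ≤ (∫⁻ g, b g ∂μ) ^ 2 * E ∧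
      ∫⁻ z, ‖∫ g, f z g ∂μ‖ₑ ^ 2 ≤ (∫⁻ g, b g ∂μ) ^ 2 * E := by
  have mq : Measurable fun z => (fsWeight z : ℂ) :=
    (Complex.continuous_ofReal.comp continuous_fsWeight).measurable
  have mv' : Measurable (Function.uncurry fun z g => v z g / fsWeight z) :=
    hv.div (mq.comp measurable_fst)
  have b1 := lintegral_sq_lintegral_le (μ := μ) (H := fun z g => ‖v z g / fsWeight z‖ₑ)
    mv'.enorm hb hb0 hb1 h1
  have b2 := lintegral_sq_lintegral_le (μ := μ) (H := fun z g => ‖f z g‖ₑ) hf.enorm hb hb0 hb1 h2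
  have hfin : (∫⁻ g, b g ∂μ) ^ 2 * E < ⊤ := ENNReal.mul_lt_top (ENNReal.pow_lt_top hbI) hE
  have c1 : ∫⁻ z, ‖(∫ g, v z g ∂μ) / fsWeight z‖ₑ ^ 2 ≤ (∫⁻ g, b g ∂μ) ^ 2 * E := by
    refine le_trans (lintegral_mono fun z => pow_le_pow_left' ?_ 2) b1
    rw [← integral_div]
    exact enorm_integral_le_lintegral_enorm _
  have c2 : ∫⁻ z, ‖∫ g, f z g ∂μ‖ₑ ^ 2 ≤ (∫⁻ g, b g ∂μ) ^ 2 * E :=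
    le_trans (lintegral_mono fun z => pow_le_pow_left' (enorm_integral_le_lintegral_enorm _) 2) b2
  have mV : Measurable fun z => ∫ g, v z g ∂μ :=
    hv.stronglyMeasurable.integral_prod_right'.measurable
  have mF : Measurable fun z => ∫ g, f z g ∂μ :=
    hf.stronglyMeasurable.integral_prod_right'.measurable
  have lV : MemLp (fun z => (∫ g, v z g ∂μ) / fsWeight z) 2 :=
    (memLp_two_iff (measurable_div_fsWeight mV).aestronglyMeasurable).2 (c1.trans_lt hfin)
  have lF : MemLp (fun z => ∫ g, f z g ∂μ) 2 :=
    (memLp_two_iff mF.aestronglyMeasurable).2 (c2.trans_lt hfin)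
  refine ⟨⟨mV, mF, lV, lF, locallyIntegrable_of_memLp lV, lF.locallyIntegrable (by norm_num),
    fun φ k1 k2 => ?_⟩, ?_, c1, c2⟩
  · have cw := continuous_wirtinger k1
    have sw := hasCompactSupport_wirtinger k2
    have cq : Continuous fun z => (fsWeight z : ℂ) * wirtinger φ z :=
      (Complex.continuous_ofReal.comp continuous_fsWeight).mul cw
    have i1 := integrable_prod_mul mv' (b1.trans_lt hfin) cq.measurable
      (cq.memLp_of_hasCompactSupport sw.mul_left)
    have i2 := integrable_prod_mul hf (b2.trans_lt hfin) k1.continuous.measurable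
      (k1.continuous.memLp_of_hasCompactSupport k2)
    have e1 : ∀ z g, v z g / fsWeight z * (fsWeight z * wirtinger φ z) = v z g * wirtinger φ z :=
      fun z g => by
      have := ofReal_fsWeight_ne_zero z
      field_simp
    simp only [e1] at i1
    have s1 := integral_integral_swap (f := fun z g => v z g * wirtinger φ z) i1
    have s2 := integral_integral_swap (f := fun z g => f z g * φ z) i2
    simp only [integral_mul_const] at s1 s2
    rw [s1, s2, ← integral_neg]
    congr 1
    ext g
    exact (hw g).2.2 φ k1 k2
  · have hlt : ∀ᵐ z, (∫⁻ g, ‖v z g / fsWeight z‖ₑ ∂μ) ^ 2 < ⊤ :=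
      ae_lt_top (mv'.enorm.lintegral_prod_right'.pow_const 2) (b1.trans_lt hfin).ne
    filter_upwards [hlt] with z hz
    have hz' : ∫⁻ g, ‖v z g / fsWeight z‖ₑ ∂μ < ⊤ := by
      by_contra hcon
      rw [not_lt, top_le_iff] at hcon
      rw [hcon] at hz
      simp at hz
    have hi : Integrable (fun g => v z g / fsWeight z) μ :=
      ⟨(mv'.comp measurable_prodMk_left).aestronglyMeasurable, hz'⟩
    refine (hi.const_mul (fsWeight z : ℂ)).congr (Eventually.of_forall fun g => ?_)
    exact mul_div_cancel₀ _ (ofReal_fsWeight_ne_zero z)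

end Average

/-! ### The averaged operators in the affine chart -/

theorem measurable_conj : Measurable fun z : ℂ => conj z := Complex.continuous_conj.measurable

theorem enorm_fsMean_sq_le {V : ℂ → ℂ} (hV : Measurable V) :
    ‖fsMean V‖ₑ ^ 2 ≤ (∫⁻ z, ENNReal.ofReal (1 / fsWeight z ^ 2)) *
      ∫⁻ z, ‖V z / fsWeight z‖ₑ ^ 2 := by
  have hpi := Real.pi_pos
  have m1 : Measurable fun z => ((1 / (Real.pi * fsWeight z) : ℝ) : ℂ) :=
    Complex.measurable_ofReal.comp (measurable_const.div
      (measurable_const.mul continuous_fsWeight.measurable))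
  have e : fsMean V = ∫ z, V z / fsWeight z * ((1 / (Real.pi * fsWeight z) : ℝ) : ℂ) := by
    rw [fsMean]
    congr 1
    ext z
    have h1 := ofReal_fsWeight_ne_zero z
    have h2 : (Real.pi : ℂ) ≠ 0 := by exact_mod_cast hpi.ne'
    rw [fsDensity_eq]
    push_cast
    field_simp
  rw [e, mul_comm]
  refine (enorm_mul_integral_sq_le (measurable_div_fsWeight hV) m1).trans ?_
  gcongr with z
  have h1 := fsWeight_pos z
  rw [enorm_sq_eq_ofReal, Complex.norm_real, Real.norm_of_nonneg (by positivity)]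
  refine ENNReal.ofReal_le_ofReal ?_
  rw [div_pow, one_pow]
  have h7 : 1 ≤ Real.pi := by linarith [Real.pi_gt_three]
  gcongr
  nlinarith

section Chart

variable [MeasurableSpace SL2C]

/-- `F` is a smooth function for which the norms of the operators `u ↦ F(σ_g) g⋆u` on the Sobolev
space have a `μ`-integral of the order of at most `β`: the norm at `g` is at most of the order of
`B g * size g`, if `B g` bounds `F` and its derivative on the range of `σ_g`. -/
structure AdmissibleSymbol (μ : Measure SL2C) (F : ℝ → ℂ) (β : ℝ) : Prop where
  contDiff : ContDiff ℝ ∞ F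
  exists_bound : ∃ B : SL2C → ℝ, Measurable B ∧ (∀ g, 0 < B g) ∧
    Integrable (fun g => B g * size g) μ ∧ ∫ g, B g * size g ∂μ ≤ β ∧
    ∀ g s, |s| ≤ Real.log (hsNormSq g) → ‖F s‖ ≤ B g ∧ ‖deriv F s‖ ≤ B g

theorem AdmissibleSymbol.nonneg {μ : Measure SL2C} {F : ℝ → ℂ} {β : ℝ}
    (h : AdmissibleSymbol μ F β) : 0 ≤ β := by
  obtain ⟨B, -, h0, -, h1, -⟩ := h.exists_bound
  exact (integral_nonneg fun g =>
    mul_nonneg (h0 g).le (zero_le_one.trans (one_le_size g))).trans h1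

variable [BorelSpace SL2C]

theorem measurable_coeff (i j : Fin 2) : Measurable fun g : SL2C => g i j :=
  have h : Continuous fun g : SL2C => g i j :=
    Continuous.matrix_elem continuous_subtype_val i j
  h.measurable

theorem measurable_mobNum : Measurable fun x : ℂ × SL2C => mobNum x.2 x.1 :=
  (((measurable_coeff 0 0).comp measurable_snd).mul measurable_fst).add
    ((measurable_coeff 0 1).comp measurable_snd)

theorem measurable_mobDen : Measurable fun x : ℂ × SL2C => mobDen x.2 x.1 :=
  (((measurable_coeff 1 0).comp measurable_snd).mul measurable_fst).add
    ((measurable_coeff 1 1).comp measurable_snd)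

theorem measurable_mob_prod : Measurable fun x : ℂ × SL2C => mob x.2 x.1 :=
  measurable_mobNum.div measurable_mobDen

theorem measurable_mobDeriv_prod : Measurable fun x : ℂ × SL2C => mobDeriv x.2 x.1 :=
  measurable_const.div (measurable_mobDen.pow_const 2)

theorem measurable_mobForm_prod : Measurable fun x : ℂ × SL2C => mobForm x.2 x.1 :=
  (measurable_mobNum.norm.pow_const 2).add (measurable_mobDen.norm.pow_const 2)

theorem measurable_coefP : Measurable coefP :=
  ((measurable_coeff 0 0).norm.pow_const 2).add ((measurable_coeff 1 0).norm.pow_const 2)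

theorem measurable_coefM : Measurable coefM :=
  ((measurable_coeff 0 1).norm.pow_const 2).add ((measurable_coeff 1 1).norm.pow_const 2)

theorem measurable_coefN : Measurable coefN :=
  ((measurable_conj.comp (measurable_coeff 0 0)).mul (measurable_coeff 0 1)).add
    ((measurable_conj.comp (measurable_coeff 1 0)).mul (measurable_coeff 1 1))

theorem measurable_size : Measurable size :=
  measurable_const.add (measurable_coefP.add measurable_coefM).log

theorem measurable_chartCocycle_prod : Measurable fun x : ℂ × SL2C => chartCocycle x.2 x.1 :=
  ((measurable_mobForm_prod.div
    (continuous_fsWeight.measurable.comp measurable_fst)).log).div_const 2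

theorem measurable_logRatioForm_prod : Measurable fun x : ℂ × SL2C => logRatioForm x.2 x.1 := by
  unfold logRatioForm
  refine Measurable.sub (Measurable.div ?_ ?_) (Measurable.div measurable_fst ?_)
  · exact ((Complex.measurable_ofReal.comp (measurable_coefP.comp measurable_snd)).mul
      measurable_fst).add (measurable_coefN.comp measurable_snd)
  · exact Complex.measurable_ofReal.comp measurable_mobForm_prod
  · exact Complex.measurable_ofReal.comp (continuous_fsWeight.measurable.comp measurable_fst)

theorem measurable_twist {F : ℝ → ℂ} (hF : ContDiff ℝ ∞ F) {U : ℂ → ℂ} (hU : Measurable U) :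
    Measurable (Function.uncurry fun z (g : SL2C) => twist F U g z) :=
  (hF.continuous.measurable.comp measurable_chartCocycle_prod).mul
    (hU.comp measurable_mob_prod)

theorem measurable_twistDz {F : ℝ → ℂ} (hF : ContDiff ℝ ∞ F) {U f : ℂ → ℂ} (hU : Measurable U)
    (hf : Measurable f) :
    Measurable (Function.uncurry fun z (g : SL2C) => twistDz F U f g z) :=
  ((hF.continuous.measurable.comp measurable_chartCocycle_prod).mul
    ((hf.comp measurable_mob_prod).mul measurable_mobDeriv_prod)).add
    ((((hF.continuous_deriv (by simp)).measurable.comp measurable_chartCocycle_prod).mul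
      ((measurable_conj.comp measurable_logRatioForm_prod).div_const 2)).mul
      (hU.comp measurable_mob_prod))

variable (μ : Measure SL2C)

/-- The operator `U ↦ ∫ F(σ_g) g⋆U dμ(g)` in the affine chart. -/
def averaged (F : ℝ → ℂ) (U : ℂ → ℂ) (z : ℂ) : ℂ := ∫ g, twist F U g z ∂μ

/-- The average of the operators `U ↦ F(σ_g) g⋆U` is bounded on the Sobolev space. -/
theorem exists_averaged_le : ∃ C : ℝ, 0 ≤ C ∧ ∀ (μ : Measure SL2C) [SFinite μ] (U f : ℂ → ℂ),
    Sob U f → ∀ (F : ℝ → ℂ) (β : ℝ), AdmissibleSymbol μ F β →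
    (∀ᵐ z, Integrable (fun g => twist F U g z) μ) ∧
    ∃ f', Sob (averaged μ F U) f' ∧
      energy (averaged μ F U) f' ≤ ENNReal.ofReal (C * β ^ 2) * energy U f := by
  obtain ⟨C, hC⟩ := exists_twist_le
  have hA : ∫⁻ z, ENNReal.ofReal (1 / fsWeight z ^ 2) < ⊤ :=
    integrable_inv_fsWeight_sq.lintegral_lt_top
  set A := (∫⁻ z, ENNReal.ofReal (1 / fsWeight z ^ 2)).toNNReal with hAdef
  have hA' : ∫⁻ z, ENNReal.ofReal (1 / fsWeight z ^ 2) = A := (ENNReal.coe_toNNReal hA.ne).symm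
  refine ⟨((A + 1) * C : ℝ≥0), NNReal.coe_nonneg _, fun μ _ U f h F β hF => ?_⟩
  obtain ⟨B, mB, hB0, hBI, hBβ, hB⟩ := hF.exists_bound
  have hpos : ∀ g, 0 < B g * size g := fun g =>
    mul_pos (hB0 g) (zero_lt_one.trans_le (one_le_size g))
  have hfinE : energy U f < ⊤ := by
    rw [energy]
    exact ENNReal.add_lt_top.2 ⟨by simp, (memLp_two_iff h.memLp_dz.1).1 h.memLp_dz⟩
  have hint : ∫⁻ g, ENNReal.ofReal (B g * size g) ∂μ = ENNReal.ofReal (∫ g, B g * size g ∂μ) :=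
    (ofReal_integral_eq_lintegral_ofReal hBI (Eventually.of_forall fun g => (hpos g).le)).symm
  have key := sob_average (μ := μ) (v := fun z g => twist F U g z)
    (f := fun z g => twistDz F U f g z) (b := fun g => ENNReal.ofReal (B g * size g))
    (E := C * energy U f)
    (measurable_twist hF.contDiff h.meas) (measurable_twistDz hF.contDiff h.meas h.meas_dz)
    (mB.mul measurable_size).ennreal_ofReal (fun g => (ENNReal.ofReal_pos.2 (hpos g)).ne')
    (fun g => ENNReal.ofReal_ne_top) (by rw [hint]; exact ENNReal.ofReal_lt_top)
    (ENNReal.mul_lt_top ENNReal.coe_lt_top hfinE)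
    (fun g => (hC U f h F g (B g) (hB0 g).le (hB g)).1)
    (fun g => (hC U f h F g (B g) (hB0 g).le (hB g)).2)
    (fun g => h.hasWeakDz_twist hF.contDiff g)
  obtain ⟨k1, k2, k3, k4⟩ := key
  refine ⟨k2, _, k1, ?_⟩
  have hβ : (∫⁻ g, ENNReal.ofReal (B g * size g) ∂μ) ^ 2 ≤ ENNReal.ofReal (β ^ 2) := by
    rw [hint, ENNReal.ofReal_pow hF.nonneg]
    exact pow_le_pow_left' (ENNReal.ofReal_le_ofReal hBβ) 2
  have hm := enorm_fsMean_sq_le k1.meas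
  rw [hA'] at hm
  calc energy (averaged μ F U) _
      ≤ A * ((∫⁻ g, ENNReal.ofReal (B g * size g) ∂μ) ^ 2 * (C * energy U f)) +
        (∫⁻ g, ENNReal.ofReal (B g * size g) ∂μ) ^ 2 * (C * energy U f) :=
        add_le_add (hm.trans (mul_le_mul_right k3 _)) k4
    _ ≤ A * (ENNReal.ofReal (β ^ 2) * (C * energy U f)) +
        ENNReal.ofReal (β ^ 2) * (C * energy U f) := by gcongr
    _ = _ := by
        rw [ENNReal.ofReal_mul (NNReal.coe_nonneg _), ENNReal.ofReal_coe_nnreal]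
        push_cast
        ring

end Chart

/-! ### The affine chart of the projective line -/

theorem chart_zero_eq (z : ℂ) : chart 0 z = Projectivization.mk ℂ ![z, 1] (by simp) := rfl

/-- The affine coordinate `[v] ↦ v₀ / v₁`, with the value `0` at the point at infinity. -/
def chartInv (x : P1) : ℂ := x.rep 0 / x.rep 1

theorem chartInv_mk (v : Fin 2 → ℂ) (hv : v ≠ 0) :
    chartInv (Projectivization.mk ℂ v hv) = v 0 / v 1 := by
  obtain ⟨a, ha⟩ := Projectivization.exists_smul_eq_mk_rep ℂ v hv
  rw [chartInv, ← ha, Units.smul_def, Pi.smul_apply, Pi.smul_apply, smul_eq_mul, smul_eq_mul,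
    mul_div_mul_left _ _ a.ne_zero]

theorem rep_one_ne_zero_iff (v : Fin 2 → ℂ) (hv : v ≠ 0) :
    (Projectivization.mk ℂ v hv).rep 1 ≠ 0 ↔ v 1 ≠ 0 := by
  obtain ⟨a, ha⟩ := Projectivization.exists_smul_eq_mk_rep ℂ v hv
  rw [← ha, Units.smul_def, Pi.smul_apply, smul_eq_mul, mul_ne_zero_iff, and_iff_right a.ne_zero]

theorem isOpen_chartInv_preimage {V : Set ℂ} (hV : IsOpen V) :
    IsOpen {x : P1 | x.rep 1 ≠ 0 ∧ chartInv x ∈ V} := by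
  rw [isOpen_coinduced]
  have e : Projectivization.mk' ℂ (V := Fin 2 → ℂ) ⁻¹' {x : P1 | x.rep 1 ≠ 0 ∧ chartInv x ∈ V}
      = {v | v.1 1 ≠ 0 ∧ v.1 0 / v.1 1 ∈ V} := by
    ext v
    simp only [Set.mem_preimage, Set.mem_ofPred_eq, Projectivization.mk'_eq_mk,
      rep_one_ne_zero_iff, chartInv_mk]
  rw [e]
  have c0 : Continuous fun v : {v : Fin 2 → ℂ // v ≠ 0} => v.1 0 :=
    (continuous_apply 0).comp continuous_subtype_val
  have c1 : Continuous fun v : {v : Fin 2 → ℂ // v ≠ 0} => v.1 1 :=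
    (continuous_apply 1).comp continuous_subtype_val
  have ho : IsOpen {v : {v : Fin 2 → ℂ // v ≠ 0} | v.1 1 ≠ 0} := isOpen_ne_fun c1 continuous_const
  have hc : ContinuousOn (fun v : {v : Fin 2 → ℂ // v ≠ 0} => v.1 0 / v.1 1) {v | v.1 1 ≠ 0} :=
    c0.continuousOn.div c1.continuousOn fun v hv => hv
  exact hc.isOpen_inter_preimage ho hV

theorem isOpen_rep_one_ne_zero : IsOpen {x : P1 | x.rep 1 ≠ 0} := by
  simpa using isOpen_chartInv_preimage isOpen_univ

theorem measurable_chartInv : Measurable chartInv := by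
  refine measurable_of_isOpen fun V hV => ?_
  have h1 := (isOpen_chartInv_preimage hV).measurableSet
  have h2 := isOpen_rep_one_ne_zero.measurableSet
  have e : chartInv ⁻¹' V = {x : P1 | x.rep 1 ≠ 0 ∧ chartInv x ∈ V} ∪
      ({x : P1 | x.rep 1 ≠ 0}ᶜ ∩ {_x : P1 | (0 : ℂ) ∈ V}) := by
    ext x
    by_cases hx : x.rep 1 = 0
    · simp [chartInv, hx]
    · simp [hx]
  rw [e]
  exact h1.union (h2.compl.inter (MeasurableSet.const _))

theorem chartInv_chart_zero (z : ℂ) : chartInv (chart 0 z) = z := by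
  rw [chart_zero_eq, chartInv_mk]; simp

theorem measurableEmbedding_chart_zero : MeasurableEmbedding (chart 0) := by
  refine MeasurableEmbedding.of_measurable_inverse (measurable_chart 0) ?_ measurable_chartInv
    chartInv_chart_zero
  have e : Set.range (chart 0) = {x : P1 | x.rep 1 ≠ 0} := by
    ext x
    constructor
    · rintro ⟨z, rfl⟩
      rw [chart_zero_eq, Set.mem_ofPred_eq, rep_one_ne_zero_iff]
      simp
    · intro hx
      refine ⟨x.rep 0 / x.rep 1, ?_⟩
      conv_rhs => rw [← Projectivization.mk_rep x]
      rw [chart_zero_eq, Projectivization.mk_eq_mk_iff']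
      refine ⟨(x.rep 1)⁻¹, ?_⟩
      have hx' : x.rep 1 ≠ 0 := hx
      ext i
      fin_cases i <;> simp [hx']
      field_simp
  rw [e]
  exact isOpen_rep_one_ne_zero.measurableSet

theorem measurable_ofReal_fsDensity : Measurable fun z => ENNReal.ofReal (fsDensity z) :=
  continuous_fsDensity.measurable.ennreal_ofReal

theorem lintegral_fubiniStudy (F : P1 → ℝ≥0∞) :
    ∫⁻ x, F x ∂fubiniStudy = ∫⁻ z, ENNReal.ofReal (fsDensity z) * F (chart 0 z) := by
  rw [fubiniStudy, measurableEmbedding_chart_zero.lintegral_map,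
    lintegral_withDensity_eq_lintegral_mul_non_measurable _ measurable_ofReal_fsDensity
      (Eventually.of_forall fun z => ENNReal.ofReal_lt_top)]
  rfl

theorem integral_fubiniStudy (F : P1 → ℂ) :
    ∫ x, F x ∂fubiniStudy = fsMean (F ∘ chart 0) := by
  rw [fubiniStudy, measurableEmbedding_chart_zero.integral_map,
    integral_withDensity_eq_integral_toReal_smul measurable_ofReal_fsDensity
      (Eventually.of_forall fun z => ENNReal.ofReal_lt_top), fsMean]
  congr 1
  ext z
  rw [ENNReal.toReal_ofReal (fsDensity_pos z).le, Complex.real_smul, mul_comm, Function.comp_apply]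

theorem ae_fubiniStudy_iff {p : P1 → Prop} :
    (∀ᵐ x ∂fubiniStudy, p x) ↔ ∀ᵐ z, p (chart 0 z) := by
  rw [fubiniStudy, measurableEmbedding_chart_zero.ae_map_iff,
    ae_withDensity_iff measurable_ofReal_fsDensity]
  have : ∀ z, ENNReal.ofReal (fsDensity z) ≠ 0 := fun z =>
    (ENNReal.ofReal_pos.2 (fsDensity_pos z)).ne'
  simp [this]

theorem mulVec_fin_two (g : SL2C) (z w : ℂ) :
    g.1 *ᵥ ![z, w] = ![g 0 0 * z + g 0 1 * w, g 1 0 * z + g 1 1 * w] := by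
  ext i
  fin_cases i <;> simp [Matrix.mulVec, dotProduct, Fin.sum_univ_two]

theorem vnorm_fin_two (z w : ℂ) : vnorm ![z, w] = √(‖z‖ ^ 2 + ‖w‖ ^ 2) := by
  simp [vnorm, EuclideanSpace.norm_eq, Fin.sum_univ_two]

theorem cocycle_chart_zero (g : SL2C) (z : ℂ) : cocycle g (chart 0 z) = chartCocycle g z := by
  rw [chart_zero_eq, cocycle_mk, mulVec_fin_two, vnorm_fin_two, vnorm_fin_two]
  have e1 : ‖g 0 0 * z + g 0 1 * 1‖ ^ 2 + ‖g 1 0 * z + g 1 1 * 1‖ ^ 2 = mobForm g z := by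
    simp [mobForm, mobNum, mobDen]
  have e2 : ‖z‖ ^ 2 + ‖(1 : ℂ)‖ ^ 2 = fsWeight z := by simp [fsWeight, add_comm]
  rw [e1, e2, ← Real.sqrt_div (mobForm_pos g z).le, Real.log_sqrt
    (div_pos (mobForm_pos g z) (fsWeight_pos z)).le, chartCocycle]

theorem smul_chart_zero (g : SL2C) {z : ℂ} (hz : mobDen g z ≠ 0) :
    g • chart 0 z = chart 0 (mob g z) := by
  have h1 : mobNum g z / mobDen g z * mobDen g z = mobNum g z := div_mul_cancel₀ _ hz
  rw [chart_zero_eq, chart_zero_eq, Projectivization.smul_mk, Projectivization.mk_eq_mk_iff']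
  refine ⟨mobDen g z, ?_⟩
  have e : g • ![z, (1 : ℂ)] = g.1 *ᵥ ![z, 1] := rfl
  rw [e, mulVec_fin_two]
  ext i
  fin_cases i
  · simp only [Fin.zero_eta, Pi.smul_apply, Matrix.cons_val_zero, smul_eq_mul, mob]
    rw [mul_comm, h1, mobNum, mul_one]
  · simp [mobDen]

/-- The symbol `F(s) = (i s)^k e^{i ξ s}` of the operator `𝒫_ξ^{(k)}`. -/
def markovSymbol (k : ℕ) (ξ : ℝ) (s : ℝ) : ℂ :=
  (Complex.I * s) ^ k * Complex.exp (Complex.I * ξ * s)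

theorem perturbedIntegrand_chart_zero (k : ℕ) (ξ : ℝ) (u : P1 → ℂ) (g : SL2C) {z : ℂ}
    (hz : mobDen g z ≠ 0) :
    perturbedIntegrand k ξ u (chart 0 z) g = twist (markovSymbol k ξ) (u ∘ chart 0) g z := by
  rw [perturbedIntegrand, cocycle_chart_zero, smul_chart_zero g hz]
  rfl

theorem ae_comp_mob (g : SL2C) {p : ℂ → Prop} (h : ∀ᵐ w, p w) : ∀ᵐ z, p (mob g z) := by
  obtain ⟨N, hN, mN, hN0⟩ := exists_measurable_superset_of_null (ae_iff.1 h)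
  have h1 := lintegral_comp_mob g (N.indicator 1)
  rw [lintegral_indicator_one mN, hN0, lintegral_eq_zero_iff] at h1
  · filter_upwards [h1, ae_mobDen_ne_zero g] with z hz hz'
    by_contra hcon
    have hm : mob g z ∈ N := hN hcon
    have hd : 0 < ‖mobDeriv g z‖ ^ 2 := by
      have : 0 < ‖mobDen g z‖ := by simpa using hz'
      rw [norm_mobDeriv]; positivity
    have : ENNReal.ofReal (‖mobDeriv g z‖ ^ 2) = 0 := by simpa [hm] using hz
    exact (ENNReal.ofReal_pos.2 hd).ne' this
  · exact ((measurable_mobDeriv g).norm.pow_const 2).ennreal_ofReal.mul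
      ((measurable_one.indicator mN).comp (measurable_mob g))

section AlmostEverywhere

variable [MeasurableSpace SL2C] [BorelSpace SL2C] (μ : Measure SL2C) [SFinite μ]

theorem ae_ae_mobDen_ne_zero : ∀ᵐ z, ∀ᵐ g ∂μ, mobDen g z ≠ 0 := by
  refine (Measure.ae_ae_comm ?_).2 (Eventually.of_forall ae_mobDen_ne_zero)
  exact (measurable_mobDen (measurableSet_singleton (0 : ℂ))).compl

theorem ae_ae_comp_mob {p : ℂ → Prop} (h : ∀ᵐ w, p w) : ∀ᵐ z, ∀ᵐ g ∂μ, p (mob g z) := by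
  obtain ⟨N, hN, mN, hN0⟩ := exists_measurable_superset_of_null (ae_iff.1 h)
  have h1 : ∀ᵐ w, w ∉ N := by simpa [ae_iff] using hN0
  have h2 : ∀ᵐ z, ∀ᵐ g ∂μ, mob g z ∉ N :=
    (Measure.ae_ae_comm (measurable_mob_prod mN).compl).2
      (Eventually.of_forall fun g => ae_comp_mob g h1)
  filter_upwards [h2] with z hz
  filter_upwards [hz] with g hg
  by_contra hcon
  exact hg (hN hcon)

end AlmostEverywhere

/-! ### The Sobolev space of the projective line in the affine chart -/

namespace W12

theorem measurable_coe (u : W12) : Measurable u := (Lp.stronglyMeasurable (toL2 u)).measurable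

theorem ext_chart {u v : W12} (h : u ∘ chart 0 =ᵐ[volume] v ∘ chart 0) : u = v :=
  Subtype.ext (Lp.ext (ae_fubiniStudy_iff.2 h))

theorem coe_add_chart (u v : W12) :
    (u + v : W12) ∘ chart 0 =ᵐ[volume] u ∘ chart 0 + v ∘ chart 0 :=
  quasi_chart_zero.ae_eq_comp (Lp.coeFn_add (toL2 u) (toL2 v))

theorem coe_sub_chart (u v : W12) :
    (u - v : W12) ∘ chart 0 =ᵐ[volume] u ∘ chart 0 - v ∘ chart 0 :=
  quasi_chart_zero.ae_eq_comp (Lp.coeFn_sub (toL2 u) (toL2 v))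

theorem coe_smul_chart (c : ℂ) (u : W12) :
    (c • u : W12) ∘ chart 0 =ᵐ[volume] c • (u ∘ chart 0) :=
  quasi_chart_zero.ae_eq_comp (Lp.coeFn_smul c (toL2 u))

end W12

theorem HasWeakDz.congr_dz {v f g : ℂ → ℂ} (h : HasWeakDz v f) (hfg : f =ᵐ[volume] g) :
    HasWeakDz v g := by
  refine ⟨h.1, h.2.1.congr hfg, fun φ h1 h2 => ?_⟩
  rw [h.2.2 φ h1 h2]
  congr 1
  refine integral_congr_ae ?_
  filter_upwards [hfg] with z hz
  rw [hz]

theorem ofReal_fsDensity (z : ℂ) :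
    ENNReal.ofReal (fsDensity z)
      = ENNReal.ofReal (1 / Real.pi) * ENNReal.ofReal (1 / fsWeight z ^ 2) := by
  rw [← ENNReal.ofReal_mul (by positivity), fsDensity_eq, one_div_mul_one_div]

theorem memLp_fubiniStudy_iff {F : P1 → ℂ} (hF : Measurable F) :
    MemLp F 2 fubiniStudy ↔ MemLp (fun z => F (chart 0 z) / fsWeight z) 2 := by
  have mF : Measurable fun z => F (chart 0 z) := hF.comp (measurable_chart 0)
  rw [memLp_two_iff (measurable_div_fsWeight mF).aestronglyMeasurable, MemLp,
    and_iff_right hF.aestronglyMeasurable,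
    eLpNorm_lt_top_iff_lintegral_rpow_enorm_lt_top (by norm_num) (by norm_num)]
  have hpi := Real.pi_pos
  have e : ∀ z, ENNReal.ofReal (fsDensity z) * ‖F (chart 0 z)‖ₑ ^ 2
      = ENNReal.ofReal (1 / Real.pi) * ‖F (chart 0 z) / fsWeight z‖ₑ ^ 2 := fun z => by
    rw [ofReal_fsDensity, enorm_div_fsWeight_sq]; ring
  have hc : ENNReal.ofReal (1 / Real.pi) ≠ 0 := (ENNReal.ofReal_pos.2 (by positivity)).ne'
  simp only [ENNReal.toReal_ofNat, ENNReal.rpow_ofNat]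
  rw [lintegral_fubiniStudy]
  simp only [e]
  rw [lintegral_const_mul' _ _ ENNReal.ofReal_ne_top,
    ENNReal.mul_lt_top_iff]
  simp only [ENNReal.ofReal_lt_top, true_and, hc, false_or, or_iff_left_iff_imp]
  rintro h
  rw [h]
  exact ENNReal.zero_lt_top

theorem W12.sob (u : W12) : Sob (u ∘ chart 0) (dz u) where
  meas := (measurable_coe u).comp (measurable_chart 0)
  meas_dz := (Lp.stronglyMeasurable (dz u)).measurable
  memLp := (memLp_fubiniStudy_iff (measurable_coe u)).1 (Lp.memLp (toL2 u))
  memLp_dz := Lp.memLp (dz u)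
  weak := (hasWeakDz_dz u).congr_dz (coeFn_dz u).symm

theorem enorm_sq_Lp_two (f : Lp ℂ 2 (volume : Measure ℂ)) : ‖f‖ₑ ^ 2 = ∫⁻ z, ‖f z‖ₑ ^ 2 := by
  have h := eLpNorm_nnreal_pow_eq_lintegral (f := f) (μ := volume) (p := 2) (by norm_num)
  rw [Lp.enorm_def]
  simpa using h

theorem ofReal_norm_sq_W12_le (u : W12) :
    ENNReal.ofReal (‖u‖ ^ 2) ≤ 3 * energy (u ∘ chart 0) (W12.dz u) := by
  rw [energy, ← enorm_sq_Lp_two, ← integral_fubiniStudy, ← ofReal_norm, ← ofReal_norm,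
    ← ENNReal.ofReal_pow (norm_nonneg _), ← ENNReal.ofReal_pow (norm_nonneg _),
    ← ENNReal.ofReal_add (by positivity) (by positivity),
    show (3 : ℝ≥0∞) = ENNReal.ofReal 3 by simp, ← ENNReal.ofReal_mul (by norm_num), W12.norm_def]
  refine ENNReal.ofReal_le_ofReal ?_
  have h2 : √2 ^ 2 = 2 := Real.sq_sqrt (by norm_num)
  nlinarith [sq_nonneg (√2 * ‖∫ x, u x ∂fubiniStudy‖ - ‖W12.dz u‖)]

theorem energy_W12_le (u : W12) :
    energy (u ∘ chart 0) (W12.dz u) ≤ ENNReal.ofReal (‖u‖ ^ 2) := by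
  rw [energy, ← enorm_sq_Lp_two, ← integral_fubiniStudy, ← ofReal_norm, ← ofReal_norm,
    ← ENNReal.ofReal_pow (norm_nonneg _), ← ENNReal.ofReal_pow (norm_nonneg _),
    ← ENNReal.ofReal_add (by positivity) (by positivity), W12.norm_def]
  refine ENNReal.ofReal_le_ofReal ?_
  have h2 : √2 ^ 2 = 2 := Real.sq_sqrt (by norm_num)
  have h3 : 0 ≤ ‖∫ x, u x ∂fubiniStudy‖ * (√2 * ‖W12.dz u‖) := by positivity
  nlinarith [sq_nonneg ‖W12.dz u‖]

theorem norm_W12_le {u : W12} {V f : ℂ → ℂ} (h : Sob V f) (huV : u ∘ chart 0 =ᵐ[volume] V) :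
    ENNReal.ofReal (‖u‖ ^ 2) ≤ 3 * energy V f := by
  refine (ofReal_norm_sq_W12_le u).trans (le_of_eq ?_)
  have h1 : W12.dz u =ᵐ[volume] f := u.sob.weak.unique (h.weak.congr huV.symm)
  congr 1
  rw [energy, energy]
  refine congrArg₂ (fun a b => ‖a‖ₑ ^ 2 + b) ?_ ?_
  · refine integral_congr_ae ?_
    filter_upwards [huV] with z hz
    rw [hz]
  · refine lintegral_congr_ae ?_
    filter_upwards [h1] with z hz
    rw [hz]

/-- The matrix `[[0, i], [i, 0]]`, which exchanges the two affine charts. -/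
def chartSwap : SL2C :=
  ⟨!![0, Complex.I; Complex.I, 0], by simp [Matrix.det_fin_two]⟩

theorem mob_chartSwap (z : ℂ) : mob chartSwap z = z⁻¹ := by
  have h : mobNum chartSwap z = Complex.I ∧ mobDen chartSwap z = Complex.I * z := by
    constructor <;> simp [mobNum, mobDen, chartSwap]
  rw [mob, h.1, h.2, div_mul_cancel_left₀ Complex.I_ne_zero]

/-- Every Sobolev function in the affine chart comes from a Sobolev class on `ℙ¹`: the second chart
is the image of the first under a Möbius transformation. -/
theorem Sob.exists_W12 {V f : ℂ → ℂ} (h : Sob V f) : ∃ u : W12, u ∘ chart 0 =ᵐ[volume] V := by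
  set F : P1 → ℂ := V ∘ chartInv with hFdef
  have mF : Measurable F := h.meas.comp measurable_chartInv
  have eF : ∀ z, F (chart 0 z) = V z := fun z => by
    rw [hFdef, Function.comp_apply, chartInv_chart_zero]
  have hF : MemLp F 2 fubiniStudy := by
    rw [memLp_fubiniStudy_iff mF]
    simpa only [eF] using h.memLp
  have h0 : hF.toLp F ∘ chart 0 =ᵐ[volume] V := by
    filter_upwards [quasi_chart_zero.ae_eq_comp hF.coeFn_toLp] with z hz
    rw [hz, Function.comp_apply, eF]
  have h1 : hF.toLp F ∘ chart 1 =ᵐ[volume] fun z => V (mob chartSwap z) := by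
    have hne : ∀ᵐ z : ℂ, z ≠ 0 := by simp [ae_iff]
    filter_upwards [(quasi_chart 1).ae_eq_comp hF.coeFn_toLp, hne] with z hz hz0
    rw [hz, Function.comp_apply, chart_one_eq z hz0, eF, mob_chartSwap]
  refine ⟨⟨hF.toLp F, fun j => ?_⟩, h0⟩
  fin_cases j
  · exact ⟨f, h.memLp_dz, h.weak.congr h0.symm⟩
  · have h2 := h.comp_mob chartSwap
    exact ⟨_, h2.memLp_dz, h2.weak.congr h1.symm⟩

/-! ### Averaged operators on the Sobolev space -/

section Operators

variable [MeasurableSpace SL2C] (μ : Measure SL2C)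

/-- `T` is the operator `u ↦ ∫ F(σ_g) g⋆u dμ(g)` on `W^{1,2}`, where the integrals converge
absolutely almost everywhere. -/
def Represents (F : ℝ → ℂ) (T : W12 → W12) : Prop :=
  ∀ u : W12, ∀ᵐ z, Integrable (fun g => twist F (u ∘ chart 0) g z) μ ∧
    T u (chart 0 z) = averaged μ F (u ∘ chart 0) z

variable {μ}

theorem Represents.sub {F F' : ℝ → ℂ} {T T' : W12 →L[ℂ] W12} (h : Represents μ F T)
    (h' : Represents μ F' T') : Represents μ (F - F') (T - T' : W12 →L[ℂ] W12) := fun u => by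
  filter_upwards [h u, h' u, W12.coe_sub_chart (T u) (T' u)] with z h1 h2 h3
  have e : ∀ g, twist (F - F') (u ∘ chart 0) g z
      = twist F (u ∘ chart 0) g z - twist F' (u ∘ chart 0) g z := fun g => by
    simp only [twist, Pi.sub_apply, sub_mul]
  simp only [averaged, e]
  refine ⟨h1.1.sub h2.1, ?_⟩
  rw [integral_sub h1.1 h2.1]
  refine Eq.trans h3 ?_
  rw [Pi.sub_apply, Function.comp_apply, Function.comp_apply, h1.2, h2.2, averaged, averaged]

theorem Represents.smul {F : ℝ → ℂ} {T : W12 →L[ℂ] W12} (c : ℂ) (h : Represents μ F T) :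
    Represents μ (c • F) (c • T : W12 →L[ℂ] W12) := fun u => by
  filter_upwards [h u, W12.coe_smul_chart c (T u)] with z h1 h3
  have e : ∀ g, twist (c • F) (u ∘ chart 0) g z = c * twist F (u ∘ chart 0) g z := fun g => by
    simp only [twist, Pi.smul_apply, smul_eq_mul, mul_assoc]
  simp only [averaged, e]
  refine ⟨h1.1.const_mul c, ?_⟩
  rw [integral_const_mul]
  refine Eq.trans h3 ?_
  rw [Pi.smul_apply, Function.comp_apply, h1.2, averaged, smul_eq_mul]

variable [BorelSpace SL2C] [SFinite μ]

/-- Different representatives of a class have the same averages: for almost every `z`, they agree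
at `g z` for almost every `g`. -/
theorem Represents.map_add {F : ℝ → ℂ} {T : W12 → W12} (h : Represents μ F T) (u v : W12) :
    T (u + v) = T u + T v := by
  refine W12.ext_chart ?_
  filter_upwards [h u, h v, h (u + v), W12.coe_add_chart (T u) (T v),
    ae_ae_comp_mob μ (W12.coe_add_chart u v)] with z h1 h2 h3 h4 h5
  rw [h4, Pi.add_apply, Function.comp_apply, Function.comp_apply, Function.comp_apply, h1.2, h2.2,
    h3.2, averaged, averaged, averaged, ← integral_add h1.1 h2.1]
  refine integral_congr_ae ?_
  filter_upwards [h5] with g hg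
  rw [twist, hg, Pi.add_apply, mul_add, twist, twist]

theorem Represents.map_smul {F : ℝ → ℂ} {T : W12 → W12} (h : Represents μ F T) (c : ℂ) (u : W12) :
    T (c • u) = c • T u := by
  refine W12.ext_chart ?_
  filter_upwards [h u, h (c • u), W12.coe_smul_chart c (T u),
    ae_ae_comp_mob μ (W12.coe_smul_chart c u)] with z h1 h3 h4 h5
  rw [h4, Pi.smul_apply, Function.comp_apply, Function.comp_apply, h1.2,
    h3.2, averaged, averaged, smul_eq_mul, ← integral_const_mul]
  refine integral_congr_ae ?_
  filter_upwards [h5] with g hg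
  rw [twist, hg, Pi.smul_apply, smul_eq_mul, mul_left_comm, twist]

/-- An admissible symbol of size `β` defines a bounded operator, of norm `O(β)`. -/
theorem exists_represents : ∃ C : ℝ, 0 ≤ C ∧ ∀ (μ : Measure SL2C) [SFinite μ] (F : ℝ → ℂ) (β : ℝ),
    AdmissibleSymbol μ F β → (∃ T : W12 →L[ℂ] W12, Represents μ F T) ∧
      ∀ T : W12 →L[ℂ] W12, Represents μ F T → ‖T‖ ≤ C * β := by
  obtain ⟨C, hC0, hC⟩ := exists_averaged_le
  refine ⟨√(3 * C), Real.sqrt_nonneg _, fun μ _ F β hF => ?_⟩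
  have hβ := hF.nonneg
  have bound : ∀ T : W12 → W12, Represents μ F T → ∀ u, ‖T u‖ ≤ √(3 * C) * β * ‖u‖ :=
    fun T hT u => by
    obtain ⟨-, f', hf', hE⟩ := hC μ _ _ u.sob F β hF
    have h1 : T u ∘ chart 0 =ᵐ[volume] averaged μ F (u ∘ chart 0) := by
      filter_upwards [hT u] with z hz
      exact hz.2
    have h2 := (norm_W12_le hf' h1).trans (mul_le_mul_right
      (hE.trans (mul_le_mul_right (energy_W12_le u) _)) _)
    rw [← ENNReal.ofReal_mul (by positivity), show (3 : ℝ≥0∞) = ENNReal.ofReal 3 by simp,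
      ← ENNReal.ofReal_mul (by norm_num), ENNReal.ofReal_le_ofReal_iff (by positivity)] at h2
    refine le_of_sq_le_sq ?_ (by positivity)
    rw [mul_pow, mul_pow, Real.sq_sqrt (by positivity)]
    linarith
  refine ⟨?_, fun T hT => T.opNorm_le_bound (by positivity) (bound T hT)⟩
  have hex : ∀ u : W12, ∃ w : W12, w ∘ chart 0 =ᵐ[volume] averaged μ F (u ∘ chart 0) := fun u => by
    obtain ⟨-, f', hf', -⟩ := hC μ _ _ u.sob F β hF
    exact hf'.exists_W12
  choose T hT using hex
  have hR : Represents μ F T := fun u => by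
    filter_upwards [(hC μ _ _ u.sob F β hF).1, hT u] with z h1 h2
    exact ⟨h1, h2⟩
  exact ⟨LinearMap.mkContinuous ⟨⟨T, hR.map_add⟩, hR.map_smul⟩ _ (bound T hR), hR⟩

end Operators

/-! ### Moments of the size -/

/-- The operator norm dominates the norms of the two columns. -/
theorem hsNormSq_le (g : SL2C) : hsNormSq g ≤ 2 * opNorm g ^ 2 := by
  have key : ∀ z w : ℂ, vnorm (g.1 *ᵥ ![z, w]) ≤ opNorm g * vnorm ![z, w] := fun z w =>
    (Matrix.toEuclideanCLM (n := Fin 2) (𝕜 := ℂ) g.1).le_opNorm (WithLp.toLp 2 ![z, w])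
  have hn : ∀ z w : ℂ, 0 ≤ vnorm (g.1 *ᵥ ![z, w]) := fun z w => norm_nonneg _
  have h1 := pow_le_pow_left₀ (hn 1 0) (key 1 0) 2
  have h2 := pow_le_pow_left₀ (hn 0 1) (key 0 1) 2
  rw [mulVec_fin_two, vnorm_fin_two, vnorm_fin_two, Real.sq_sqrt (by positivity)] at h1 h2
  simp only [mul_one, mul_zero, add_zero, zero_add, norm_one, norm_zero, one_pow, ne_eq,
    OfNat.ofNat_ne_zero, not_false_eq_true, zero_pow, Real.sqrt_one] at h1 h2
  rw [hsNormSq, coefP, coefM]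
  linarith

theorem one_le_opNorm (g : SL2C) : 1 ≤ opNorm g := by
  have h1 := hsNormSq_le g
  have h2 := two_le_hsNormSq g
  have h3 : 0 ≤ opNorm g := norm_nonneg _
  nlinarith

theorem size_le (g : SL2C) : size g ≤ 2 + 2 * Real.log (opNorm g) := by
  have h1 := one_le_opNorm g
  have h2 := Real.log_le_log (by linarith [two_le_hsNormSq g]) (hsNormSq_le g)
  rw [Real.log_mul (by norm_num) (by positivity), Real.log_pow] at h2
  rw [size]
  push_cast at h2
  linarith [Real.log_two_lt_d9]

theorem size_pow_le (g : SL2C) {p : ℝ} (hp : 0 ≤ p) {m : ℕ} (hm : (m : ℝ) ≤ p) :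
    size g ^ m ≤ 4 ^ p * (1 + Real.log (opNorm g) ^ p) := by
  have h1 := one_le_size g
  have hl : 0 ≤ Real.log (opNorm g) := Real.log_nonneg (one_le_opNorm g)
  have h4 : (0 : ℝ) ≤ 4 ^ p := by positivity
  have hlp : 0 ≤ Real.log (opNorm g) ^ p := by positivity
  have e : size g ^ m ≤ size g ^ p := by
    rw [← Real.rpow_natCast]
    exact Real.rpow_le_rpow_of_exponent_le h1 hm
  refine e.trans ?_
  rcases le_total (Real.log (opNorm g)) 1 with h | h
  · refine (Real.rpow_le_rpow (by linarith) (show size g ≤ 4 by linarith [size_le g]) hp).trans ?_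
    exact le_mul_of_one_le_right h4 (by linarith)
  · refine (Real.rpow_le_rpow (by linarith)
      (show size g ≤ 4 * Real.log (opNorm g) by linarith [size_le g]) hp).trans ?_
    rw [Real.mul_rpow (by norm_num) hl]
    gcongr
    linarith

section Moments

variable [MeasurableSpace SL2C] [BorelSpace SL2C] {μ : Measure SL2C}

theorem integrable_size_pow [IsProbabilityMeasure μ] {p : ℝ} (hp : 0 ≤ p)
    (hμ : Integrable (fun g => Real.log (opNorm g) ^ p) μ) {m : ℕ} (hm : (m : ℝ) ≤ p) :
    Integrable (fun g => size g ^ m) μ := by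
  refine (((integrable_const 1).add hμ).const_mul (4 ^ p)).mono'
    (measurable_size.pow_const m).aestronglyMeasurable (Eventually.of_forall fun g => ?_)
  rw [Real.norm_of_nonneg (pow_nonneg (zero_le_one.trans (one_le_size g)) m)]
  exact size_pow_le g hp hm

/-- The factor `min 2 (|h| size g)`, which bounds the change of `e^{i ξ σ_g}` when `ξ` is shifted by
`h`, has an integral against `size ^ m` that tends to zero with `h`. -/
theorem tendsto_integral_size_pow_mul_min {m : ℕ} (hm : Integrable (fun g => size g ^ m) μ) :
    Tendsto (fun h : ℝ => ∫ g, size g ^ m * min 2 (|h| * size g) ∂μ) (𝓝 0) (𝓝 0) := by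
  have e : (0 : ℝ) = ∫ _ : SL2C, 0 ∂μ := by simp
  conv => arg 3; rw [e]
  refine tendsto_integral_filter_of_dominated_convergence (fun g => size g ^ m * 2)
    (Eventually.of_forall fun h => ?_) (Eventually.of_forall fun h => ?_) (hm.mul_const 2)
    (Eventually.of_forall fun g => ?_)
  · exact ((measurable_size.pow_const m).mul
      (measurable_const.min (measurable_size.const_mul _))).aestronglyMeasurable
  · refine Eventually.of_forall fun g => ?_
    have h1 := one_le_size g
    rw [Real.norm_of_nonneg (by positivity)]
    gcongr
    exact min_le_left _ _
  · have hc : Continuous fun h : ℝ => size g ^ m * min 2 (|h| * size g) := by fun_prop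
    simpa using hc.tendsto 0

end Moments

/-! ### Symbols of the perturbed Markov operators -/

theorem hasDerivAt_exp_I_mul (ξ s : ℝ) : HasDerivAt (fun s : ℝ => Complex.exp (Complex.I * ξ * s))
    (Complex.exp (Complex.I * ξ * s) * (Complex.I * ξ)) s := by
  have h1 : HasDerivAt (fun s : ℝ => Complex.I * ξ * (s : ℂ)) (Complex.I * ξ * 1) s :=
    (Complex.ofRealCLM.hasDerivAt (x := s)).const_mul _
  simpa using h1.cexp

theorem norm_exp_I_mul_mul (ξ s : ℝ) : ‖Complex.exp (Complex.I * ξ * s)‖ = 1 := by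
  rw [mul_assoc, ← Complex.ofReal_mul, Complex.norm_exp_I_mul_ofReal]

theorem contDiff_markovSymbol (k : ℕ) (ξ : ℝ) : ContDiff ℝ ∞ (markovSymbol k ξ) := by
  have h : ContDiff ℝ ∞ fun s : ℝ => (s : ℂ) := Complex.ofRealCLM.contDiff
  exact ((contDiff_const.mul h).pow k).mul (contDiff_const.mul h).cexp

theorem norm_markovSymbol (k : ℕ) (ξ s : ℝ) : ‖markovSymbol k ξ s‖ = |s| ^ k := by
  rw [markovSymbol, norm_mul, norm_exp_I_mul_mul, norm_pow, norm_mul, Complex.norm_I,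
    Complex.norm_real, Real.norm_eq_abs, one_mul, mul_one]

theorem norm_deriv_markovSymbol_le (k : ℕ) (ξ : ℝ) {s x : ℝ} (hs : |s| ≤ x) (hx : 1 ≤ x) :
    ‖deriv (markovSymbol k ξ) s‖ ≤ (k + |ξ|) * x ^ k := by
  have h1 : HasDerivAt (fun s : ℝ => (Complex.I * (s : ℂ)) ^ k)
      (k * (Complex.I * (s : ℂ)) ^ (k - 1) * Complex.I) s := by
    have := ((Complex.ofRealCLM.hasDerivAt (x := s)).const_mul Complex.I).fun_pow k
    simpa using this
  have h2 : deriv (markovSymbol k ξ) s = _ := (h1.mul (hasDerivAt_exp_I_mul ξ s)).deriv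
  have h3 : |s| ^ (k - 1) ≤ x ^ k :=
    (pow_le_pow_left₀ (abs_nonneg s) hs _).trans (pow_le_pow_right₀ hx (Nat.sub_le k 1))
  rw [h2]
  refine (norm_add_le _ _).trans ?_
  simp only [norm_mul, norm_pow, norm_exp_I_mul_mul, Complex.norm_I, Complex.norm_real,
    Real.norm_eq_abs, one_mul, mul_one, Complex.norm_natCast]
  rw [add_mul, mul_comm (|s| ^ k)]
  gcongr

theorem markovSymbol_sub (k : ℕ) (ξ h s : ℝ) : markovSymbol k (ξ + h) s - markovSymbol k ξ s
    = markovSymbol k ξ s * (Complex.exp (Complex.I * h * s) - 1) := by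
  have : Complex.I * ((ξ + h : ℝ) : ℂ) * s = Complex.I * ξ * s + Complex.I * h * s := by
    push_cast; ring
  rw [markovSymbol, this, Complex.exp_add, markovSymbol]
  ring

theorem markovSymbol_succ (k : ℕ) (ξ s : ℝ) :
    markovSymbol (k + 1) ξ s = markovSymbol k ξ s * (Complex.I * s) := by
  rw [markovSymbol, markovSymbol]; ring

theorem norm_exp_sub_one_le (h s : ℝ) :
    ‖Complex.exp (Complex.I * h * s) - 1‖ ≤ min 2 (|h| * |s|) := by
  refine le_min ?_ ?_
  · refine (norm_sub_le _ _).trans ?_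
    rw [norm_exp_I_mul_mul, norm_one]
    norm_num
  · rw [mul_assoc, ← Complex.ofReal_mul]
    refine Real.norm_exp_I_mul_ofReal_sub_one_le.trans ?_
    rw [Real.norm_eq_abs, abs_mul]

theorem contDiff_exp_sub_one (h : ℝ) :
    ContDiff ℝ ∞ fun s : ℝ => Complex.exp (Complex.I * h * s) - 1 := by
  have h1 : ContDiff ℝ ∞ fun s : ℝ => (s : ℂ) := Complex.ofRealCLM.contDiff
  exact (contDiff_const.mul h1).cexp.sub contDiff_const

theorem norm_deriv_exp_sub_one (h s : ℝ) :
    ‖deriv (fun s : ℝ => Complex.exp (Complex.I * h * s) - 1) s‖ = |h| := by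
  rw [((hasDerivAt_exp_I_mul h s).sub_const 1).deriv, norm_mul, norm_exp_I_mul_mul, norm_mul,
    Complex.norm_I, Complex.norm_real, Real.norm_eq_abs, one_mul, one_mul]

/-- The error in the difference quotient of `ξ ↦ e^{i ξ s}` at `ξ = 0`. -/
def expSlopeError (h s : ℝ) : ℂ :=
  (h : ℂ)⁻¹ * (Complex.exp (Complex.I * h * s) - 1) - Complex.I * s

theorem contDiff_expSlopeError (h : ℝ) : ContDiff ℝ ∞ (expSlopeError h) := by
  have h1 : ContDiff ℝ ∞ fun s : ℝ => (s : ℂ) := Complex.ofRealCLM.contDiff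
  exact (contDiff_const.mul (contDiff_exp_sub_one h)).sub (contDiff_const.mul h1)

theorem hasDerivAt_expSlopeError {h : ℝ} (hh : h ≠ 0) (s : ℝ) : HasDerivAt (expSlopeError h)
    (Complex.I * (Complex.exp (Complex.I * h * s) - 1)) s := by
  have h1 := (((hasDerivAt_exp_I_mul h s).sub_const 1).const_mul (h : ℂ)⁻¹).sub
    ((Complex.ofRealCLM.hasDerivAt (x := s)).const_mul Complex.I)
  refine h1.congr_deriv ?_
  have : (h : ℂ) ≠ 0 := by exact_mod_cast hh
  simp only [Complex.ofRealCLM_apply, Complex.ofReal_one]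
  field_simp

theorem norm_deriv_expSlopeError_le {h : ℝ} (hh : h ≠ 0) (s : ℝ) :
    ‖deriv (expSlopeError h) s‖ ≤ min 2 (|h| * |s|) := by
  rw [(hasDerivAt_expSlopeError hh s).deriv, norm_mul, Complex.norm_I, one_mul]
  exact norm_exp_sub_one_le h s

theorem norm_expSlopeError_le {h : ℝ} (hh : h ≠ 0) (s : ℝ) :
    ‖expSlopeError h s‖ ≤ min 2 (|h| * |s|) * |s| := by
  have h0 : expSlopeError h 0 = 0 := by simp [expSlopeError]
  have := (convex_closedBall (0 : ℝ) |s|).norm_image_sub_le_of_norm_hasDerivWithin_le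
    (f := expSlopeError h) (C := min 2 (|h| * |s|)) (x := 0) (y := s)
    (fun t _ => (hasDerivAt_expSlopeError hh t).hasDerivWithinAt) (fun t ht => ?_)
    (by simp) (by simp)
  · simpa [h0] using this
  · have ht' : |t| ≤ |s| := by simpa using ht
    rw [← (hasDerivAt_expSlopeError hh t).deriv]
    refine (norm_deriv_expSlopeError_le hh t).trans ?_
    gcongr

theorem min_size_pos {h : ℝ} (hh : h ≠ 0) (g : SL2C) : 0 < min 2 (|h| * size g) :=
  lt_min two_pos (mul_pos (abs_pos.2 hh) (zero_lt_one.trans_le (one_le_size g)))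

section Admissible

variable [MeasurableSpace SL2C] [BorelSpace SL2C] {μ : Measure SL2C}

/-- The symbols `(i s)^k e^{i ξ s} φ(s)`, where `φ` and `φ'` are bounded by `c g` on the range of
`σ_g`. Each derivative of the symbol and each factor `s` costs at most one power of the size. -/
theorem AdmissibleSymbol.markovSymbol_mul (k : ℕ) (ξ : ℝ) {φ : ℝ → ℂ} (hφ : ContDiff ℝ ∞ φ)
    {c : SL2C → ℝ} (mc : Measurable c) (hc0 : ∀ g, 0 < c g)
    (hint : Integrable (fun g => size g ^ (k + 1) * c g) μ)
    (hφc : ∀ g s, |s| ≤ size g → ‖φ s‖ ≤ c g ∧ ‖deriv φ s‖ ≤ c g) :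
    AdmissibleSymbol μ (fun s => markovSymbol k ξ s * φ s)
      ((1 + k + |ξ|) * ∫ g, size g ^ (k + 1) * c g ∂μ) := by
  have e : ∀ g, (1 + k + |ξ|) * (size g ^ k * c g) * size g
      = (1 + k + |ξ|) * (size g ^ (k + 1) * c g) := fun g => by ring
  refine ⟨(contDiff_markovSymbol k ξ).mul hφ,
    fun g => (1 + k + |ξ|) * (size g ^ k * c g),
    ((measurable_size.pow_const k).mul mc).const_mul _, fun g => ?_, ?_, ?_, fun g s hs => ?_⟩
  · have := one_le_size g
    have := hc0 g
    positivity
  · simp only [e]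
    exact hint.const_mul _
  · simp only [e]
    rw [integral_const_mul]
  · have h1 := one_le_size g
    have hs' : |s| ≤ size g := by rw [size]; linarith
    obtain ⟨b1, b2⟩ := hφc g s hs'
    have b3 : ‖markovSymbol k ξ s‖ ≤ size g ^ k := by
      rw [norm_markovSymbol]
      gcongr
    have b4 := norm_deriv_markovSymbol_le k ξ hs' h1
    have hc := hc0 g
    constructor
    · rw [norm_mul]
      calc ‖markovSymbol k ξ s‖ * ‖φ s‖ ≤ size g ^ k * c g := by gcongr
        _ ≤ _ := le_mul_of_one_le_left (by positivity) (by
            have : 0 ≤ |ξ| := abs_nonneg ξ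
            have : (0 : ℝ) ≤ k := Nat.cast_nonneg k
            linarith)
    · have d1 : DifferentiableAt ℝ (markovSymbol k ξ) s :=
        ((contDiff_markovSymbol k ξ).differentiable (by simp)) s
      have d2 : DifferentiableAt ℝ φ s := (hφ.differentiable (by simp)) s
      have d3 : deriv (fun s => markovSymbol k ξ s * φ s) s = _ :=
        (d1.hasDerivAt.mul d2.hasDerivAt).deriv
      rw [d3]
      refine (norm_add_le _ _).trans ?_
      rw [norm_mul, norm_mul]
      calc ‖deriv (markovSymbol k ξ) s‖ * ‖φ s‖ + ‖markovSymbol k ξ s‖ * ‖deriv φ s‖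
          ≤ (k + |ξ|) * size g ^ k * c g + size g ^ k * c g := by gcongr
        _ = _ := by ring

theorem admissibleSymbol_markovSymbol (k : ℕ) (ξ : ℝ)
    (hint : Integrable (fun g => size g ^ (k + 1)) μ) :
    ∃ β, AdmissibleSymbol μ (markovSymbol k ξ) β := by
  have := AdmissibleSymbol.markovSymbol_mul (μ := μ) k ξ (φ := fun _ => 1) contDiff_const
    (c := fun _ => 1) measurable_const (fun _ => one_pos) (by simpa using hint)
    (fun g s _ => by simp)
  simp only [mul_one] at this
  exact ⟨_, this⟩

theorem measurable_min_size (h : ℝ) : Measurable fun g : SL2C => min 2 (|h| * size g) :=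
  measurable_const.min (measurable_size.const_mul _)

theorem integrable_size_pow_mul_min {m : ℕ} (hint : Integrable (fun g => size g ^ m) μ) (h : ℝ) :
    Integrable (fun g => size g ^ m * min 2 (|h| * size g)) μ := by
  refine hint.mul_bdd (c := 2) (measurable_min_size h).aestronglyMeasurable
    (Eventually.of_forall fun g => ?_)
  have := one_le_size g
  rw [Real.norm_of_nonneg (by positivity)]
  exact min_le_left _ _

theorem admissibleSymbol_sub (k : ℕ) (ξ : ℝ) {h : ℝ} (hh : h ≠ 0) (hh2 : |h| ≤ 2)
    (hint : Integrable (fun g => size g ^ (k + 1)) μ) :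
    AdmissibleSymbol μ (markovSymbol k (ξ + h) - markovSymbol k ξ)
      ((1 + k + |ξ|) * ∫ g, size g ^ (k + 1) * min 2 (|h| * size g) ∂μ) := by
  have e : markovSymbol k (ξ + h) - markovSymbol k ξ
      = fun s => markovSymbol k ξ s * (Complex.exp (Complex.I * h * s) - 1) := by
    ext s; exact markovSymbol_sub k ξ h s
  rw [e]
  refine AdmissibleSymbol.markovSymbol_mul k ξ (contDiff_exp_sub_one h) (measurable_min_size h)
    (min_size_pos hh) (integrable_size_pow_mul_min hint h) fun g s hs => ⟨?_, ?_⟩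
  · refine (norm_exp_sub_one_le h s).trans ?_
    gcongr
  · rw [norm_deriv_exp_sub_one]
    exact le_min hh2 (le_mul_of_one_le_right (abs_nonneg h) (one_le_size g))

theorem admissibleSymbol_slope_sub (k : ℕ) (ξ : ℝ) {h : ℝ} (hh : h ≠ 0)
    (hint : Integrable (fun g => size g ^ (k + 2)) μ) :
    AdmissibleSymbol μ ((h : ℂ)⁻¹ • (markovSymbol k (ξ + h) - markovSymbol k ξ)
        - markovSymbol (k + 1) ξ)
      ((1 + k + |ξ|) * ∫ g, size g ^ (k + 2) * min 2 (|h| * size g) ∂μ) := by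
  have e : (h : ℂ)⁻¹ • (markovSymbol k (ξ + h) - markovSymbol k ξ) - markovSymbol (k + 1) ξ
      = fun s => markovSymbol k ξ s * expSlopeError h s := by
    ext s
    simp only [Pi.sub_apply, Pi.smul_apply, smul_eq_mul]
    rw [markovSymbol_sub, markovSymbol_succ, expSlopeError]
    ring
  have e2 : ∀ g, size g ^ (k + 2) * min 2 (|h| * size g)
      = size g ^ (k + 1) * (size g * min 2 (|h| * size g)) := fun g => by ring
  have hint2 := integrable_size_pow_mul_min hint h
  simp only [e2] at hint2 ⊢
  rw [e]
  refine AdmissibleSymbol.markovSymbol_mul k ξ (contDiff_expSlopeError h)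
    (measurable_size.mul (measurable_min_size h))
    (fun g => mul_pos (zero_lt_one.trans_le (one_le_size g)) (min_size_pos hh g))
    hint2 fun g s hs => ?_
  have h1 := one_le_size g
  have hm : min 2 (|h| * |s|) ≤ min 2 (|h| * size g) := by gcongr
  have hm0 := (min_size_pos hh g).le
  constructor
  · refine (norm_expSlopeError_le hh s).trans ?_
    rw [mul_comm]
    gcongr
  · exact (norm_deriv_expSlopeError_le hh s).trans (hm.trans (le_mul_of_one_le_left hm0 h1))

/-! ### Regularity of the family of operators -/

/-- A family of operators given by the symbols `(i s)^k e^{i ξ s}` is continuous in `ξ`. -/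
theorem continuous_of_represents [SFinite μ] {k : ℕ} {T : ℝ → W12 →L[ℂ] W12}
    (hint : Integrable (fun g => size g ^ (k + 1)) μ)
    (hT : ∀ ξ, Represents μ (markovSymbol k ξ) (T ξ)) : Continuous T := by
  obtain ⟨C, hC0, hC⟩ := exists_represents
  refine continuous_iff_continuousAt.2 fun ξ => ?_
  rw [ContinuousAt, ← map_add_left_nhds_zero ξ, tendsto_map'_iff, tendsto_iff_norm_sub_tendsto_zero]
  have hlim := ((tendsto_integral_size_pow_mul_min hint).const_mul (1 + k + |ξ|)).const_mul C
  rw [mul_zero, mul_zero] at hlim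
  refine squeeze_zero' (Eventually.of_forall fun h => norm_nonneg _) ?_ hlim
  filter_upwards [Metric.closedBall_mem_nhds (0 : ℝ) two_pos] with h hh
  have hh2 : |h| ≤ 2 := by simpa using hh
  by_cases h0 : h = 0
  · simp [h0]
  · exact (hC μ _ _ (admissibleSymbol_sub k ξ h0 hh2 hint)).2 _ ((hT (ξ + h)).sub (hT ξ))

/-- A family of operators given by the symbols `(i s)^k e^{i ξ s}` is differentiable in `ξ`, and its
derivative is given by the symbols `(i s)^{k + 1} e^{i ξ s}`. -/
theorem hasDerivAt_of_represents [SFinite μ] {k : ℕ} {T : ℝ → W12 →L[ℂ] W12} {T' : W12 →L[ℂ] W12}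
    {ξ : ℝ} (hint : Integrable (fun g => size g ^ (k + 2)) μ)
    (hT : ∀ ξ, Represents μ (markovSymbol k ξ) (T ξ))
    (hT' : Represents μ (markovSymbol (k + 1) ξ) T') : HasDerivAt T T' ξ := by
  obtain ⟨C, hC0, hC⟩ := exists_represents
  have hlim := ((tendsto_integral_size_pow_mul_min hint).const_mul (1 + k + |ξ|)).const_mul C
  rw [mul_zero, mul_zero] at hlim
  refine HasFDerivAt.of_isLittleO (Asymptotics.isLittleO_iff.2 fun c hc => ?_)
  rw [← map_add_left_nhds_zero ξ, eventually_map]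
  filter_upwards [hlim.eventually_le_const hc] with h hle
  rw [add_sub_cancel_left, ContinuousLinearMap.toSpanSingleton_apply]
  by_cases h0 : h = 0
  · simp [h0]
  have h0' : (h : ℂ) ≠ 0 := by exact_mod_cast h0
  -- after division by `h`, the remainder is the operator with symbol `(i s)^k e^{i ξ s}` times the
  -- error in the difference quotient of the exponential
  have e : T (ξ + h) - T ξ - h • T' = (h : ℂ) • ((h : ℂ)⁻¹ • (T (ξ + h) - T ξ) - T') := by
    rw [smul_sub, smul_inv_smul₀ h0', Complex.coe_smul]
  rw [e, norm_smul, Complex.norm_real, mul_comm]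
  gcongr
  exact ((hC μ _ _ (admissibleSymbol_slope_sub k ξ h0 hint)).2 _
    ((((hT (ξ + h)).sub (hT ξ)).smul _).sub hT')).trans hle

theorem Represents.perturbedMarkov [SFinite μ] {k : ℕ} {ξ : ℝ} {T : W12 → W12}
    (hT : Represents μ (markovSymbol k ξ) T) (u : W12) : ∀ᵐ x ∂fubiniStudy,
      Integrable (perturbedIntegrand k ξ u x) μ ∧ T u x = perturbedMarkov μ k ξ u x := by
  rw [ae_fubiniStudy_iff]
  filter_upwards [hT u, ae_ae_mobDen_ne_zero μ] with z h1 h2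
  have e : (fun g => twist (markovSymbol k ξ) (u ∘ chart 0) g z)
      =ᵐ[μ] perturbedIntegrand k ξ u (chart 0 z) := by
    filter_upwards [h2] with g hg
    exact (perturbedIntegrand_chart_zero k ξ u g hg).symm
  exact ⟨h1.1.congr e, h1.2.trans (integral_congr_ae e)⟩

end Admissible

end SobolevP1

end

/-- In the first conjunct the classes `T k ξ u` are given by the integrals defining `𝒫_ξ^{(k)} u`,
so that `T k ξ` is the operator `𝒫_ξ^{(k)}` on `W^{1,2}`; continuity and differentiability are for
the operator norm. -/
theorem mainTheorem7 [MeasurableSpace SobolevP1.SL2C] [BorelSpace SobolevP1.SL2C]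
    (μ : Measure SobolevP1.SL2C) [IsProbabilityMeasure μ] (p : ℝ) (hp : 1 ≤ p)
    (hμ : Integrable (fun g => Real.log (SobolevP1.opNorm g) ^ p) μ) :
    ∃ T : ℕ → ℝ → (SobolevP1.W12 →L[ℂ] SobolevP1.W12),
      (∀ k ≤ ⌊p - 1⌋₊, ∀ (ξ : ℝ) (u : SobolevP1.W12), ∀ᵐ x ∂SobolevP1.fubiniStudy,
        Integrable (SobolevP1.perturbedIntegrand k ξ u x) μ ∧
          T k ξ u x = SobolevP1.perturbedMarkov μ k ξ u x) ∧
      Continuous (T 0) ∧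
      (2 ≤ p → ∀ k < ⌊p - 1⌋₊, ∀ ξ : ℝ, HasDerivAt (T k) (T (k + 1) ξ) ξ) := by
  have hp0 : 0 ≤ p - 1 := by linarith
  have hcast : ∀ k ≤ ⌊p - 1⌋₊, ((k + 1 : ℕ) : ℝ) ≤ p := fun k hk => by
    have := (Nat.le_floor_iff hp0).1 hk
    push_cast
    linarith
  have hint : ∀ k ≤ ⌊p - 1⌋₊, Integrable (fun g => SobolevP1.size g ^ (k + 1)) μ := fun k hk =>
    SobolevP1.integrable_size_pow (by linarith) hμ (hcast k hk)
  -- outside the range of `k` where the averages converge, the operator is irrelevant and set to `0`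
  have hex : ∀ (k : ℕ) (ξ : ℝ), ∃ T : SobolevP1.W12 →L[ℂ] SobolevP1.W12, k ≤ ⌊p - 1⌋₊ →
      SobolevP1.Represents μ (SobolevP1.markovSymbol k ξ) T := fun k ξ => by
    by_cases hk : k ≤ ⌊p - 1⌋₊
    · obtain ⟨C, -, hC⟩ := SobolevP1.exists_represents
      obtain ⟨β, hβ⟩ := SobolevP1.admissibleSymbol_markovSymbol k ξ (hint k hk)
      obtain ⟨T, hT⟩ := (hC μ _ β hβ).1
      exact ⟨T, fun _ => hT⟩
    · exact ⟨0, fun h => absurd h hk⟩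
  choose T hT using hex
  exact ⟨T, fun k hk ξ u => (hT k ξ hk).perturbedMarkov u,
    SobolevP1.continuous_of_represents (hint 0 (Nat.zero_le _)) fun ξ => hT 0 ξ (Nat.zero_le _),
    fun _ k hk ξ => SobolevP1.hasDerivAt_of_represents (hint (k + 1) hk)
      (fun ξ => hT k ξ hk.le) (hT (k + 1) ξ hk)⟩
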